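/- **Setting.** All rings are unital and associative. A *left bialgebroid* $\mathcal H_L=(H,L,s_L,t_L,\gamma_L,\pi_L)$ consists of rings $H,L$, ring maps $s_L:L\to H$ and $t_L:L^{op}\to H$ with commuting ranges, and a comonoid $(H,\gamma_L,\pi_L)$ in $L$-$L$-bimodules, where $l\cdot h\cdot l'=s_L(l)t_L(l')h$, such that $\gamma_L(h)=h_{(1)}\otimes h_{(2)}$ satisfies $h_{(1)}t_L(l)\otimes h_{(2)}=h_{(1)}\otimes h_{(2)}s_L(l)$, $\gamma_L$ is multiplicative and unital, $\pi_L(1)=1$ and $\pi_L(h\,s_L\pi_L(k))=\pi_L(hk)=\pi_L(h\,t_L\pi_L(k))$. A *right bialgebroid* $\mathcal H_R=(H,R,s_R,t_R,\gamma_R,\pi_R)$ is defined symmetrically, with $r\cdot h\cdot r'=h\,s_R(r')t_R(r)$, $\gamma_R(h)=h^{(1)}\otimes h^{(2)}$, $s_R(r)h^{(1)}\otimes h^{(2)}=h^{(1)}\otimes t_R(r)h^{(2)}$ and $\pi_R(s_R\pi_R(h)\,k)=\pi_R(hk)=\pi_R(t_R\pi_R(h)\,k)$. A *Hopf algebroid*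 $\mathcal H=(\mathcal H_L,\mathcal H_R,S)$ consists of a left and a right bialgebroid on the same ring $H$ with $R\cong L^{op}$, $s_L(L)=t_R(R^{op})$, $t_L(L^{op})=s_R(R)$, $(\gamma_L\otimes\mathrm{id})\gamma_R=(\mathrm{id}\otimes\gamma_R)\gamma_L$, $(\gamma_R\otimes\mathrm{id})\gamma_L=(\mathrm{id}\otimes\gamma_L)\gamma_R$, and an additive bijection $S:H\to H$ such that $S(t_L(l)\,h\,t_L(l'))=s_L(l')S(h)s_L(l)$, $S(t_R(r')\,h\,t_R(r))=s_R(r)S(h)s_R(r')$, $S(h_{(1)})h_{(2)}=s_R\pi_R(h)$ and $h^{(1)}S(h^{(2)})=s_L\pi_L(h)$. Let $\mathcal H$ be a Hopf algebroid and let $i\in H$ be a *non-degenerate right integral*: $ih=i\,s_R\pi_R(h)$ for all $h\in H$, and the maps $${}_Li:{}_*\mathcal H=\mathrm{Hom}_{L-}({}_LH,L)\to H,\ \varphi\mapsto t_L(\varphi(i_{(2)}))\,i_{(1)},\qquad i_L:\mathcal H_*=\mathrm{Hom}_{-L}(H_L,L)\to H,\ \varphi\mapsto s_L(\varphi(i_{(1)}))\,i_{(2)}$$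 are bijective. Define the convolution product $h*k={}_Li\big({}_Li^{-1}(h)\,{}_Li^{-1}(k)\big)$, where ${}_*\mathcal H$ carries the product $(\varphi\psi)(h)=\psi\big(t_L(\varphi(h_{(2)}))h_{(1)}\big)$, and $\eta:R\to H$, $\eta(r)=i\,s_R(r)$. Let $\mathcal M_H$ be the monoidal category of right $H$-modules with product $\otimes_R$ (where $r\cdot m\cdot r'=m\,s_R(r')t_R(r)$), diagonal action $(m\otimes n)h=mh^{(1)}\otimes nh^{(2)}$ and unit object $R_H$, $r\cdot h=\pi_R(s_R(r)h)$; write $l_M:R\otimes_R M\to M$ and $r_M:M\otimes_R R\to M$ for its unit constraints. Let $\mathbf{BIM}(\mathcal M_H)$ be the additive bicategory of internal bimodules: 0-cells are monoids in $\mathcal M_H$, 1-cells are bimodules, 2-cells are bimodule maps, and horizontal composition $\times$ of an $\mathcal A$-$\mathcal B$- and a $\mathcal B$-$\mathcal C$-bimodule is the tensor product over $\mathcal B$ (a coequalizer), with associator $\alpha$. Let $\mathcal U$ be the trivial monoid on $R_H$. **Claim.** The triple $\mathcal Q=(H_H,*,\eta)$ is a monoid in $\mathcal M_H$. The $\mathcal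 U$-$\mathcal Q$-bimodule $\mathcal X=(H_H,l_H,*)$ is a Frobenius 1-morphism of $\mathbf{BIM}(\mathcal M_H)$ with two-sided dual the $\mathcal Q$-$\mathcal U$-bimodule $\bar{\mathcal X}=(H_H,*,r_H)$. Explicitly, let $t:\mathcal X\times\bar{\mathcal X}\cong(H_H,l_H,r_H)$ be the isomorphism induced by $*$, and identify the object underlying $\bar{\mathcal X}\times\mathcal X$ with $H_H\otimes_R H_H$. Then $$\mathrm{ev}_L=*:\bar{\mathcal X}\times\mathcal X\to\mathcal Q,\qquad \mathrm{coev}_L=t^{-1}\circ\eta:\mathcal U\to\mathcal X\times\bar{\mathcal X},$$ $$\mathrm{ev}_R=\pi_R\circ t:\mathcal X\times\bar{\mathcal X}\to\mathcal U,\qquad \mathrm{coev}_R=\gamma_R:\mathcal Q\to\bar{\mathcal X}\times\mathcal X$$ are 2-cells, where $\mathcal Q$ and $\mathcal U$ stand for the regular bimodules (the identity 1-cells); $(\mathrm{coev}_L,\mathrm{ev}_L)$ are unit and counit of an adjunction between $\mathcal X$ and $\bar{\mathcal X}$, and $(\mathrm{coev}_R,\mathrm{ev}_R)$ are unit and counit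 of an adjunction between $\bar{\mathcal X}$ and $\mathcal X$. Moreover $\mathcal X$ satisfies the D2 condition on both sides: $(\mathcal X\times\bar{\mathcal X})\times\mathcal X$ is a direct summand of a finite direct sum of copies of $\mathcal X$, and $(\bar{\mathcal X}\times\mathcal X)\times\bar{\mathcal X}$ is a direct summand of a finite direct sum of copies of $\bar{\mathcal X}$. Finally, let $\Lambda(h)$ be the 2-endomorphism of $\mathcal X\times\bar{\mathcal X}$ that corresponds under $t$ to left multiplication $k\mapsto hk$ on $H_H$. Let $A$ be the ring of 2-endomorphisms of $\mathcal X\times\bar{\mathcal X}$ and $E$ the ring of 2-endomorphisms of $\mathcal X$, acting on $A$ by $a\cdot e=a\circ(e\times\bar{\mathcal X})$ and $e\cdot a=(e\times\bar{\mathcal X})\circ a$. Then the element $$\Lambda(S(i_{(1)}))\otimes\Lambda(i_{(2)})\in A\otimes_EA$$ is well defined (it does not depend on how $\gamma_L(i)=i_{(1)}\otimes i_{(2)}$ is written as a finite sum of elementary tensors), and it is a D2 quasi-basis for $\mathcal X$: whenever it is written as $\sum_j y_j\otimes x_j$, $$\sum_j (y_j\times\mathcal X)\circ\alpha^{-1}\circ(\mathcal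 X\times\mathrm{coev}_R)\circ(\mathcal X\times\mathrm{ev}_L)\circ\alpha\circ(x_j\times\mathcal X)=\mathrm{id}_{(\mathcal X\times\bar{\mathcal X})\times\mathcal X}.$$ -/

import Mathlib

open CategoryTheory MonoidalCategory MulOpposite
open scoped TensorProduct

universe u v w

section BalancedTensor

variable {R : Type*} {R' : Type*} {M : Type*} {N : Type*} {P : Type*} {T : Type*}
  [AddCommGroup M] [AddCommGroup N] [AddCommGroup P] [AddCommGroup T]

/-- The additive map out of `M ⊗_ℤ N` induced by a biadditive map. -/
def intLift (f : M →+ N →+ P) : M ⊗[ℤ] N →+ P :=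
  TensorProduct.liftAddHom f (by intro r m n; simp)

@[simp] theorem intLift_tmul (f : M →+ N →+ P) (m : M) (n : N) :
    intLift f (m ⊗ₜ[ℤ] n) = f m n := rfl

theorem intTensor_hom_ext {f g : M ⊗[ℤ] N →+ P} (h : ∀ m n, f (m ⊗ₜ n) = g (m ⊗ₜ n)) : f = g := by
  ext z
  induction z using TensorProduct.induction_on with
  | zero => simp
  | tmul m n => exact h m n
  | add a b ha hb => rw [map_add, map_add, ha, hb]

/-- The relations `m·r ⊗ n = m ⊗ r·n`. -/
def balRel (ρ : R → M →+ M) (l : R → N →+ N) : Submodule ℤ (M ⊗[ℤ] N) :=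
  Submodule.span ℤ {z | ∃ r m n, z = ρ r m ⊗ₜ[ℤ] n - m ⊗ₜ[ℤ] l r n}

/-- The balanced tensor product `M ⊗_R N` of a right `R`-module `M` and a left `R`-module `N`,
`R` not necessarily commutative. The actions are explicit arguments, since the total ring of a
Hopf algebroid carries several module structures over the same base ring:
`ρ r m` is `m·r` and `l r n` is `r·n`. -/
def BalTensor (ρ : R → M →+ M) (l : R → N →+ N) : Type _ := (M ⊗[ℤ] N) ⧸ balRel ρ l

instance (ρ : R → M →+ M) (l : R → N →+ N) : AddCommGroup (BalTensor ρ l) :=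
  inferInstanceAs (AddCommGroup ((M ⊗[ℤ] N) ⧸ balRel ρ l))

namespace BalTensor

variable {ρ : R → M →+ M} {l : R → N →+ N}

/-- The class of `m ⊗ n` in `M ⊗_R N`. -/
def tmul (ρ : R → M →+ M) (l : R → N →+ N) (m : M) (n : N) : BalTensor ρ l :=
  Submodule.Quotient.mk (p := balRel ρ l) (m ⊗ₜ[ℤ] n)

theorem add_tmul (m m' : M) (n : N) : tmul ρ l (m + m') n = tmul ρ l m n + tmul ρ l m' n := by
  simp only [tmul, TensorProduct.add_tmul]; rfl

theorem tmul_add (m : M) (n n' : N) : tmul ρ l m (n + n') = tmul ρ l m n + tmul ρ l m n' := by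
  simp only [tmul, TensorProduct.tmul_add]; rfl

theorem smul_tmul (r : R) (m : M) (n : N) : tmul ρ l (ρ r m) n = tmul ρ l m (l r n) :=
  (Submodule.Quotient.eq _).2 (Submodule.subset_span ⟨r, m, n, rfl⟩)

/-- `tmul` as a biadditive map. -/
def tmulHom (ρ : R → M →+ M) (l : R → N →+ N) : M →+ N →+ BalTensor ρ l :=
  AddMonoidHom.mk' (fun m => AddMonoidHom.mk' (fun n => tmul ρ l m n) (tmul_add m))
    (fun m m' => by ext n; exact add_tmul m m' n)

@[simp] theorem tmulHom_apply (m : M) (n : N) : tmulHom ρ l m n = tmul ρ l m n := rfl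

theorem zero_tmul (n : N) : tmul ρ l 0 n = 0 := by
  rw [← tmulHom_apply, map_zero]; rfl

theorem tmul_zero (m : M) : tmul ρ l m 0 = 0 := by
  rw [← tmulHom_apply, map_zero]

theorem sum_tmul {ι : Type*} (s : Finset ι) (f : ι → M) (n : N) :
    tmul ρ l (∑ j ∈ s, f j) n = ∑ j ∈ s, tmul ρ l (f j) n := by
  simp only [← tmulHom_apply, map_sum, AddMonoidHom.finsetSum_apply]

theorem tmul_sum {ι : Type*} (s : Finset ι) (m : M) (f : ι → N) :
    tmul ρ l m (∑ j ∈ s, f j) = ∑ j ∈ s, tmul ρ l m (f j) := by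
  simp only [← tmulHom_apply, map_sum]

/-- The universal property of the balanced tensor product. -/
def lift (f : M →+ N →+ P) (hf : ∀ r m n, f (ρ r m) n = f m (l r n)) : BalTensor ρ l →+ P :=
  ((balRel ρ l).liftQ
    (intLift f).toIntLinearMap (by
      rw [balRel, Submodule.span_le]
      rintro _ ⟨r, m, n, rfl⟩
      simp [hf r m n])).toAddMonoidHom

@[simp] theorem lift_tmul (f : M →+ N →+ P) (hf : ∀ r m n, f (ρ r m) n = f m (l r n))
    (m : M) (n : N) : lift f hf (tmul ρ l m n) = f m n := rfl

theorem exists_rep (q : BalTensor ρ l) :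
    ∃ (n : ℕ) (x : Fin n → M) (y : Fin n → N), q = ∑ j, tmul ρ l (x j) (y j) := by
  obtain ⟨z, rfl⟩ := Submodule.Quotient.mk_surjective (balRel ρ l) q
  induction z using TensorProduct.induction_on with
  | zero => exact ⟨0, Fin.elim0, Fin.elim0, by simp; rfl⟩
  | tmul m n => exact ⟨1, fun _ => m, fun _ => n, by simp; rfl⟩
  | add a b ha hb =>
    obtain ⟨n, x, y, h⟩ := ha
    obtain ⟨n', x', y', h'⟩ := hb
    refine ⟨n + n', Fin.append x x', Fin.append y y', ?_⟩
    rw [Fin.sum_univ_add]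
    simp only [Fin.append_left, Fin.append_right]
    rw [← h, ← h']; rfl

theorem hom_ext {f g : BalTensor ρ l →+ P} (h : ∀ m n, f (tmul ρ l m n) = g (tmul ρ l m n)) :
    f = g := by
  ext q
  obtain ⟨n, x, y, rfl⟩ := exists_rep q
  simp [map_sum, h]

end BalTensor

/-- The relations `m·r ⊗ n ⊗ p = m ⊗ r·n ⊗ p` and `m ⊗ n·r' ⊗ p = m ⊗ n ⊗ r'·p`. -/
def balRel₃ (ρ₁ : R → M →+ M) (l₂ : R → N →+ N) (ρ₂ : R' → N →+ N) (l₃ : R' → P →+ P) :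
    Submodule ℤ (M ⊗[ℤ] (N ⊗[ℤ] P)) :=
  Submodule.span ℤ
    ({z | ∃ r m n p, z = ρ₁ r m ⊗ₜ[ℤ] (n ⊗ₜ[ℤ] p) - m ⊗ₜ[ℤ] (l₂ r n ⊗ₜ[ℤ] p)} ∪
      {z | ∃ r m n p, z = m ⊗ₜ[ℤ] (ρ₂ r n ⊗ₜ[ℤ] p) - m ⊗ₜ[ℤ] (n ⊗ₜ[ℤ] l₃ r p)})

/-- The threefold balanced tensor product `M ⊗_R N ⊗_{R'} P`. -/
def BalTensor₃ (ρ₁ : R → M →+ M) (l₂ : R → N →+ N) (ρ₂ : R' → N →+ N) (l₃ : R' → P →+ P) :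
    Type _ := (M ⊗[ℤ] (N ⊗[ℤ] P)) ⧸ balRel₃ ρ₁ l₂ ρ₂ l₃

instance (ρ₁ : R → M →+ M) (l₂ : R → N →+ N) (ρ₂ : R' → N →+ N) (l₃ : R' → P →+ P) :
    AddCommGroup (BalTensor₃ ρ₁ l₂ ρ₂ l₃) :=
  inferInstanceAs (AddCommGroup ((M ⊗[ℤ] (N ⊗[ℤ] P)) ⧸ balRel₃ ρ₁ l₂ ρ₂ l₃))

namespace BalTensor₃

variable (ρ₁ : R → M →+ M) (l₂ : R → N →+ N) (ρ₂ : R' → N →+ N) (l₃ : R' → P →+ P)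

/-- The class of `m ⊗ n ⊗ p` as a triadditive map. -/
def tmulHom : M →+ N →+ P →+ BalTensor₃ ρ₁ l₂ ρ₂ l₃ :=
  AddMonoidHom.mk' (fun m => AddMonoidHom.mk' (fun n => AddMonoidHom.mk' (fun p =>
      (Submodule.Quotient.mk (p := balRel₃ ρ₁ l₂ ρ₂ l₃) (m ⊗ₜ[ℤ] (n ⊗ₜ[ℤ] p)) :
        BalTensor₃ ρ₁ l₂ ρ₂ l₃))
      (fun p p' => by simp only [TensorProduct.tmul_add]; rfl))
      (fun n n' => by
        ext p; simp only [TensorProduct.tmul_add, TensorProduct.add_tmul]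
        rfl))
    (fun m m' => by
      ext n p; simp only [TensorProduct.add_tmul, AddMonoidHom.mk'_apply]; rfl)

/-- The canonical map `(M ⊗_R N) × P → M ⊗_R N ⊗_{R'} P`. -/
def assocL : BalTensor ρ₁ l₂ →+ P →+ BalTensor₃ ρ₁ l₂ ρ₂ l₃ :=
  BalTensor.lift (tmulHom ρ₁ l₂ ρ₂ l₃) (fun r m n => by
    ext p
    exact (Submodule.Quotient.eq _).2 (Submodule.subset_span (Or.inl ⟨r, m, n, p, rfl⟩)))

/-- The canonical map `M × (N ⊗_{R'} P) → M ⊗_R N ⊗_{R'} P`. -/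
def assocR : M →+ BalTensor ρ₂ l₃ →+ BalTensor₃ ρ₁ l₂ ρ₂ l₃ :=
  AddMonoidHom.mk' (fun m => BalTensor.lift (tmulHom ρ₁ l₂ ρ₂ l₃ m) (fun r n p =>
      (Submodule.Quotient.eq _).2 (Submodule.subset_span (Or.inr ⟨r, m, n, p, rfl⟩))))
    (fun m m' => BalTensor.hom_ext (fun n p => by
      simp only [map_add, AddMonoidHom.add_apply, BalTensor.lift_tmul]; rfl))

variable {ρ₁ l₂ ρ₂ l₃}

/-- The universal property of the threefold balanced tensor product. -/
def lift (f : M →+ N →+ P →+ T) (h₁ : ∀ r m n p, f (ρ₁ r m) n p = f m (l₂ r n) p)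
    (h₂ : ∀ r m n p, f m (ρ₂ r n) p = f m n (l₃ r p)) : BalTensor₃ ρ₁ l₂ ρ₂ l₃ →+ T :=
  ((balRel₃ ρ₁ l₂ ρ₂ l₃).liftQ
    (intLift (AddMonoidHom.mk' (fun m => intLift (f m)) (fun m m' =>
      intTensor_hom_ext (fun n p => by simp)))).toIntLinearMap (by
      rw [balRel₃, Submodule.span_le]
      rintro _ (⟨r, m, n, p, rfl⟩ | ⟨r, m, n, p, rfl⟩)
      · exact (map_sub _ _ _).trans (sub_eq_zero.2 (h₁ r m n p))
      · exact (map_sub _ _ _).trans (sub_eq_zero.2 (h₂ r m n p)))).toAddMonoidHom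

theorem lift_assocL (f : M →+ N →+ P →+ T) (h₁ : ∀ r m n p, f (ρ₁ r m) n p = f m (l₂ r n) p)
    (h₂ : ∀ r m n p, f m (ρ₂ r n) p = f m n (l₃ r p)) (m : M) (n : N) (p : P) :
    lift f h₁ h₂ (assocL ρ₁ l₂ ρ₂ l₃ (BalTensor.tmul ρ₁ l₂ m n) p) = f m n p := by
  rfl

theorem lift_assocR (f : M →+ N →+ P →+ T) (h₁ : ∀ r m n p, f (ρ₁ r m) n p = f m (l₂ r n) p)
    (h₂ : ∀ r m n p, f m (ρ₂ r n) p = f m n (l₃ r p)) (m : M) (n : N) (p : P) :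
    lift f h₁ h₂ (assocR ρ₁ l₂ ρ₂ l₃ m (BalTensor.tmul ρ₂ l₃ n p)) = f m n p := by
  rfl

end BalTensor₃

end BalancedTensor

section Bialgebroids

open BalTensor

/-- The right `R`-action `m·r = m s(r)` on a right `A`-module, for a ring map `s : R → A`. -/
def rightAct {A R : Type*} [Ring A] [Ring R] (s : R →+* A) (M : Type*) [AddCommGroup M]
    [Module Aᵐᵒᵖ M] (r : R) : M →+ M :=
  DistribSMul.toAddMonoidHom M (op (s r))

/-- The left `R`-action `r·m = m t(r)` on a right `A`-module, for a ring map `t : Rᵒᵖ → A`. -/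
def leftAct {A R : Type*} [Ring A] [Ring R] (t : Rᵐᵒᵖ →+* A) (M : Type*) [AddCommGroup M]
    [Module Aᵐᵒᵖ M] (r : R) : M →+ M :=
  DistribSMul.toAddMonoidHom M (op (t (op r)))

/-- A left bialgebroid `(A, L, s, t, γ, π)`. Here `A` is the `L`-`L`-bimodule
`l·a·l' = s(l) t(l') a`, and `γ` takes values in `A_L ⊗ _LA`. Identities in Sweedler notation are
required for every representation of the coproducts as finite sums of elementary tensors. -/
structure LeftBialgebroid (A : Type*) (L : Type*) [Ring A] [Ring L] where
  /-- the source map -/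
  s : L →+* A
  /-- the target map -/
  t : Lᵐᵒᵖ →+* A
  s_t_comm : ∀ l l', s l * t (op l') = t (op l') * s l
  /-- the coproduct -/
  γ : A →+ BalTensor (fun l => AddMonoidHom.mulLeft (t (op l)))
    (fun l => AddMonoidHom.mulLeft (s l))
  /-- the counit -/
  π : A →+ L
  γ_bimod : ∀ (l l' : L) (a : A) (n : ℕ) (x y : Fin n → A), γ a = ∑ j, tmul _ _ (x j) (y j) →
    γ (s l * t (op l') * a) = ∑ j, tmul _ _ (s l * x j) (t (op l') * y j)
  π_bimod : ∀ (l l' : L) (a : A), π (s l * t (op l') * a) = l * π a * l'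
  coassoc : ∀ (a : A) (n : ℕ) (x y : Fin n → A), γ a = ∑ j, tmul _ _ (x j) (y j) →
    ∑ j, BalTensor₃.assocL _ _ (fun l => AddMonoidHom.mulLeft (t (op l)))
        (fun l => AddMonoidHom.mulLeft (s l)) (γ (x j)) (y j) =
      ∑ j, BalTensor₃.assocR _ _ _ _ (x j) (γ (y j))
  counit_left : ∀ (a : A) (n : ℕ) (x y : Fin n → A), γ a = ∑ j, tmul _ _ (x j) (y j) →
    ∑ j, s (π (x j)) * y j = a
  counit_right : ∀ (a : A) (n : ℕ) (x y : Fin n → A), γ a = ∑ j, tmul _ _ (x j) (y j) →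
    ∑ j, t (op (π (y j))) * x j = a
  γ_takeuchi : ∀ (l : L) (a : A) (n : ℕ) (x y : Fin n → A), γ a = ∑ j, tmul _ _ (x j) (y j) →
    (∑ j, tmul _ _ (x j * t (op l)) (y j) : BalTensor (fun l => AddMonoidHom.mulLeft (t (op l)))
      (fun l => AddMonoidHom.mulLeft (s l))) = ∑ j, tmul _ _ (x j) (y j * s l)
  γ_one : γ 1 = tmul _ _ 1 1
  γ_mul : ∀ (a b : A) (n m : ℕ) (x y : Fin n → A) (z w : Fin m → A),
    γ a = ∑ j, tmul _ _ (x j) (y j) → γ b = ∑ k, tmul _ _ (z k) (w k) →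
      γ (a * b) = ∑ j, ∑ k, tmul _ _ (x j * z k) (y j * w k)
  π_one : π 1 = 1
  π_mul_s : ∀ a b, π (a * s (π b)) = π (a * b)
  π_mul_t : ∀ a b, π (a * t (op (π b))) = π (a * b)

/-- A right bialgebroid `(A, R, s, t, γ, π)`. Here `A` is the `R`-`R`-bimodule
`r·a·r' = a s(r') t(r)`, and `γ` takes values in `A^R ⊗ ^RA`. -/
structure RightBialgebroid (A : Type*) (R : Type*) [Ring A] [Ring R] where
  /-- the source map -/
  s : R →+* A
  /-- the target map -/
  t : Rᵐᵒᵖ →+* A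
  s_t_comm : ∀ r r', s r * t (op r') = t (op r') * s r
  /-- the coproduct -/
  γ : A →+ BalTensor (rightAct s A) (leftAct t A)
  /-- the counit -/
  π : A →+ R
  γ_bimod : ∀ (r r' : R) (a : A) (n : ℕ) (x y : Fin n → A), γ a = ∑ j, tmul _ _ (x j) (y j) →
    γ (a * s r' * t (op r)) = ∑ j, tmul _ _ (x j * t (op r)) (y j * s r')
  π_bimod : ∀ (r r' : R) (a : A), π (a * s r' * t (op r)) = r * π a * r'
  coassoc : ∀ (a : A) (n : ℕ) (x y : Fin n → A), γ a = ∑ j, tmul _ _ (x j) (y j) →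
    ∑ j, BalTensor₃.assocL _ _ (rightAct s A) (leftAct t A) (γ (x j)) (y j) =
      ∑ j, BalTensor₃.assocR _ _ _ _ (x j) (γ (y j))
  counit_left : ∀ (a : A) (n : ℕ) (x y : Fin n → A), γ a = ∑ j, tmul _ _ (x j) (y j) →
    ∑ j, y j * t (op (π (x j))) = a
  counit_right : ∀ (a : A) (n : ℕ) (x y : Fin n → A), γ a = ∑ j, tmul _ _ (x j) (y j) →
    ∑ j, x j * s (π (y j)) = a
  γ_takeuchi : ∀ (r : R) (a : A) (n : ℕ) (x y : Fin n → A), γ a = ∑ j, tmul _ _ (x j) (y j) →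
    (∑ j, tmul _ _ (s r * x j) (y j) : BalTensor (rightAct s A) (leftAct t A)) =
      ∑ j, tmul _ _ (x j) (t (op r) * y j)
  γ_one : γ 1 = tmul _ _ 1 1
  γ_mul : ∀ (a b : A) (n m : ℕ) (x y : Fin n → A) (z w : Fin m → A),
    γ a = ∑ j, tmul _ _ (x j) (y j) → γ b = ∑ k, tmul _ _ (z k) (w k) →
      γ (a * b) = ∑ j, ∑ k, tmul _ _ (x j * z k) (y j * w k)
  π_one : π 1 = 1
  π_s_mul : ∀ a b, π (s (π a) * b) = π (a * b)
  π_t_mul : ∀ a b, π (t (op (π a)) * b) = π (a * b)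

/-- A Hopf algebroid `(𝒜_L, 𝒜_R, S)` with bijective antipode: a left and a right bialgebroid on the
same total ring, and an antipode relating them. -/
structure HopfAlgebroid (A : Type*) (L : Type*) (R : Type*) [Ring A] [Ring L] [Ring R] where
  /-- the underlying left bialgebroid -/
  left : LeftBialgebroid A L
  /-- the underlying right bialgebroid -/
  right : RightBialgebroid A R
  base_iso : Nonempty (R ≃+* Lᵐᵒᵖ)
  range_sL : Set.range left.s = Set.range right.t
  range_tL : Set.range left.t = Set.range right.s
  /-- `(γ_L ⊗ id) ∘ γ_R = (id ⊗ γ_R) ∘ γ_L` in `A_L ⊗ _LA^R ⊗ ^RA` -/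
  coassoc_LR : ∀ (a : A) (n m : ℕ) (x y : Fin n → A) (z w : Fin m → A),
    right.γ a = ∑ j, tmul _ _ (x j) (y j) → left.γ a = ∑ k, tmul _ _ (z k) (w k) →
      ∑ j, BalTensor₃.assocL _ _ (rightAct right.s A) (leftAct right.t A) (left.γ (x j)) (y j) =
        ∑ k, BalTensor₃.assocR _ _ _ _ (z k) (right.γ (w k))
  /-- `(γ_R ⊗ id) ∘ γ_L = (id ⊗ γ_L) ∘ γ_R` in `A^R ⊗ ^RA_L ⊗ _LA` -/
  coassoc_RL : ∀ (a : A) (n m : ℕ) (x y : Fin n → A) (z w : Fin m → A),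
    left.γ a = ∑ j, tmul _ _ (x j) (y j) → right.γ a = ∑ k, tmul _ _ (z k) (w k) →
      ∑ j, BalTensor₃.assocL _ _ (fun l => AddMonoidHom.mulLeft (left.t (op l)))
          (fun l => AddMonoidHom.mulLeft (left.s l)) (right.γ (x j)) (y j) =
        ∑ k, BalTensor₃.assocR _ _ _ _ (z k) (left.γ (w k))
  /-- the antipode -/
  S : A ≃+ A
  S_left : ∀ (l l' : L) (a : A),
    S (left.t (op l) * a * left.t (op l')) = left.s l' * S a * left.s l
  S_right : ∀ (r r' : R) (a : A),
    S (right.t (op r') * a * right.t (op r)) = right.s r * S a * right.s r'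
  antipode_left : ∀ (a : A) (n : ℕ) (x y : Fin n → A), left.γ a = ∑ j, tmul _ _ (x j) (y j) →
    ∑ j, S (x j) * y j = right.s (right.π a)
  antipode_right : ∀ (a : A) (n : ℕ) (x y : Fin n → A), right.γ a = ∑ j, tmul _ _ (x j) (y j) →
    ∑ j, x j * S (y j) = left.s (left.π a)

end Bialgebroids

namespace LeftBialgebroid

open BalTensor

variable {A L : Type*} [Ring A] [Ring L] (B : LeftBialgebroid A L)

/-- The dual `_*𝒜` of left `L`-module maps `_LA → _LL`. -/
abbrev StarL : Type _ := {φ : A →+ L // ∀ l a, φ (B.s l * a) = l * φ a}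

/-- The dual `𝒜_*` of right `L`-module maps `A_L → L_L`. -/
abbrev LStar : Type _ := {φ : A →+ L // ∀ l a, φ (B.t (op l) * a) = φ a * l}

/-- `a ↼ φ = t(φ(a₂)) a₁` for `φ ∈ _*𝒜`. -/
def hitStarL (φ : B.StarL) (a : A) : A :=
  lift (AddMonoidHom.mk' (fun x => AddMonoidHom.mk' (fun y => B.t (op (φ.1 y)) * x)
      (fun y y' => by rw [map_add, MulOpposite.op_add, map_add, add_mul]))
      (fun x x' => by ext y; exact mul_add _ _ _))
    (fun l x y => by
      change B.t (op (φ.1 y)) * (B.t (op l) * x) = B.t (op (φ.1 (B.s l * y))) * x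
      rw [φ.2, MulOpposite.op_mul, map_mul, mul_assoc]) (B.γ a)

/-- `a ↼ φ = s(φ(a₁)) a₂` for `φ ∈ 𝒜_*`. -/
def hitLStar (φ : B.LStar) (a : A) : A :=
  lift (AddMonoidHom.mk' (fun x => AddMonoidHom.mk' (fun y => B.s (φ.1 x) * y)
      (fun y y' => mul_add _ _ _))
      (fun x x' => by
        ext y; change B.s (φ.1 (x + x')) * y = B.s (φ.1 x) * y + B.s (φ.1 x') * y
        rw [map_add, map_add, add_mul]))
    (fun l x y => by
      change B.s (φ.1 (B.t (op l) * x)) * y = B.s (φ.1 x) * (B.s l * y)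
      rw [φ.2, map_mul, mul_assoc]) (B.γ a)

theorem hitStarL_of_rep (φ : B.StarL) (a : A) {n : ℕ} (x y : Fin n → A)
    (h : B.γ a = ∑ j, tmul _ _ (x j) (y j)) :
    B.hitStarL φ a = ∑ j, B.t (op (φ.1 (y j))) * x j := by
  unfold hitStarL; rw [h, map_sum]; rfl

theorem hitLStar_of_rep (φ : B.LStar) (a : A) {n : ℕ} (x y : Fin n → A)
    (h : B.γ a = ∑ j, tmul _ _ (x j) (y j)) :
    B.hitLStar φ a = ∑ j, B.s (φ.1 (x j)) * y j := by
  unfold hitLStar; rw [h, map_sum]; rfl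

/-- The product `(φψ)(a) = ψ(a ↼ φ) = ψ(t(φ(a₂)) a₁)` of the dual ring `_*𝒜`. -/
def mulStarL (φ ψ : B.StarL) : B.StarL :=
  ⟨AddMonoidHom.mk' (fun a => ψ.1 (B.hitStarL φ a)) (fun a a' => by
      unfold hitStarL; rw [map_add, map_add, map_add]),
    fun l a => by
      obtain ⟨n, x, y, h⟩ := exists_rep (B.γ a)
      have h' := B.γ_bimod l 1 a n x y h
      simp only [MulOpposite.op_one, map_one, mul_one, one_mul] at h'
      simp only [AddMonoidHom.mk'_apply]
      rw [B.hitStarL_of_rep φ a x y h, B.hitStarL_of_rep φ _ _ _ h', ← ψ.2, Finset.mul_sum]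
      congr 1
      refine Finset.sum_congr rfl (fun j _ => ?_)
      rw [← mul_assoc, ← B.s_t_comm, mul_assoc]⟩

end LeftBialgebroid

namespace HopfAlgebroid

variable {A L R : Type*} [Ring A] [Ring L] [Ring R] (𝓗 : HopfAlgebroid A L R)

/-- `i` is a right integral: `i a = i s_R(π_R(a))` for all `a`. -/
def IsRightIntegral (i : A) : Prop := ∀ a, i * a = i * 𝓗.right.s (𝓗.right.π a)

/-- Non-degeneracy of a right integral `i`: the maps `_Li : _*𝒜 → A` and `i_L : 𝒜_* → A`,
`φ ↦ i ↼ φ`, are bijective. -/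
structure IsNondegenerate (i : A) : Prop where
  bijective_starL : Function.Bijective fun φ : 𝓗.left.StarL => 𝓗.left.hitStarL φ i
  bijective_lStar : Function.Bijective fun φ : 𝓗.left.LStar => 𝓗.left.hitLStar φ i

variable {𝓗}

/-- The convolution product `h ∗ k = _Li(_Li⁻¹(h) _Li⁻¹(k))`. -/
noncomputable def conv {i : A} (hi : 𝓗.IsNondegenerate i) (h k : A) : A :=
  𝓗.left.hitStarL (𝓗.left.mulStarL ((Equiv.ofBijective _ hi.bijective_starL).symm h)
    ((Equiv.ofBijective _ hi.bijective_starL).symm k)) i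

end HopfAlgebroid

namespace RightBialgebroid

open BalTensor

variable {A R : Type u} [Ring A] [Ring R] (B : RightBialgebroid A R)

section Modules

variable (M N P : Type u) [AddCommGroup M] [AddCommGroup N] [AddCommGroup P]
  [Module Aᵐᵒᵖ M] [Module Aᵐᵒᵖ N] [Module Aᵐᵒᵖ P]

/-- The tensor product `M ⊗_R N` of right `A`-modules, with `r·m·r' = m s(r') t(r)`. -/
abbrev Tens : Type u := BalTensor (rightAct B.s M) (leftAct B.t N)

variable {M N P}

/-- The map `A^R ⊗ ^RA → M ⊗_R N`, `x ⊗ y ↦ m x ⊗ n y`. -/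
def orbit (m : M) (n : N) : BalTensor (rightAct B.s A) (leftAct B.t A) →+ B.Tens M N :=
  lift (AddMonoidHom.mk' (fun x => AddMonoidHom.mk'
      (fun y => tmul (rightAct B.s M) (leftAct B.t N) (op x • m) (op y • n))
      (fun y y' => by rw [MulOpposite.op_add, add_smul, tmul_add]))
      (fun x x' => by
        ext y; simp only [AddMonoidHom.mk'_apply, AddMonoidHom.add_apply]
        rw [MulOpposite.op_add, add_smul, add_tmul]))
    (fun r x y => by
      simp only [AddMonoidHom.mk'_apply]
      have h₁ : op (rightAct B.s A r x) • m = rightAct B.s M r (op x • m) := by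
        change op (x * B.s r) • m = op (B.s r) • op x • m
        rw [MulOpposite.op_mul, mul_smul]
      have h₂ : op (leftAct B.t A r y) • n = leftAct B.t N r (op y • n) := by
        change op (y * B.t (op r)) • n = op (B.t (op r)) • op y • n
        rw [MulOpposite.op_mul, mul_smul]
      rw [h₁, h₂, smul_tmul])

@[simp] theorem orbit_tmul (m : M) (n : N) (x y : A) :
    B.orbit m n (tmul _ _ x y) = tmul _ _ (op x • m) (op y • n) := rfl

theorem orbit_add_left (m m' : M) (n : N) : B.orbit (m + m') n = B.orbit m n + B.orbit m' n :=
  hom_ext (fun x y => by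
    rw [AddMonoidHom.add_apply]; simp only [orbit_tmul]; rw [smul_add, add_tmul])

theorem orbit_add_right (m : M) (n n' : N) : B.orbit m (n + n') = B.orbit m n + B.orbit m n' :=
  hom_ext (fun x y => by
    rw [AddMonoidHom.add_apply]; simp only [orbit_tmul]; rw [smul_add, tmul_add])

/-- The diagonal action `(m ⊗ n)·a = m a⁽¹⁾ ⊗ n a⁽²⁾`. -/
def diagAct (a : A) : B.Tens M N →+ B.Tens M N :=
  lift (AddMonoidHom.mk' (fun m => AddMonoidHom.mk' (fun n => B.orbit m n (B.γ a))
      (fun n n' => by rw [orbit_add_right]; rfl))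
      (fun m m' => by
        ext n; simp only [AddMonoidHom.mk'_apply, AddMonoidHom.add_apply, orbit_add_left]))
    (fun r m n => by
      simp only [AddMonoidHom.mk'_apply]
      obtain ⟨k, x, y, h⟩ := exists_rep (B.γ a)
      have h' := congrArg (B.orbit m n) (B.γ_takeuchi r a k x y h)
      simp only [map_sum, orbit_tmul] at h'
      rw [h]
      simp only [map_sum, orbit_tmul]
      simp only [MulOpposite.op_mul, mul_smul] at h'
      exact h')

theorem diagAct_tmul (a : A) (m : M) (n : N) :
    B.diagAct a (tmul _ _ m n) = B.orbit m n (B.γ a) := rfl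

theorem diagAct_of_rep (a : A) (m : M) (n : N) {k : ℕ} (x y : Fin k → A)
    (h : B.γ a = ∑ j, tmul _ _ (x j) (y j)) :
    B.diagAct a (tmul _ _ m n : B.Tens M N) = ∑ j, tmul _ _ (op (x j) • m) (op (y j) • n) := by
  rw [diagAct_tmul, h, map_sum]; rfl

theorem diagAct_one : (B.diagAct 1 : B.Tens M N →+ B.Tens M N) = AddMonoidHom.id _ :=
  hom_ext (fun m n => by rw [diagAct_tmul, B.γ_one, orbit_tmul]; simp)

theorem diagAct_mul (a b : A) :
    (B.diagAct (a * b) : B.Tens M N →+ B.Tens M N) = (B.diagAct b).comp (B.diagAct a) :=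
  hom_ext (fun m n => by
    obtain ⟨k, x, y, h⟩ := exists_rep (B.γ a)
    obtain ⟨k', z, w, h'⟩ := exists_rep (B.γ b)
    rw [AddMonoidHom.comp_apply, B.diagAct_of_rep a m n x y h, map_sum, diagAct_tmul,
      B.γ_mul a b k k' x y z w h h', map_sum]
    refine Finset.sum_congr rfl (fun j _ => ?_)
    rw [B.diagAct_of_rep b _ _ z w h', map_sum]
    refine Finset.sum_congr rfl (fun i _ => ?_)
    rw [orbit_tmul, MulOpposite.op_mul, MulOpposite.op_mul, mul_smul, mul_smul])

theorem diagAct_add (a b : A) :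
    (B.diagAct (a + b) : B.Tens M N →+ B.Tens M N) = B.diagAct a + B.diagAct b :=
  hom_ext (fun m n => by
    rw [AddMonoidHom.add_apply, diagAct_tmul, map_add, map_add]; rfl)

instance : Module Aᵐᵒᵖ (B.Tens M N) where
  smul a q := B.diagAct a.unop q
  one_smul q := DFunLike.congr_fun B.diagAct_one q
  mul_smul a b q := DFunLike.congr_fun (B.diagAct_mul b.unop a.unop) q
  smul_zero a := map_zero (B.diagAct a.unop)
  smul_add a := map_add (B.diagAct a.unop)
  add_smul a b q := DFunLike.congr_fun (B.diagAct_add a.unop b.unop) q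
  zero_smul q := by
    have h := DFunLike.congr_fun (B.diagAct_add (M := M) (N := N) 0 0) q
    rw [add_zero, AddMonoidHom.add_apply] at h
    exact left_eq_add.1 h

theorem smul_def (a : A) (q : B.Tens M N) : op a • q = B.diagAct a q := rfl

theorem smul_tmul_of_rep (a : A) (m : M) (n : N) {k : ℕ} (x y : Fin k → A)
    (h : B.γ a = ∑ j, tmul _ _ (x j) (y j)) :
    op a • (tmul _ _ m n : B.Tens M N) = ∑ j, tmul _ _ (op (x j) • m) (op (y j) • n) :=
  B.diagAct_of_rep a m n x y h

/-- `γ(s(r)) = 1 ⊗ s(r)`. -/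
theorem γ_s (r : R) : B.γ (B.s r) = tmul _ _ 1 (B.s r) := by
  have h := B.γ_bimod 1 r 1 1 (fun _ => 1) (fun _ => 1) (by simpa using B.γ_one)
  simpa using h

/-- `γ(t(r)) = t(r) ⊗ 1`. -/
theorem γ_t (r : R) : B.γ (B.t (op r)) = tmul _ _ (B.t (op r)) 1 := by
  have h := B.γ_bimod r 1 1 1 (fun _ => 1) (fun _ => 1) (by simpa using B.γ_one)
  simpa using h

theorem rightAct_tmul (r : R) (m : M) (n : N) :
    rightAct B.s (B.Tens M N) r (tmul _ _ m n) = tmul _ _ m (rightAct B.s N r n) := by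
  change B.diagAct (B.s r) _ = _
  rw [diagAct_tmul, γ_s, orbit_tmul, op_one, one_smul]; rfl

theorem leftAct_tmul (r : R) (m : M) (n : N) :
    leftAct B.t (B.Tens M N) r (tmul _ _ m n) = tmul _ _ (leftAct B.t M r m) n := by
  change B.diagAct (B.t (op r)) _ = _
  rw [diagAct_tmul, γ_t, orbit_tmul, op_one, one_smul]; rfl

/-- An additive map on `M ⊗_R N` that commutes with the actions on elementary tensors is
`A`-linear. -/
def linOfTmul (f : B.Tens M N →+ P) (h : ∀ (a : A) (m : M) (n : N),
    f (op a • (tmul _ _ m n : B.Tens M N)) = op a • f (tmul _ _ m n)) : B.Tens M N →ₗ[Aᵐᵒᵖ] P :=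
  { f with
    map_smul' := fun a q => by
      have : f.comp (B.diagAct a.unop) = (DistribSMul.toAddMonoidHom P a).comp f :=
        hom_ext (fun m n => h a.unop m n)
      exact DFunLike.congr_fun this q }

@[simp] theorem linOfTmul_apply (f : B.Tens M N →+ P) (h) (q : B.Tens M N) :
    B.linOfTmul f h q = f q := rfl

theorem lin_ext {f g : B.Tens M N →ₗ[Aᵐᵒᵖ] P}
    (h : ∀ m n, f (tmul _ _ m n) = g (tmul _ _ m n)) : f = g := by
  have : f.toAddMonoidHom = g.toAddMonoidHom := hom_ext h
  ext q
  exact DFunLike.congr_fun this q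

end Modules

section Constructions

variable {M N P M' N' : Type u} [AddCommGroup M] [AddCommGroup N] [AddCommGroup P]
  [AddCommGroup M'] [AddCommGroup N']
  [Module Aᵐᵒᵖ M] [Module Aᵐᵒᵖ N] [Module Aᵐᵒᵖ P] [Module Aᵐᵒᵖ M'] [Module Aᵐᵒᵖ N']

/-- The tensor product `f ⊗ g` of module maps. -/
def tensMap (f : M →ₗ[Aᵐᵒᵖ] M') (g : N →ₗ[Aᵐᵒᵖ] N') : B.Tens M N →ₗ[Aᵐᵒᵖ] B.Tens M' N' :=
  B.linOfTmul (lift (AddMonoidHom.mk' (fun m => (tmulHom _ _ (f m)).comp g.toAddMonoidHom)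
      (fun m m' => by ext n; simp))
    (fun r m n => by
      change tmul _ _ (f (op (B.s r) • m)) (g n) = tmul _ _ (f m) (g (op (B.t (op r)) • n))
      rw [map_smul, map_smul]
      exact smul_tmul r (f m) (g n)))
    (fun a m n => by
      obtain ⟨k, x, y, h⟩ := exists_rep (B.γ a)
      rw [B.smul_tmul_of_rep a m n x y h, map_sum]
      simp only [lift_tmul, AddMonoidHom.mk'_apply, AddMonoidHom.comp_apply, tmulHom_apply]
      rw [B.smul_tmul_of_rep a _ _ x y h]
      refine Finset.sum_congr rfl (fun j _ => ?_)
      change tmul _ _ (f _) (g _) = tmul _ _ (op (x j) • f m) (op (y j) • g n)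
      rw [map_smul, map_smul])

@[simp] theorem tensMap_tmul (f : M →ₗ[Aᵐᵒᵖ] M') (g : N →ₗ[Aᵐᵒᵖ] N') (m : M) (n : N) :
    B.tensMap f g (tmul _ _ m n) = tmul _ _ (f m) (g n) := rfl

variable (M N P)

/-- `(m ⊗ n, p) ↦ m ⊗ (n ⊗ p)` as a biadditive map. -/
def assocAux₁ : B.Tens M N →+ P →+ B.Tens M (B.Tens N P) :=
  lift (AddMonoidHom.mk' (fun m => AddMonoidHom.mk' (fun n =>
      (tmulHom (rightAct B.s M) (leftAct B.t (B.Tens N P)) m).comp (tmulHom _ _ n))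
      (fun n n' => by ext p; simp [tmul_add]))
      (fun m m' => by ext n p; simp))
    (fun r m n => by
      ext p
      change tmul _ _ (rightAct B.s M r m) (tmul _ _ n p) =
        tmul _ _ m (tmul _ _ (leftAct B.t N r n) p)
      rw [smul_tmul, leftAct_tmul])

/-- `(m, n ⊗ p) ↦ (m ⊗ n) ⊗ p` as a biadditive map. -/
def assocAux₂ : M →+ B.Tens N P →+ B.Tens (B.Tens M N) P :=
  AddMonoidHom.mk' (fun m => lift
      ((tmulHom (rightAct B.s (B.Tens M N)) (leftAct B.t P)).comp (tmulHom _ _ m))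
      (fun r n p => by
        change tmul _ _ (tmul _ _ m (rightAct B.s N r n)) p =
          tmul _ _ (tmul _ _ m n) (leftAct B.t P r p)
        rw [← smul_tmul, rightAct_tmul]))
    (fun m m' => hom_ext (fun n p => by
      change tmul _ _ (tmul _ _ (m + m') n) p = tmul _ _ (tmul _ _ m n) p + tmul _ _ (tmul _ _ m' n) p
      rw [add_tmul, add_tmul]))

/-- `(m ⊗ n) ⊗ p ↦ m ⊗ (n ⊗ p)` as an additive map. -/
def assocAux : B.Tens (B.Tens M N) P →+ B.Tens M (B.Tens N P) :=
  lift (B.assocAux₁ M N P) (fun r q p => by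
    obtain ⟨k, x, y, rfl⟩ := exists_rep q
    simp only [map_sum, AddMonoidHom.finsetSum_apply]
    refine Finset.sum_congr rfl (fun j _ => ?_)
    rw [rightAct_tmul]
    change tmul _ _ (x j) (tmul _ _ (rightAct B.s N r (y j)) p) =
      tmul _ _ (x j) (tmul _ _ (y j) (leftAct B.t P r p))
    rw [smul_tmul])

@[simp] theorem assocAux_tmul (m : M) (n : N) (p : P) :
    B.assocAux M N P (tmul _ _ (tmul _ _ m n) p) = tmul _ _ m (tmul _ _ n p) := rfl

/-- `m ⊗ (n ⊗ p) ↦ (m ⊗ n) ⊗ p` as an additive map. -/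
def assocAuxInv : B.Tens M (B.Tens N P) →+ B.Tens (B.Tens M N) P :=
  lift (B.assocAux₂ M N P) (fun r m q => by
    obtain ⟨k, x, y, rfl⟩ := exists_rep q
    simp only [map_sum]
    refine Finset.sum_congr rfl (fun j _ => ?_)
    rw [leftAct_tmul]
    change tmul _ _ (tmul _ _ (rightAct B.s M r m) (x j)) (y j) =
      tmul _ _ (tmul _ _ m (leftAct B.t N r (x j))) (y j)
    rw [smul_tmul])

@[simp] theorem assocAuxInv_tmul (m : M) (n : N) (p : P) :
    B.assocAuxInv M N P (tmul _ _ m (tmul _ _ n p)) = tmul _ _ (tmul _ _ m n) p := rfl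

variable {M N P}

/-- Two additive maps on `(M ⊗ N) ⊗ P` that agree on elementary tensors are equal. -/
theorem hom_ext₃ {T : Type*} [AddCommGroup T] {f g : B.Tens (B.Tens M N) P →+ T}
    (h : ∀ m n p, f (tmul _ _ (tmul _ _ m n) p) = g (tmul _ _ (tmul _ _ m n) p)) : f = g :=
  hom_ext (fun q p => by
    obtain ⟨k, x, y, rfl⟩ := exists_rep q
    rw [sum_tmul, map_sum, map_sum]
    exact Finset.sum_congr rfl (fun j _ => h _ _ _))

/-- Two additive maps on `M ⊗ (N ⊗ P)` that agree on elementary tensors are equal. -/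
theorem hom_ext₃' {T : Type*} [AddCommGroup T] {f g : B.Tens M (B.Tens N P) →+ T}
    (h : ∀ m n p, f (tmul _ _ m (tmul _ _ n p)) = g (tmul _ _ m (tmul _ _ n p))) : f = g :=
  hom_ext (fun m q => by
    obtain ⟨k, x, y, rfl⟩ := exists_rep q
    rw [tmul_sum, map_sum, map_sum]
    exact Finset.sum_congr rfl (fun j _ => h _ _ _))

/-- The map `x ⊗ y ⊗ z ↦ m x ⊗ (n y ⊗ p z)`. -/
def orbit₃ (m : M) (n : N) (p : P) :
    BalTensor₃ (rightAct B.s A) (leftAct B.t A) (rightAct B.s A) (leftAct B.t A) →+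
      B.Tens M (B.Tens N P) :=
  BalTensor₃.lift (AddMonoidHom.mk' (fun x => AddMonoidHom.mk' (fun y => AddMonoidHom.mk' (fun z =>
      (tmul _ _ (op x • m) (tmul _ _ (op y • n) (op z • p)) : B.Tens M (B.Tens N P)))
      (fun z z' => by rw [MulOpposite.op_add, add_smul, tmul_add, tmul_add]))
      (fun y y' => by
        ext z; simp only [AddMonoidHom.mk'_apply, AddMonoidHom.add_apply]
        rw [MulOpposite.op_add, add_smul, add_tmul, tmul_add]))
      (fun x x' => by
        ext y z; simp only [AddMonoidHom.mk'_apply, AddMonoidHom.add_apply]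
        rw [MulOpposite.op_add, add_smul, add_tmul]))
    (fun r x y z => by
      change tmul _ _ (op (x * B.s r) • m) (tmul _ _ (op y • n) (op z • p)) =
        tmul _ _ (op x • m) (tmul _ _ (op (y * B.t (op r)) • n) (op z • p))
      rw [MulOpposite.op_mul, mul_smul, MulOpposite.op_mul, mul_smul]
      exact (smul_tmul r _ _).trans (congrArg _ (B.leftAct_tmul r _ _)))
    (fun r x y z => by
      change tmul _ _ (op x • m) (tmul _ _ (op (y * B.s r) • n) (op z • p)) =
        tmul _ _ (op x • m) (tmul _ _ (op y • n) (op (z * B.t (op r)) • p))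
      rw [MulOpposite.op_mul, mul_smul, MulOpposite.op_mul, mul_smul]
      exact congrArg _ (smul_tmul r _ _))

theorem orbit₃_assocL (m : M) (n : N) (p : P)
    (q : BalTensor (rightAct B.s A) (leftAct B.t A)) (z : A) :
    B.orbit₃ m n p (BalTensor₃.assocL _ _ _ _ q z) =
      B.assocAux M N P (tmul _ _ (B.orbit m n q) (op z • p)) := by
  obtain ⟨k, x, y, rfl⟩ := exists_rep q
  simp only [map_sum, AddMonoidHom.finsetSum_apply, sum_tmul]
  exact Finset.sum_congr rfl (fun j _ => rfl)

theorem orbit₃_assocR (m : M) (n : N) (p : P) (x : A)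
    (q : BalTensor (rightAct B.s A) (leftAct B.t A)) :
    B.orbit₃ m n p (BalTensor₃.assocR _ _ _ _ x q) = tmul _ _ (op x • m) (B.orbit n p q) := by
  obtain ⟨k, y, z, rfl⟩ := exists_rep q
  simp only [map_sum, tmul_sum]
  exact Finset.sum_congr rfl (fun j _ => rfl)

theorem assocAux_smul (a : A) (q : B.Tens (B.Tens M N) P) :
    B.assocAux M N P (op a • q) = op a • B.assocAux M N P q := by
  have : (B.assocAux M N P).comp (B.diagAct a) = (B.diagAct a).comp (B.assocAux M N P) :=
    B.hom_ext₃ (fun m n p => by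
      obtain ⟨k, x, y, h⟩ := exists_rep (B.γ a)
      have h' := congrArg (B.orbit₃ m n p) (B.coassoc a k x y h)
      simp only [map_sum, orbit₃_assocL, orbit₃_assocR] at h'
      rw [AddMonoidHom.comp_apply, AddMonoidHom.comp_apply, B.diagAct_of_rep a _ _ x y h,
        map_sum, assocAux_tmul, B.diagAct_of_rep a _ _ x y h]
      exact h')
  exact DFunLike.congr_fun this q

variable (M N P)

/-- The associativity isomorphism. -/
def assocEquiv : B.Tens (B.Tens M N) P ≃ₗ[Aᵐᵒᵖ] B.Tens M (B.Tens N P) :=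
  { B.assocAux M N P with
    map_smul' := fun a q => B.assocAux_smul a.unop q
    invFun := B.assocAuxInv M N P
    left_inv := DFunLike.congr_fun (show (B.assocAuxInv M N P).comp (B.assocAux M N P) =
      AddMonoidHom.id _ from B.hom_ext₃ (fun _ _ _ => rfl))
    right_inv := DFunLike.congr_fun (show (B.assocAux M N P).comp (B.assocAuxInv M N P) =
      AddMonoidHom.id _ from B.hom_ext₃' (fun _ _ _ => rfl)) }

@[simp] theorem assocEquiv_tmul (m : M) (n : N) (p : P) :
    B.assocEquiv M N P (tmul _ _ (tmul _ _ m n) p) = tmul _ _ m (tmul _ _ n p) := rfl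

/-- The right `A`-action `r·a = π(s(r) a)` on the base ring. -/
def unitAct (a : A) : R →+ R := B.π.comp ((AddMonoidHom.mulRight a).comp B.s.toAddMonoidHom)

theorem unitAct_apply (a : A) (r : R) : B.unitAct a r = B.π (B.s r * a) := rfl

theorem π_s (r : R) : B.π (B.s r) = r := by
  have h := B.π_bimod 1 r 1
  rw [op_one, map_one, mul_one, one_mul, B.π_one, one_mul, one_mul] at h
  exact h

theorem π_mul_s (a : A) (r : R) : B.π (a * B.s r) = B.π a * r := by
  have h := B.π_bimod 1 r a
  rw [op_one, map_one, mul_one, one_mul] at h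
  exact h

theorem π_mul_t (a : A) (r : R) : B.π (a * B.t (op r)) = r * B.π a := by
  have h := B.π_bimod r 1 a
  rw [map_one, mul_one, mul_one] at h
  exact h

theorem π_t_mul_eq (r : R) (a : A) : B.π (B.t (op r) * a) = B.π (B.s r * a) := by
  have h := B.π_t_mul (B.s r) a
  rwa [π_s] at h

theorem unitAct_s (r r' : R) : B.unitAct (B.s r) r' = r' * r := by
  rw [unitAct_apply, ← map_mul, π_s]

theorem unitAct_t (r r' : R) : B.unitAct (B.t (op r)) r' = r * r' := by
  rw [unitAct_apply, π_mul_t, π_s]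

theorem unitAct_one (r : R) : B.unitAct 1 r = r := by rw [unitAct_apply, mul_one, π_s]

theorem unitAct_mul (a b : A) (r : R) : B.unitAct (a * b) r = B.unitAct b (B.unitAct a r) := by
  rw [unitAct_apply, unitAct_apply, unitAct_apply, B.π_s_mul, mul_assoc]

theorem unitAct_add (a b : A) (r : R) : B.unitAct (a + b) r = B.unitAct a r + B.unitAct b r := by
  rw [unitAct_apply, mul_add, map_add]; rfl

theorem unitAct_zero (r : R) : B.unitAct 0 r = 0 := by rw [unitAct_apply, mul_zero, map_zero]

/-- The monoidal unit: the base ring `R` with right `A`-action `r·a = π(s(r) a)`. -/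
@[nolint unusedArguments]
def UnitMod (_ : RightBialgebroid A R) : Type u := R

instance : AddCommGroup B.UnitMod := inferInstanceAs (AddCommGroup R)

instance : Module Aᵐᵒᵖ B.UnitMod where
  smul a r := B.unitAct a.unop r
  one_smul r := B.unitAct_one r
  mul_smul a b r := B.unitAct_mul b.unop a.unop r
  smul_zero a := map_zero (B.unitAct a.unop)
  smul_add a := map_add (B.unitAct a.unop)
  add_smul a b r := B.unitAct_add a.unop b.unop r
  zero_smul r := B.unitAct_zero r

/-- `x ⊗ y ↦ y t(π(x))`. -/
def counitL : BalTensor (rightAct B.s A) (leftAct B.t A) →+ A :=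
  lift (AddMonoidHom.mk' (fun x => AddMonoidHom.mulRight (B.t (op (B.π x))))
      (fun x x' => by
        ext y; simp [mul_add]))
    (fun r x y => by
      change y * B.t (op (B.π (x * B.s r))) = y * B.t (op r) * B.t (op (B.π x))
      rw [π_mul_s, MulOpposite.op_mul, map_mul, mul_assoc])

/-- `x ⊗ y ↦ x s(π(y))`. -/
def counitR : BalTensor (rightAct B.s A) (leftAct B.t A) →+ A :=
  lift (AddMonoidHom.mk' (fun x => (AddMonoidHom.mulLeft x).comp (B.s.toAddMonoidHom.comp B.π))
      (fun x x' => by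
        ext y; simp [add_mul]))
    (fun r x y => by
      change x * B.s r * B.s (B.π y) = x * B.s (B.π (y * B.t (op r)))
      rw [π_mul_t, map_mul, mul_assoc])

theorem counit_left_act (r : R) (a : A) {k : ℕ} (x y : Fin k → A)
    (h : B.γ a = ∑ j, tmul _ _ (x j) (y j)) :
    ∑ j, y j * B.t (op (B.unitAct (x j) r)) = B.t (op r) * a := by
  have h' := congrArg B.counitL (B.γ_takeuchi r a k x y h)
  rw [map_sum, map_sum] at h'
  refine h'.trans ?_
  change ∑ j, B.t (op r) * y j * B.t (op (B.π (x j))) = _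
  simp only [mul_assoc]
  rw [← Finset.mul_sum, B.counit_left a k x y h]

theorem counit_right_act (r : R) (a : A) {k : ℕ} (x y : Fin k → A)
    (h : B.γ a = ∑ j, tmul _ _ (x j) (y j)) :
    ∑ j, x j * B.s (B.unitAct (y j) r) = B.s r * a := by
  have h' := congrArg B.counitR (B.γ_takeuchi r a k x y h)
  rw [map_sum, map_sum] at h'
  simp only [unitAct_apply, ← π_t_mul_eq]
  refine h'.symm.trans ?_
  change ∑ j, B.s r * x j * B.s (B.π (y j)) = _
  simp only [mul_assoc]
  rw [← Finset.mul_sum, B.counit_right a k x y h]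

theorem sum_op_smul {k : ℕ} (x : Fin k → A) (m : M) : ∑ j, op (x j) • m = op (∑ j, x j) • m := by
  rw [← Finset.sum_smul]
  exact congrArg (· • m) (map_sum (opAddEquiv (α := A)) x Finset.univ).symm

/-- An element of the base ring as an element of the unit module. -/
def toUnit : R ≃+ B.UnitMod := AddEquiv.refl R

/-- `(r, m) ↦ m t(r)` as a biadditive map. -/
def leftActHom : R →+ M →+ M :=
  AddMonoidHom.mk' (fun r : R => leftAct B.t M r) (fun r r' => by
    ext m
    change op (B.t (op (r + r'))) • m = op (B.t (op r)) • m + op (B.t (op r')) • m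
    rw [MulOpposite.op_add, map_add, MulOpposite.op_add, add_smul])

/-- `(r, m) ↦ m s(r)` as a biadditive map. -/
def rightActHom : R →+ M →+ M :=
  AddMonoidHom.mk' (fun r : R => rightAct B.s M r) (fun r r' => by
    ext m
    change op (B.s (r + r')) • m = op (B.s r) • m + op (B.s r') • m
    rw [map_add, MulOpposite.op_add, add_smul])

/-- `r ⊗ m ↦ m t(r)` as an additive map. -/
def lUnitAux : B.Tens B.UnitMod M →+ M :=
  lift ((B.leftActHom M).comp B.toUnit.symm.toAddMonoidHom)
    (fun (r' r : R) m => by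
      change op (B.t (op (B.unitAct (B.s r') r))) • m = op (B.t (op r)) • op (B.t (op r')) • m
      rw [unitAct_s, MulOpposite.op_mul, map_mul, MulOpposite.op_mul, mul_smul])

/-- `m ⊗ r ↦ m s(r)` as an additive map. -/
def rUnitAux : B.Tens M B.UnitMod →+ M :=
  lift ((B.rightActHom M).comp B.toUnit.symm.toAddMonoidHom).flip
    (fun (r' : R) m (r : R) => by
      change op (B.s r) • op (B.s r') • m = op (B.s (B.unitAct (B.t (op r')) r)) • m
      rw [unitAct_t, map_mul, MulOpposite.op_mul, mul_smul])

/-- The left unit isomorphism `r ⊗ m ↦ m t(r)`. -/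
def lUnitEquiv : B.Tens B.UnitMod M ≃ₗ[Aᵐᵒᵖ] M :=
  { B.linOfTmul (B.lUnitAux M) (fun a (r : R) m => by
      obtain ⟨k, x, y, h⟩ := exists_rep (B.γ a)
      rw [B.smul_tmul_of_rep a (M := B.UnitMod) r m x y h, map_sum]
      change ∑ j, op (B.t (op (B.unitAct (x j) r))) • op (y j) • m = op a • op (B.t (op r)) • m
      simp only [← mul_smul, ← MulOpposite.op_mul]
      rw [sum_op_smul, B.counit_left_act r a x y h]) with
    invFun := fun m => tmul _ _ (B.toUnit 1) m
    left_inv := fun q => by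
      obtain ⟨k, x, y, rfl⟩ := exists_rep q
      change tmul _ _ (B.toUnit 1) (B.lUnitAux M _) = _
      rw [map_sum, tmul_sum]
      refine Finset.sum_congr rfl (fun j _ => ?_)
      refine (smul_tmul (x j : R) _ _).symm.trans ?_
      congr 1
      exact (B.unitAct_s (x j : R) 1).trans (one_mul _)
    right_inv := fun m => by
      change op (B.t (op 1)) • m = m
      rw [op_one, map_one, op_one, one_smul] }

/-- The right unit isomorphism `m ⊗ r ↦ m s(r)`. -/
def rUnitEquiv : B.Tens M B.UnitMod ≃ₗ[Aᵐᵒᵖ] M :=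
  { B.linOfTmul (B.rUnitAux M) (fun a m (r : R) => by
      obtain ⟨k, x, y, h⟩ := exists_rep (B.γ a)
      rw [B.smul_tmul_of_rep a (N := B.UnitMod) m r x y h, map_sum]
      change ∑ j, op (B.s (B.unitAct (y j) r)) • op (x j) • m = op a • op (B.s r) • m
      simp only [← mul_smul, ← MulOpposite.op_mul]
      rw [sum_op_smul, B.counit_right_act r a x y h]) with
    invFun := fun m => tmul _ _ m (B.toUnit 1)
    left_inv := fun q => by
      obtain ⟨k, x, y, rfl⟩ := exists_rep q
      change tmul _ _ (B.rUnitAux M _) (B.toUnit 1) = _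
      rw [map_sum, sum_tmul]
      refine Finset.sum_congr rfl (fun j _ => ?_)
      refine (smul_tmul (y j : R) _ _).trans ?_
      congr 1
      exact (B.unitAct_t (y j : R) 1).trans (mul_one _)
    right_inv := fun m => by
      change op (B.s 1) • m = m
      rw [map_one, op_one, one_smul] }

theorem lUnitEquiv_tmul (r : R) (m : M) :
    B.lUnitEquiv M (tmul _ _ (B.toUnit r) m) = op (B.t (op r)) • m := rfl

theorem rUnitEquiv_tmul (r : R) (m : M) :
    B.rUnitEquiv M (tmul _ _ m (B.toUnit r)) = op (B.s r) • m := rfl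

end Constructions

end RightBialgebroid

namespace RightBialgebroid

open BalTensor

variable {A R : Type u} [Ring A] [Ring R] (B : RightBialgebroid A R)

/-- The category `ℳ_A` of right `A`-modules, to be given the monoidal structure of the right
bialgebroid `B`. -/
@[nolint unusedArguments]
def Mod (_ : RightBialgebroid A R) : Type (u + 1) := ModuleCat.{u} Aᵐᵒᵖ

instance : Category.{u} B.Mod := inferInstanceAs (Category.{u} (ModuleCat.{u} Aᵐᵒᵖ))
instance : Preadditive B.Mod := inferInstanceAs (Preadditive (ModuleCat.{u} Aᵐᵒᵖ))
instance : Limits.HasCoequalizers B.Mod :=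
  inferInstanceAs (Limits.HasCoequalizers (ModuleCat.{u} Aᵐᵒᵖ))

variable {B}

namespace Mod

/-- The underlying set of a right module. -/
def carrier (M : B.Mod) : Type u := ModuleCat.carrier (R := Aᵐᵒᵖ) M

instance : CoeSort B.Mod (Type u) := ⟨carrier⟩
instance (M : B.Mod) : AddCommGroup M := ModuleCat.isAddCommGroup (R := Aᵐᵒᵖ) M
instance (M : B.Mod) : Module Aᵐᵒᵖ M := ModuleCat.isModule (R := Aᵐᵒᵖ) M

variable (B) in
/-- A right `A`-module as an object of `ℳ_A`. -/
def of (M : Type u) [AddCommGroup M] [Module Aᵐᵒᵖ M] : B.Mod := ModuleCat.of Aᵐᵒᵖ M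

variable {M N P : B.Mod}

/-- The linear map underlying a morphism of `ℳ_A`. -/
def lin (f : M ⟶ N) : M →ₗ[Aᵐᵒᵖ] N := ModuleCat.Hom.hom (R := Aᵐᵒᵖ) f

/-- A linear map as a morphism of `ℳ_A`. -/
def ofLin (f : M →ₗ[Aᵐᵒᵖ] N) : M ⟶ N :=
  ConcreteCategory.ofHom (C := ModuleCat.{u} Aᵐᵒᵖ) f

@[simp] theorem lin_ofLin (f : M →ₗ[Aᵐᵒᵖ] N) : lin (ofLin f) = f := rfl
@[simp] theorem lin_id : lin (𝟙 M) = LinearMap.id := rfl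
@[simp] theorem lin_comp (f : M ⟶ N) (g : N ⟶ P) : lin (f ≫ g) = (lin g).comp (lin f) := rfl
@[simp] theorem lin_add (f g : M ⟶ N) : lin (f + g) = lin f + lin g := rfl

theorem hom_ext' {f g : M ⟶ N} (h : lin f = lin g) : f = g := ModuleCat.hom_ext (R := Aᵐᵒᵖ) h

/-- A linear equivalence as an isomorphism of `ℳ_A`. -/
def ofEquiv (e : M ≃ₗ[Aᵐᵒᵖ] N) : M ≅ N where
  hom := ofLin e.toLinearMap
  inv := ofLin e.symm.toLinearMap
  hom_inv_id := hom_ext' (by ext x; exact e.symm_apply_apply x)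
  inv_hom_id := hom_ext' (by ext x; exact e.apply_symm_apply x)

/-- The tensor product of `ℳ_A`. -/
def tensor (M N : B.Mod) : B.Mod := of B (B.Tens M N)

/-- The elementary tensor `m ⊗ n` in `M ⊗_R N`. -/
def tm (m : M) (n : N) : tensor M N := tmul (rightAct B.s M) (leftAct B.t N) m n

theorem tensor_ext {f g : tensor M N ⟶ P} (h : ∀ m n, lin f (tm m n) = lin g (tm m n)) : f = g :=
  hom_ext' (B.lin_ext (M := M) (N := N) h)

theorem tensor_ext₃ {Q : B.Mod} {f g : tensor (tensor M N) P ⟶ Q}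
    (h : ∀ m n p, lin f (tm (tm m n) p) = lin g (tm (tm m n) p)) : f = g :=
  hom_ext' (by
    have : (lin f).toAddMonoidHom = (lin g).toAddMonoidHom :=
      B.hom_ext₃ (M := M) (N := N) (P := P) h
    ext q
    exact DFunLike.congr_fun this q)

theorem tensor_ext₄ {Q T : B.Mod} {f g : tensor (tensor (tensor M N) P) Q ⟶ T}
    (h : ∀ m n p q, lin f (tm (tm (tm m n) p) q) = lin g (tm (tm (tm m n) p) q)) : f = g :=
  tensor_ext (fun x q => by
    have : ((lin f).toAddMonoidHom.comp ((tmulHom (rightAct B.s (tensor (tensor M N) P))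
        (leftAct B.t Q)).flip q)) = ((lin g).toAddMonoidHom.comp ((tmulHom (rightAct B.s
          (tensor (tensor M N) P)) (leftAct B.t Q)).flip q)) :=
      B.hom_ext₃ (M := M) (N := N) (P := P) (fun m n p => h m n p q)
    exact DFunLike.congr_fun this x)

/-- The tensor product of morphisms of `ℳ_A`. -/
def tensorMap {M M' N N' : B.Mod} (f : M ⟶ M') (g : N ⟶ N') : tensor M N ⟶ tensor M' N' :=
  ofLin (M := tensor M N) (N := tensor M' N') (B.tensMap (lin f) (lin g))

/-- The monoidal structure of `ℳ_A`: the tensor product over the base ring with the diagonal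
action, the base ring as unit object. -/
instance : MonoidalCategory B.Mod :=
  letI : MonoidalCategoryStruct B.Mod :=
    { tensorObj := tensor
      tensorHom := tensorMap
      whiskerLeft := fun M _ _ g => tensorMap (𝟙 M) g
      whiskerRight := fun f N => tensorMap f (𝟙 N)
      tensorUnit := of B B.UnitMod
      associator := fun M N P => ofEquiv (M := tensor (tensor M N) P)
        (N := tensor M (tensor N P)) (B.assocEquiv M N P)
      leftUnitor := fun M => ofEquiv (M := tensor (of B B.UnitMod) M) (B.lUnitEquiv M)
      rightUnitor := fun M => ofEquiv (M := tensor M (of B B.UnitMod)) (B.rUnitEquiv M) }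
  MonoidalCategory.ofTensorHom
    (id_tensorHom_id := fun M N => tensor_ext (fun m n => rfl))
    (id_tensorHom := fun M _ _ f => rfl)
    (tensorHom_id := fun f N => rfl)
    (tensorHom_comp_tensorHom := fun f₁ f₂ g₁ g₂ => tensor_ext (fun m n => rfl))
    (associator_naturality := fun f₁ f₂ f₃ => tensor_ext₃ (fun m n p => rfl))
    (leftUnitor_naturality := fun {M N} f => tensor_ext (fun r m => by
      change op (B.t (op (B.toUnit.symm r))) • lin f m = lin f (op (B.t (op (B.toUnit.symm r))) • m)
      rw [map_smul]))
    (rightUnitor_naturality := fun {M N} f => tensor_ext (fun m r => by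
      change op (B.s (B.toUnit.symm r)) • lin f m = lin f (op (B.s (B.toUnit.symm r)) • m)
      rw [map_smul]))
    (pentagon := fun M N P Q => tensor_ext₄ (fun m n p q => rfl))
    (triangle := fun M N => tensor_ext₃ (fun m r n =>
      (smul_tmul (B.toUnit.symm r) m n).symm))

end Mod

end RightBialgebroid

namespace RightBialgebroid.Mod

open BalTensor

variable {A R : Type u} [Ring A] [Ring R] {B : RightBialgebroid A R}

instance : MonoidalPreadditive B.Mod where
  whiskerLeft_zero := tensor_ext (fun _ _ => tmul_zero _)
  zero_whiskerRight := tensor_ext (fun _ _ => zero_tmul _)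
  whiskerLeft_add _ _ := tensor_ext (fun _ _ => tmul_add _ _ _)
  add_whiskerRight _ _ := tensor_ext (fun _ _ => add_tmul _ _ _)

section Colimits

open CategoryTheory.Limits

variable (B) in
/-- The functor sending a right module to its underlying abelian group. -/
def toAb : B.Mod ⥤ AddCommGrpCat.{u} := forget₂ (ModuleCat.{u} Aᵐᵒᵖ) AddCommGrpCat.{u}

instance : PreservesColimitsOfSize.{0, 0} (toAb B) :=
  have : PreservesColimitsOfSize.{u, u} (toAb B) :=
    ModuleCat.forget₂PreservesColimitsOfSize.{u, u, u, u} (R := Aᵐᵒᵖ)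
  preservesColimitsOfSize_shrink.{0, u, 0, u} (toAb B)

variable {J : Type} [SmallCategory J] {K : J ⥤ B.Mod} {c : Cocone K}

/-- Colimits in `ℳ_A` are colimits of abelian groups. -/
theorem exists_addHom (hc : IsColimit c) {T : Type u} [AddCommGroup T]
    (f : ∀ j, K.obj j →+ T) (hf : ∀ {j j'} (φ : j ⟶ j') x, f j' (lin (K.map φ) x) = f j x) :
    ∃ g : c.pt →+ T, ∀ j x, g (lin (c.ι.app j) x) = f j x := by
  have hc' : IsColimit ((toAb B).mapCocone c) := isColimitOfPreserves (toAb B) hc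
  let s : Cocone (K ⋙ toAb B) :=
    { pt := AddCommGrpCat.of T
      ι := { app := fun j => AddCommGrpCat.ofHom (X := (toAb B).obj (K.obj j)) (Y := AddCommGrpCat.of T) (f j)
             naturality := fun j j' φ => by ext x; exact hf φ x } }
  refine ⟨(hc'.desc s).hom, fun j x => ?_⟩
  exact ConcreteCategory.congr_hom (hc'.fac s j) x

theorem addHom_ext (hc : IsColimit c) {T : Type u} [AddCommGroup T] {g g' : c.pt →+ T}
    (h : ∀ j x, g (lin (c.ι.app j) x) = g' (lin (c.ι.app j) x)) : g = g' := by
  have hc' : IsColimit ((toAb B).mapCocone c) := isColimitOfPreserves (toAb B) hc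
  have : AddCommGrpCat.ofHom (X := (toAb B).obj c.pt) (Y := AddCommGrpCat.of T) g =
      AddCommGrpCat.ofHom (X := (toAb B).obj c.pt) (Y := AddCommGrpCat.of T) g' :=
    hc'.hom_ext (fun j => by ext x; exact h j x)
  ext x
  exact ConcreteCategory.congr_hom this x

theorem existsUnique_tensorLeft (M : B.Mod) (hc : IsColimit c) (s : Cocone (K ⋙ tensorLeft M)) :
    ∃! d : M ⊗ c.pt ⟶ s.pt, ∀ j, M ◁ c.ι.app j ≫ d = s.ι.app j := by
  have key : ∀ m : M, ∃ g : c.pt →+ s.pt, ∀ j x,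
      g (lin (c.ι.app j) x) = lin (s.ι.app j) (tm m x) := fun m => by
    let f : ∀ j, K.obj j →+ s.pt := fun j => (lin (s.ι.app j)).toAddMonoidHom.comp
      (tmulHom (rightAct B.s M) (leftAct B.t (K.obj j)) m)
    exact exists_addHom hc f (fun {j j'} φ x =>
      DFunLike.congr_fun (congrArg lin (s.w φ)) (tm m x))
  choose g hg using key
  have hlin : ∀ j (a : A) (x : K.obj j), op a • lin (c.ι.app j) x = lin (c.ι.app j) (op a • x) :=
    fun j a x => (map_smul _ _ _).symm
  let D : B.Tens M c.pt →+ s.pt := lift (AddMonoidHom.mk' g (fun m m' => addHom_ext hc (fun j x => by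
      rw [AddMonoidHom.add_apply, hg, hg, hg, ← map_add]
      exact congrArg _ (add_tmul _ _ _)))) (fun r m n => by
        have : g (rightAct B.s M r m) = (g m).comp (leftAct B.t c.pt r) :=
          addHom_ext hc (fun j x => by
            rw [AddMonoidHom.comp_apply, hg]
            change _ = g m (op (B.t (op r)) • _)
            rw [hlin, hg]
            exact congrArg _ (smul_tmul _ _ _))
        exact DFunLike.congr_fun this n)
  have hD : ∀ (a : A) (m : M) (n : c.pt),
      D (op a • (tmul _ _ m n : B.Tens M c.pt)) = op a • D (tmul _ _ m n) := by
    intro a m n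
    obtain ⟨k, x, y, h⟩ := exists_rep (B.γ a)
    rw [B.smul_tmul_of_rep a m n x y h, map_sum]
    have : ∑ i, (g (op (x i) • m)).comp (DistribSMul.toAddMonoidHom _ (op (y i))) =
        (DistribSMul.toAddMonoidHom _ (op a)).comp (g m) := addHom_ext hc (fun j z => by
      simp only [AddMonoidHom.finsetSum_apply, AddMonoidHom.comp_apply,
        DistribSMul.toAddMonoidHom_apply, hlin, hg]
      rw [← map_sum, ← map_smul]
      exact congrArg _ (B.smul_tmul_of_rep a m z x y h).symm)
    have h' := DFunLike.congr_fun this n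
    rw [AddMonoidHom.finsetSum_apply] at h'
    exact h'
  refine ⟨ofLin (M := tensor M c.pt) (B.linOfTmul D hD), fun j => tensor_ext (fun m x => hg m j x),
    fun d hd => tensor_ext (fun m n => ?_)⟩
  have : (lin d).toAddMonoidHom.comp (tmulHom (rightAct B.s M) (leftAct B.t c.pt) m) = g m :=
    addHom_ext hc (fun j x => by
      rw [hg, ← hd j]; rfl)
  exact DFunLike.congr_fun this n

theorem existsUnique_tensorRight (M : B.Mod) (hc : IsColimit c) (s : Cocone (K ⋙ tensorRight M)) :
    ∃! d : c.pt ⊗ M ⟶ s.pt, ∀ j, c.ι.app j ▷ M ≫ d = s.ι.app j := by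
  have key : ∀ m : M, ∃ g : c.pt →+ s.pt, ∀ j x,
      g (lin (c.ι.app j) x) = lin (s.ι.app j) (tm x m) := fun m => by
    let f : ∀ j, K.obj j →+ s.pt := fun j => (lin (s.ι.app j)).toAddMonoidHom.comp
      ((tmulHom (rightAct B.s (K.obj j)) (leftAct B.t M)).flip m)
    exact exists_addHom hc f (fun {j j'} φ x =>
      DFunLike.congr_fun (congrArg lin (s.w φ)) (tm x m))
  choose g hg using key
  have hlin : ∀ j (a : A) (x : K.obj j), op a • lin (c.ι.app j) x = lin (c.ι.app j) (op a • x) :=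
    fun j a x => (map_smul _ _ _).symm
  let D : B.Tens c.pt M →+ s.pt := lift (AddMonoidHom.mk' g (fun m m' => addHom_ext hc (fun j x => by
      rw [AddMonoidHom.add_apply, hg, hg, hg, ← map_add]
      exact congrArg _ (tmul_add _ _ _)))).flip (fun r n m => by
        have : (g m).comp (rightAct B.s c.pt r) = g (leftAct B.t M r m) :=
          addHom_ext hc (fun j x => by
            rw [AddMonoidHom.comp_apply, hg]
            change g m (op (B.s r) • _) = _
            rw [hlin, hg]
            exact congrArg _ (smul_tmul _ _ _))
        exact DFunLike.congr_fun this n)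
  have hD : ∀ (a : A) (n : c.pt) (m : M),
      D (op a • (tmul _ _ n m : B.Tens c.pt M)) = op a • D (tmul _ _ n m) := by
    intro a n m
    obtain ⟨k, x, y, h⟩ := exists_rep (B.γ a)
    rw [B.smul_tmul_of_rep a n m x y h, map_sum]
    have : ∑ i, (g (op (y i) • m)).comp (DistribSMul.toAddMonoidHom _ (op (x i))) =
        (DistribSMul.toAddMonoidHom _ (op a)).comp (g m) := addHom_ext hc (fun j z => by
      simp only [AddMonoidHom.finsetSum_apply, AddMonoidHom.comp_apply,
        DistribSMul.toAddMonoidHom_apply, hlin, hg]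
      rw [← map_sum, ← map_smul]
      exact congrArg _ (B.smul_tmul_of_rep a z m x y h).symm)
    have h' := DFunLike.congr_fun this n
    rw [AddMonoidHom.finsetSum_apply] at h'
    exact h'
  refine ⟨ofLin (M := tensor c.pt M) (B.linOfTmul D hD), fun j => tensor_ext (fun x m => hg m j x),
    fun d hd => tensor_ext (fun n m => ?_)⟩
  have : (lin d).toAddMonoidHom.comp ((tmulHom (rightAct B.s c.pt) (leftAct B.t M)).flip m) = g m :=
    addHom_ext hc (fun j x => by
      rw [hg, ← hd j]; rfl)
  exact DFunLike.congr_fun this n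

/-- A cocone with the universal property is a colimit cocone. -/
theorem nonempty_isColimit {C : Type*} [Category C] {I : Type*} [Category I] {F : I ⥤ C}
    (c : Cocone F) (h : ∀ s : Cocone F, ∃! d : c.pt ⟶ s.pt, ∀ j, c.ι.app j ≫ d = s.ι.app j) :
    Nonempty (IsColimit c) :=
  ⟨{ desc := fun s => (h s).exists.choose
     fac := fun s j => (h s).exists.choose_spec j
     uniq := fun s _ hm => (h s).unique hm (h s).exists.choose_spec }⟩

instance (M : B.Mod) : PreservesColimitsOfSize.{0, 0} (tensorLeft M) where
  preservesColimitsOfShape :=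
    ⟨⟨fun hc => nonempty_isColimit _ (fun s => existsUnique_tensorLeft M hc s)⟩⟩

instance (M : B.Mod) : PreservesColimitsOfSize.{0, 0} (tensorRight M) where
  preservesColimitsOfShape :=
    ⟨⟨fun hc => nonempty_isColimit _ (fun s => existsUnique_tensorRight M hc s)⟩⟩

end Colimits

end RightBialgebroid.Mod

section InternalBimodules

open CategoryTheory.Limits MonObj

variable {C : Type u} [Category.{v} C] [MonoidalCategory C]

section Additive

variable [Preadditive C] [MonoidalPreadditive C] {X Y : Mon C}

namespace Bimod

variable {P Q : Bimod X Y}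

instance : Zero (P ⟶ Q) := ⟨{ hom := 0, left_act_hom := by simp, right_act_hom := by simp }⟩

instance : Add (P ⟶ Q) := ⟨fun f g =>
  { hom := f.hom + g.hom
    left_act_hom := by
      rw [Preadditive.comp_add, f.left_act_hom, g.left_act_hom, MonoidalPreadditive.whiskerLeft_add,
        Preadditive.add_comp]
    right_act_hom := by
      rw [Preadditive.comp_add, f.right_act_hom, g.right_act_hom,
        MonoidalPreadditive.add_whiskerRight, Preadditive.add_comp] }⟩

instance : Neg (P ⟶ Q) := ⟨fun f =>
  { hom := -f.hom
    left_act_hom := by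
      have h : X.X ◁ (-f.hom) = -(X.X ◁ f.hom) := (tensorLeft X.X).map_neg
      rw [h, Preadditive.comp_neg, Preadditive.neg_comp, f.left_act_hom]
    right_act_hom := by
      have h : (-f.hom) ▷ Y.X = -(f.hom ▷ Y.X) := (tensorRight Y.X).map_neg
      rw [h, Preadditive.comp_neg, Preadditive.neg_comp, f.right_act_hom] }⟩

theorem add_hom (f g : P ⟶ Q) : (f + g).hom = f.hom + g.hom := rfl
theorem zero_hom : (0 : P ⟶ Q).hom = 0 := rfl
theorem neg_hom (f : P ⟶ Q) : (-f).hom = -f.hom := rfl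

/-- Bimodule maps are added in the ambient category. -/
instance : AddCommGroup (P ⟶ Q) where
  add_assoc f g h := hom_ext _ _ (add_assoc f.hom g.hom h.hom)
  zero_add f := hom_ext _ _ (zero_add f.hom)
  add_zero f := hom_ext _ _ (add_zero f.hom)
  neg_add_cancel f := hom_ext _ _ (neg_add_cancel f.hom)
  add_comm f g := hom_ext _ _ (add_comm f.hom g.hom)
  nsmul := nsmulRec
  zsmul := zsmulRec

instance : Preadditive (Bimod X Y) where
  add_comp _ _ _ f f' g := hom_ext _ _ (by
    change (f.hom + f'.hom) ≫ g.hom = f.hom ≫ g.hom + f'.hom ≫ g.hom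
    exact Preadditive.add_comp _ _ _ _ _ _)
  comp_add _ _ _ f g g' := hom_ext _ _ (by
    change f.hom ≫ (g.hom + g'.hom) = f.hom ≫ g.hom + f.hom ≫ g'.hom
    exact Preadditive.comp_add _ _ _ _ _ _)

end Bimod

end Additive

/-- An object `X` as the bimodule `_𝒰X_𝒰 = (X, l_X, r_X)` over the trivial monoid `𝒰`. -/
def unitUnitBimod (X : C) : Bimod (Mon.trivial C) (Mon.trivial C) where
  X := X
  actLeft := (λ_ X).hom
  actRight := (ρ_ X).hom
  one_actLeft := by
    change 𝟙 (𝟙_ C) ▷ X ≫ (λ_ X).hom = (λ_ X).hom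
    simp
  left_assoc := by
    change (λ_ (𝟙_ C)).hom ▷ X ≫ (λ_ X).hom =
      (α_ (𝟙_ C) (𝟙_ C) X).hom ≫ 𝟙_ C ◁ (λ_ X).hom ≫ (λ_ X).hom
    monoidal
  actRight_one := by
    change X ◁ 𝟙 (𝟙_ C) ≫ (ρ_ X).hom = (ρ_ X).hom
    simp
  right_assoc := by
    change X ◁ (λ_ (𝟙_ C)).hom ≫ (ρ_ X).hom =
      (α_ X (𝟙_ C) (𝟙_ C)).inv ≫ (ρ_ X).hom ▷ 𝟙_ C ≫ (ρ_ X).hom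
    monoidal
  middle_assoc := by
    change ((λ_ X).hom) ▷ 𝟙_ C ≫ (ρ_ X).hom = (α_ (𝟙_ C) X (𝟙_ C)).hom ≫ 𝟙_ C ◁ ((ρ_ X).hom) ≫ (λ_ X).hom
    simp

/-- A morphism of the ambient category as a map of `𝒰`-`𝒰`-bimodules. -/
def unitUnitBimodMap {X Y : C} (f : X ⟶ Y) : unitUnitBimod X ⟶ unitUnitBimod Y :=
  Bimod.Hom.mk (M := unitUnitBimod X) (N := unitUnitBimod Y) f
    (leftUnitor_naturality f).symm (rightUnitor_naturality f).symm

/-- The `𝒰`-`𝒬`-bimodule `_𝒰Q_𝒬 = (Q, l_Q, m)` of a monoid `𝒬 = (Q, m, η)`. -/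
def unitMonBimod (Q : Mon C) : Bimod (Mon.trivial C) Q where
  X := Q.X
  actLeft := (λ_ Q.X).hom
  actRight := μ[Q.X]
  one_actLeft := by
    change 𝟙 (𝟙_ C) ▷ Q.X ≫ (λ_ Q.X).hom = (λ_ Q.X).hom
    simp
  left_assoc := by
    change (λ_ (𝟙_ C)).hom ▷ Q.X ≫ (λ_ Q.X).hom =
      (α_ (𝟙_ C) (𝟙_ C) Q.X).hom ≫ 𝟙_ C ◁ (λ_ Q.X).hom ≫ (λ_ Q.X).hom
    monoidal
  actRight_one := by simp
  right_assoc := by simp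
  middle_assoc := by
    change ((λ_ Q.X).hom) ▷ Q.X ≫ μ[Q.X] = (α_ (𝟙_ C) Q.X Q.X).hom ≫ 𝟙_ C ◁ (μ[Q.X]) ≫ (λ_ Q.X).hom
    simp

/-- The `𝒬`-`𝒰`-bimodule `_𝒬Q_𝒰 = (Q, m, r_Q)` of a monoid `𝒬 = (Q, m, η)`. -/
def monUnitBimod (Q : Mon C) : Bimod Q (Mon.trivial C) where
  X := Q.X
  actLeft := μ[Q.X]
  actRight := (ρ_ Q.X).hom
  one_actLeft := by simp
  left_assoc := by simp
  actRight_one := by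
    change Q.X ◁ 𝟙 (𝟙_ C) ≫ (ρ_ Q.X).hom = (ρ_ Q.X).hom
    simp
  right_assoc := by
    change Q.X ◁ (λ_ (𝟙_ C)).hom ≫ (ρ_ Q.X).hom =
      (α_ Q.X (𝟙_ C) (𝟙_ C)).inv ≫ (ρ_ Q.X).hom ▷ 𝟙_ C ≫ (ρ_ Q.X).hom
    monoidal
  middle_assoc := by
    change (μ[Q.X]) ▷ 𝟙_ C ≫ (ρ_ Q.X).hom = (α_ Q.X Q.X (𝟙_ C)).hom ≫ Q.X ◁ ((ρ_ Q.X).hom) ≫ μ[Q.X]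
    simp

theorem unit_left_aux (Q : Mon C) {T : C} (p : Q.X ⊗ Q.X ⟶ T) (t : T ⟶ Q.X) (h : p ≫ t = μ[Q.X]) :
    ((α_ (𝟙_ C) Q.X Q.X).inv ≫ (λ_ Q.X).hom ▷ Q.X ≫ p) ≫ t =
      𝟙_ C ◁ p ≫ 𝟙_ C ◁ t ≫ (λ_ Q.X).hom := by
  rw [← MonoidalCategory.whiskerLeft_comp_assoc, Category.assoc, Category.assoc, h]
  simp

theorem unit_right_aux (Q : Mon C) {T : C} (p : Q.X ⊗ Q.X ⟶ T) (t : T ⟶ Q.X) (h : p ≫ t = μ[Q.X]) :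
    ((α_ Q.X Q.X (𝟙_ C)).hom ≫ Q.X ◁ (ρ_ Q.X).hom ≫ p) ≫ t =
      p ▷ 𝟙_ C ≫ t ▷ 𝟙_ C ≫ (ρ_ Q.X).hom := by
  rw [← MonoidalCategory.comp_whiskerRight_assoc, Category.assoc, Category.assoc, h]
  simp

section Bicat

variable [HasCoequalizers C]

section

variable (C)

/-- The bicategory `BIM(C)` of internal bimodules: 0-cells are the monoids of `C`, 1-cells are
bimodules, 2-cells are bimodule maps, horizontal composition is the tensor product of bimodules
(constructed as a coequalizer). The composite `M ≫ N` of an `𝒜`-`ℬ`-bimodule and a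
`ℬ`-`𝒞`-bimodule is `M ⊗_ℬ N`. -/
structure BIM where
  /-- the monoid -/
  mon : Mon C

variable [∀ X : C, PreservesColimitsOfSize.{0, 0} (tensorLeft X)]
  [∀ X : C, PreservesColimitsOfSize.{0, 0} (tensorRight X)]

noncomputable instance : Bicategory (BIM C) where
  Hom X Y := Bimod X.mon Y.mon
  homCategory X Y := (inferInstance : Category (Bimod X.mon Y.mon))
  id X := Bimod.regular X.mon
  comp M N := Bimod.tensorBimod M N
  whiskerLeft L _ _ f := Bimod.whiskerLeft L f
  whiskerRight f N := Bimod.whiskerRight f N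
  associator := Bimod.associatorBimod
  leftUnitor := Bimod.leftUnitorBimod
  rightUnitor := Bimod.rightUnitorBimod
  whiskerLeft_id _ _ := Bimod.whiskerLeft_id_bimod
  whiskerLeft_comp M _ _ _ f g := Bimod.whiskerLeft_comp_bimod M f g
  id_whiskerLeft := Bimod.id_whiskerLeft_bimod
  comp_whiskerLeft M N _ _ f := Bimod.comp_whiskerLeft_bimod M N f
  id_whiskerRight _ _ := Bimod.id_whiskerRight_bimod
  comp_whiskerRight f g Q := Bimod.comp_whiskerRight_bimod f g Q
  whiskerRight_id := Bimod.whiskerRight_id_bimod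
  whiskerRight_comp := Bimod.whiskerRight_comp_bimod
  whisker_assoc M _ _ f P := Bimod.whisker_assoc_bimod M f P
  whisker_exchange := Bimod.whisker_exchange_bimod
  pentagon := Bimod.pentagon_bimod
  triangle := Bimod.triangle_bimod

noncomputable instance [Preadditive C] [MonoidalPreadditive C] (a b : BIM C) :
    Preadditive (a ⟶ b) :=
  inferInstanceAs (Preadditive (Bimod a.mon b.mon))

end

variable [∀ X : C, PreservesColimitsOfSize.{0, 0} (tensorLeft X)]
  [∀ X : C, PreservesColimitsOfSize.{0, 0} (tensorRight X)]

namespace BIM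

variable (C) in
/-- The trivial monoid `𝒰` as a 0-cell. -/
def triv : BIM C := ⟨Mon.trivial C⟩

/-- A monoid as a 0-cell. -/
def ofMon (Q : Mon C) : BIM C := ⟨Q⟩

/-- The 1-cell `_𝒰Q_𝒬`. -/
def ext (Q : Mon C) : triv C ⟶ ofMon Q := unitMonBimod Q

/-- The 1-cell `_𝒬Q_𝒰`. -/
def extBar (Q : Mon C) : ofMon Q ⟶ triv C := monUnitBimod Q

/-- The 1-cell `_𝒰X_𝒰`. -/
def ofObj (X : C) : triv C ⟶ triv C := unitUnitBimod X

/-- The 2-cell given by a morphism of `C`. -/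
def ofHom {X Y : C} (f : X ⟶ Y) : ofObj X ⟶ ofObj Y := unitUnitBimodMap f

/-- The morphism of `C` underlying a 2-cell. -/
def hom {a b : BIM C} {f g : a ⟶ b} (φ : f ⟶ g) : Bimod.X f ⟶ Bimod.X g :=
  Bimod.Hom.hom φ

/-- The canonical projection `τ : M ⊗ N ⟶ M ⊗_ℬ N` onto the coequalizer. -/
noncomputable def proj {a b c : BIM C} (f : a ⟶ b) (g : b ⟶ c) :
    Bimod.X f ⊗ Bimod.X g ⟶ Bimod.X (f ≫ g) :=
  coequalizer.π _ _

theorem proj_leftUnitor (Q : Mon C) :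
    proj (ext Q) (extBar Q) ≫ Bimod.LeftUnitorBimod.hom (Bimod.regular Q) = μ[Q.X] :=
  coequalizer.π_desc _ _

/-- The isomorphism `t : _𝒰Q_𝒬 ⊗_𝒬 _𝒬Q_𝒰 ≅ _𝒰Q_𝒰` induced by the multiplication of `𝒬`. -/
noncomputable def multIso (Q : Mon C) : ext Q ≫ extBar Q ≅ ofObj Q.X :=
  Bimod.isoOfIso (C := C) (P := (unitMonBimod Q).tensorBimod (monUnitBimod Q))
    (Q := unitUnitBimod Q.X)
    { hom := Bimod.LeftUnitorBimod.hom (Bimod.regular Q)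
      inv := Bimod.LeftUnitorBimod.inv (Bimod.regular Q)
      hom_inv_id := Bimod.LeftUnitorBimod.hom_inv_id (Bimod.regular Q)
      inv_hom_id := Bimod.LeftUnitorBimod.inv_hom_id (Bimod.regular Q) }
    (by
      refine (cancel_epi ((tensorLeft (𝟙_ C)).map (coequalizer.π _ _))).1 ?_
      refine (Category.assoc _ _ _).symm.trans ?_
      refine (congrArg (· ≫ Bimod.LeftUnitorBimod.hom (Bimod.regular Q))
        (Bimod.TensorBimod.whiskerLeft_π_actLeft (unitMonBimod Q) (monUnitBimod Q))).trans ?_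
      exact unit_left_aux Q _ _ (proj_leftUnitor Q))
    (by
      refine (cancel_epi ((tensorRight (𝟙_ C)).map (coequalizer.π _ _))).1 ?_
      refine (Category.assoc _ _ _).symm.trans ?_
      refine (congrArg (· ≫ Bimod.LeftUnitorBimod.hom (Bimod.regular Q))
        (Bimod.TensorBimod.π_tensor_id_actRight (unitMonBimod Q) (monUnitBimod Q))).trans ?_
      exact unit_right_aux Q _ _ (proj_leftUnitor Q))

theorem proj_multIso (Q : Mon C) : proj (ext Q) (extBar Q) ≫ hom (multIso Q).hom = μ[Q.X] :=
  proj_leftUnitor Q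

end BIM

end Bicat

end InternalBimodules

section DepthTwo

open Bicategory BalTensor

/-- `X` is a direct summand in a finite direct sum of copies of `Y`. -/
def IsSummandOfCopies {C : Type*} [Category C] [Preadditive C] (X Y : C) : Prop :=
  ∃ (n : ℕ) (S : Limits.Bicone (fun _ : Fin n => Y)), Nonempty S.IsBilimit ∧ Nonempty (Retract X S.pt)

variable {𝒞 : Type*} [Bicategory 𝒞] [∀ a b : 𝒞, Preadditive (a ⟶ b)] {a b : 𝒞}

/-- The left D2 condition on a 1-cell `ι` with dual `ῑ`: `(ι × ῑ) × ι` is a direct summand in a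
finite direct sum of copies of `ι`. -/
def IsLeftD2 (ι : a ⟶ b) (ι' : b ⟶ a) : Prop := IsSummandOfCopies ((ι ≫ ι') ≫ ι) ι

/-- The right D2 condition on a 1-cell `ι` with dual `ῑ`: `(ῑ × ι) × ῑ` is a direct summand in a
finite direct sum of copies of `ῑ`. -/
def IsRightD2 (ι : a ⟶ b) (ι' : b ⟶ a) : Prop := IsSummandOfCopies ((ι' ≫ ι) ≫ ι') ι'

/-- The tensor product `A^L ⊗ _LA` of the ring `A` of 2-endomorphisms of `ι × ῑ` with itself over
the ring `L` of 2-endomorphisms of `ι`, for `a·l = a ∘ (l × ῑ)` and `l·a = (l × ῑ) ∘ a`. -/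
abbrev EndTensor (ι : a ⟶ b) (ι' : b ⟶ a) : Type _ :=
  BalTensor (R := (ι ⟶ ι)) (M := (ι ≫ ι' ⟶ ι ≫ ι')) (N := (ι ≫ ι' ⟶ ι ≫ ι'))
    (fun l => Preadditive.leftComp (ι ≫ ι') (l ▷ ι'))
    (fun l => Preadditive.rightComp (ι ≫ ι') (l ▷ ι'))

/-- The D2 quasi-basis property of `q = ∑ y_j ⊗ x_j`:
`∑ (y_j × ι) ∘ α⁻¹ ∘ (ι × coev_R) ∘ (ι × ev_L) ∘ α ∘ (x_j × ι) = id` on `(ι × ῑ) × ι`. -/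
def IsD2QuasiBasis {ι : a ⟶ b} {ι' : b ⟶ a} (evL : ι' ≫ ι ⟶ 𝟙 b) (coevR : 𝟙 b ⟶ ι' ≫ ι)
    (q : EndTensor ι ι') : Prop :=
  ∀ (n : ℕ) (y x : Fin n → (ι ≫ ι' ⟶ ι ≫ ι')), q = ∑ j, tmul _ _ (y j) (x j) →
    ∑ j, (x j ▷ ι) ≫ (α_ ι ι' ι).hom ≫ (ι ◁ evL) ≫ (ι ◁ coevR) ≫ (α_ ι ι' ι).inv ≫ (y j ▷ ι) =
      𝟙 ((ι ≫ ι') ≫ ι)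

end DepthTwo

namespace RightBialgebroid

open BalTensor

variable {A R : Type u} [Ring A] [Ring R] (B : RightBialgebroid A R)

/-- The right regular module `A_A`. -/
def reg : B.Mod := Mod.of B A

/-- An element of `A` as an element of the regular module. -/
def toReg : A ≃+ B.reg := AddEquiv.refl A

/-- An element of the base ring as an element of the monoidal unit `R_A`. -/
def toUnitObj : R ≃+ (𝟙_ B.Mod : B.Mod) := AddEquiv.refl R

/-- The elementary tensor `m ⊗ n` in the monoidal product of `ℳ_A`. -/
def Mod.elem {B : RightBialgebroid A R} {M N : B.Mod} (m : M) (n : N) : (M ⊗ N : B.Mod) :=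
  Mod.tm m n

/-- Left multiplication `Λ(h) k = h k`, an endomorphism of the right regular module. -/
def leftMul (h : A) : B.reg ⟶ B.reg :=
  Mod.ofLin (M := B.reg) (N := B.reg)
    { toFun := fun k : A => (h * k : A)
      map_add' := fun k k' => mul_add (R := A) h k k'
      map_smul' := fun a k => (mul_assoc (G := A) h k a.unop).symm }

/-- The coproduct `γ` as a morphism `A_A ⟶ A_A ⊗ A_A`. -/
def comulHom : B.reg ⟶ B.reg ⊗ B.reg :=
  Mod.ofLin (M := B.reg) (N := Mod.tensor B.reg B.reg)
    { B.γ with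
      map_smul' := fun a (k : A) => by
        change B.γ (k * a.unop) = B.diagAct a.unop (B.γ k)
        obtain ⟨n, x, y, h⟩ := exists_rep (B.γ k)
        obtain ⟨n', z, w, h'⟩ := exists_rep (B.γ a.unop)
        rw [B.γ_mul k a.unop n n' x y z w h h', h, map_sum]
        refine Finset.sum_congr rfl (fun j _ => ?_)
        rw [B.diagAct_of_rep _ _ _ z w h']
        rfl }

/-- The counit `π` as a morphism from `A_A` to the monoidal unit `R_A`. -/
def counitHom : B.reg ⟶ 𝟙_ B.Mod :=
  Mod.ofLin (M := B.reg) (N := Mod.of B B.UnitMod)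
    { B.π with
      map_smul' := fun a k => (B.π_s_mul k a.unop).symm }

end RightBialgebroid

namespace HopfAlgebroid

open MonObj

variable {H R : Type u} {L : Type v} [Ring H] [Ring R] [Ring L] (𝓗 : HopfAlgebroid H L R)

/-- The monoid `𝒬 = (H_H, ∗, η)` for a monoid structure on the right regular module. -/
abbrev monReg [MonObj 𝓗.right.reg] : Mon 𝓗.right.Mod := Mon.mk 𝓗.right.reg

/-- The `𝒰`-`𝒬`-bimodule `𝒳 = (H_H, l_H, ∗)`. -/
abbrev calX [MonObj 𝓗.right.reg] : BIM.triv 𝓗.right.Mod ⟶ BIM.ofMon 𝓗.monReg :=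
  BIM.ext 𝓗.monReg

/-- The `𝒬`-`𝒰`-bimodule `𝒳̄ = (H_H, ∗, r_H)`. -/
abbrev calXbar [MonObj 𝓗.right.reg] : BIM.ofMon 𝓗.monReg ⟶ BIM.triv 𝓗.right.Mod :=
  BIM.extBar 𝓗.monReg

/-- Left multiplication `Λ(h)` as a 2-endomorphism of `𝒳 ⊗_𝒬 𝒳̄ ≅ (H_H, l_H, r_H)`. -/
noncomputable def Lam [MonObj 𝓗.right.reg] (h : H) : 𝓗.calX ≫ 𝓗.calXbar ⟶ 𝓗.calX ≫ 𝓗.calXbar :=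
  (BIM.multIso 𝓗.monReg).hom ≫ BIM.ofHom (𝓗.right.leftMul h) ≫ (BIM.multIso 𝓗.monReg).inv

/-- The monoid structure on `H_H` is the convolution product of the integral `i`, with unit
`η(r) = i s_R(r)`. -/
structure IsConvolution {i : H} (hi : 𝓗.IsNondegenerate i) [MonObj 𝓗.right.reg] : Prop where
  mul : ∀ h k : H, RightBialgebroid.Mod.lin μ[𝓗.right.reg]
    (RightBialgebroid.Mod.elem (𝓗.right.toReg h) (𝓗.right.toReg k)) = 𝓗.right.toReg (conv hi h k)
  one : ∀ r : R, RightBialgebroid.Mod.lin η[𝓗.right.reg] (𝓗.right.toUnitObj r) =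
    𝓗.right.toReg (i * 𝓗.right.s r)

/-- The evaluations and coevaluations of the two dualities between `𝒳` and `𝒳̄` are
`ev_L = ∗`, `coev_L = t⁻¹ ∘ η`, `ev_R = π_R ∘ t`, `coev_R = γ_R`, where
`t : 𝒳 ⊗_𝒬 𝒳̄ ≅ (H_H, l_H, r_H)` is induced by `∗`, and `𝒳̄ ⊗_𝒰 𝒳` is identified with `H_H ⊗ H_H`
by the canonical projection. -/
structure IsCanonicalDuality [MonObj 𝓗.right.reg]
    (adjL : Bicategory.Adjunction 𝓗.calX 𝓗.calXbar)
    (adjR : Bicategory.Adjunction 𝓗.calXbar 𝓗.calX) : Prop where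
  evL : BIM.proj 𝓗.calXbar 𝓗.calX ≫ BIM.hom adjL.counit = μ[𝓗.right.reg]
  coevL : BIM.hom adjL.unit ≫ BIM.hom (BIM.multIso 𝓗.monReg).hom = η[𝓗.right.reg]
  evR : BIM.hom adjR.counit = BIM.hom (BIM.multIso 𝓗.monReg).hom ≫ 𝓗.right.counitHom
  coevR : BIM.hom adjR.unit = 𝓗.right.comulHom ≫ BIM.proj 𝓗.calXbar 𝓗.calX

end HopfAlgebroid

/-!
`𝒬` is a Frobenius monoid whose comultiplication is `γ_R` and whose counit is `π_R`. Indeed `h ∗ k`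
is the action of `_Li⁻¹(k)` on `h` as well as the action of `i_L⁻¹(h)` on `k`, and the mixed
coassociativity laws make `γ_R` compatible with both actions; these are the two Frobenius relations.
That `∗` is `H`-linear comes from `i₁ a ⊗ i₂ = i₁ ⊗ i₂ S(a)`. Every monoid `𝒬` provides an
adjunction `𝒳 ⊣ 𝒳̄`, and a Frobenius structure on it provides the opposite adjunction.

For `γ_L(i) = ∑ x_j ⊗ y_j` the antipode laws give `∑ S(x_j) (y_j a)⁽¹⁾ ⊗ (y_j a)⁽²⁾ = a ⊗ i` and
`∑ (x_j a)⁽¹⁾ ⊗ S⁻¹(y_j) (x_j a)⁽²⁾ = i ⊗ a`. As `i` is the unit of `∗`, the Frobenius relations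
turn these identities into decompositions of the identity maps of `(𝒳 × 𝒳̄) × 𝒳` and
`(𝒳̄ × 𝒳) × 𝒳̄` that factor through `𝒳` and `𝒳̄`: the first is the quasi-basis equation, and the two
together are the D2 conditions.
-/

section DepthTwoCriteria

open CategoryTheory.Limits

theorem isSummandOfCopies_of_sum_comp_eq_id {D : Type*} [Category D] [Preadditive D]
    [HasFiniteBiproducts D] {X Y : D} {n : ℕ} (f : Fin n → (X ⟶ Y)) (g : Fin n → (Y ⟶ X))
    (h : ∑ j, f j ≫ g j = 𝟙 X) : IsSummandOfCopies X Y :=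
  ⟨n, biproduct.bicone _, ⟨biproduct.isBilimit _⟩,
    ⟨⟨biproduct.lift f, biproduct.desc g, biproduct.lift_desc.trans h⟩⟩⟩

open scoped Bicategory
open BalTensor

variable {𝒞 : Type*} [Bicategory 𝒞] {a b c d : 𝒞}

theorem associator_conj_whiskerLeft_comm {f : a ⟶ b} {g : b ⟶ c} {h : c ⟶ d} (l : f ⟶ f)
    (ψ : g ≫ h ⟶ g ≫ h) :
    ((α_ f g h).hom ≫ f ◁ ψ ≫ (α_ f g h).inv) ≫ (l ▷ g) ▷ h =
      (l ▷ g) ▷ h ≫ (α_ f g h).hom ≫ f ◁ ψ ≫ (α_ f g h).inv := by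
  simp only [Category.assoc]
  rw [Bicategory.associator_naturality_left_assoc, ← Bicategory.whisker_exchange_assoc,
    Bicategory.associator_inv_naturality_left]

variable [∀ a b : 𝒞, Preadditive (a ⟶ b)] {f : a ⟶ b} {g : b ⟶ a}

/-- The map `y ⊗ x ↦ (y × f) ∘ α⁻¹ ∘ (f × ψ) ∘ α ∘ (x × f)` on `A ⊗_E A`. For `ψ = coev_R ∘ ev_L`
its value is the left-hand side of the quasi-basis equation. -/
def sandwich (whiskerRight_add : ∀ x x' : f ≫ g ⟶ f ≫ g, (x + x') ▷ f = x ▷ f + x' ▷ f)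
    (ψ : g ≫ f ⟶ g ≫ f) : EndTensor f g →+ ((f ≫ g) ≫ f ⟶ (f ≫ g) ≫ f) :=
  lift
    (AddMonoidHom.mk'
      (fun y => AddMonoidHom.mk'
        (fun x => x ▷ f ≫ ((α_ f g f).hom ≫ f ◁ ψ ≫ (α_ f g f).inv) ≫ y ▷ f)
        (fun x x' => by rw [whiskerRight_add, Preadditive.add_comp]))
      (fun y y' => by
        ext x
        simp only [AddMonoidHom.mk'_apply, AddMonoidHom.add_apply, whiskerRight_add,
          Preadditive.comp_add]))
    (fun l y x => by
      change x ▷ f ≫ (_ ≫ _ ≫ _) ≫ (l ▷ g ≫ y) ▷ f = (x ≫ l ▷ g) ▷ f ≫ (_ ≫ _ ≫ _) ≫ y ▷ f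
      rw [Bicategory.comp_whiskerRight, Bicategory.comp_whiskerRight,
        ← Category.assoc (_ ≫ _ ≫ _) ((l ▷ g) ▷ f), associator_conj_whiskerLeft_comm]
      simp only [Category.assoc])

theorem sandwich_tmul (whiskerRight_add : ∀ x x' : f ≫ g ⟶ f ≫ g, (x + x') ▷ f = x ▷ f + x' ▷ f)
    (ψ : g ≫ f ⟶ g ≫ f) (y x : f ≫ g ⟶ f ≫ g) :
    sandwich whiskerRight_add ψ (tmul _ _ y x) =
      x ▷ f ≫ ((α_ f g f).hom ≫ f ◁ ψ ≫ (α_ f g f).inv) ≫ y ▷ f :=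
  rfl

theorem isD2QuasiBasis_sum_tmul
    (whiskerRight_add : ∀ x x' : f ≫ g ⟶ f ≫ g, (x + x') ▷ f = x ▷ f + x' ▷ f)
    (evL : g ≫ f ⟶ 𝟙 b) (coevR : 𝟙 b ⟶ g ≫ f) {m : ℕ} (y x : Fin m → (f ≫ g ⟶ f ≫ g))
    (h : ∑ j, (x j ▷ f) ≫ (α_ f g f).hom ≫ (f ◁ evL) ≫ (f ◁ coevR) ≫ (α_ f g f).inv ≫
      (y j ▷ f) = 𝟙 ((f ≫ g) ≫ f)) :
    IsD2QuasiBasis evL coevR (∑ j, tmul _ _ (y j) (x j) : EndTensor f g) := by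
  have sandwich_sum : ∀ {n : ℕ} (y x : Fin n → (f ≫ g ⟶ f ≫ g)),
      sandwich whiskerRight_add (evL ≫ coevR) (∑ j, tmul _ _ (y j) (x j)) =
        ∑ j, (x j ▷ f) ≫ (α_ f g f).hom ≫ (f ◁ evL) ≫ (f ◁ coevR) ≫ (α_ f g f).inv ≫
          (y j ▷ f) := by
    intro n y x
    simp only [map_sum, sandwich_tmul, Bicategory.whiskerLeft_comp, Category.assoc]
  intro n y' x' hq
  rw [← sandwich_sum, ← hq, sandwich_sum, h]

end DepthTwoCriteria

section BimoduleBiproducts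

open CategoryTheory.Limits

variable {C : Type u} [Category.{v} C] [MonoidalCategory C] [Preadditive C]
  [MonoidalPreadditive C] {A B : Mon C}

theorem bimod_sum_hom {M N : Bimod A B} {J : Type*} (s : Finset J) (φ : J → (M ⟶ N)) :
    (∑ j ∈ s, φ j).hom = ∑ j ∈ s, (φ j).hom :=
  map_sum (AddMonoidHom.mk' (fun φ : M ⟶ N => φ.hom) (fun _ _ => rfl)) φ s

variable [HasFiniteBiproducts C] {n : ℕ} (P : Fin n → Bimod A B)

/-- The direct sum of a finite family of bimodules, with the componentwise actions. -/
noncomputable def bimodDirectSum : Bimod A B where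
  X := ⨁ fun j => (P j).X
  actLeft := biproduct.lift fun j => A.X ◁ biproduct.π _ j ≫ (P j).actLeft
  actRight := biproduct.lift fun j => biproduct.π _ j ▷ B.X ≫ (P j).actRight
  one_actLeft := by
    refine biproduct.hom_ext _ _ (fun j => ?_)
    rw [Category.assoc, biproduct.lift_π, ← whisker_exchange_assoc, (P j).one_actLeft,
      leftUnitor_naturality]
  left_assoc := by
    refine biproduct.hom_ext _ _ (fun j => ?_)
    simp only [Category.assoc, biproduct.lift_π]
    rw [← whisker_exchange_assoc, (P j).left_assoc, ← MonoidalCategory.whiskerLeft_comp_assoc,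
      biproduct.lift_π]
    simp
  actRight_one := by
    refine biproduct.hom_ext _ _ (fun j => ?_)
    rw [Category.assoc, biproduct.lift_π, whisker_exchange_assoc, (P j).actRight_one,
      rightUnitor_naturality]
  right_assoc := by
    refine biproduct.hom_ext _ _ (fun j => ?_)
    simp only [Category.assoc, biproduct.lift_π]
    rw [whisker_exchange_assoc, (P j).right_assoc, ← comp_whiskerRight_assoc, biproduct.lift_π]
    simp
  middle_assoc := by
    refine biproduct.hom_ext _ _ (fun j => ?_)
    simp only [Category.assoc, biproduct.lift_π]
    rw [← comp_whiskerRight_assoc, biproduct.lift_π, ← MonoidalCategory.whiskerLeft_comp_assoc,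
      biproduct.lift_π]
    simp

/-- The direct sum of a finite family of bimodules with its projections and inclusions. -/
noncomputable def bimodBicone : Bicone P where
  pt := bimodDirectSum P
  π j :=
    { hom := biproduct.π (fun j => (P j).X) j
      left_act_hom := biproduct.lift_π _ _
      right_act_hom := biproduct.lift_π _ _ }
  ι j :=
    { hom := biproduct.ι (fun j => (P j).X) j
      left_act_hom := by
        refine biproduct.hom_ext _ _ (fun k => ?_)
        simp only [bimodDirectSum, Category.assoc, biproduct.lift_π,
          ← MonoidalCategory.whiskerLeft_comp_assoc]
        obtain rfl | h := eq_or_ne j k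
        · simp
        · simp [biproduct.ι_π_ne _ h]
      right_act_hom := by
        refine biproduct.hom_ext _ _ (fun k => ?_)
        simp only [bimodDirectSum, Category.assoc, biproduct.lift_π, ← comp_whiskerRight_assoc]
        obtain rfl | h := eq_or_ne j k
        · simp
        · simp [biproduct.ι_π_ne _ h] }
  ι_π j k := by
    refine Bimod.hom_ext _ _ ?_
    change biproduct.ι (fun j => (P j).X) j ≫ biproduct.π (fun j => (P j).X) k = _
    obtain rfl | h := eq_or_ne j k
    · rw [biproduct.ι_π_self, dif_pos rfl]
      rfl
    · rw [biproduct.ι_π_ne _ h, dif_neg h]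
      rfl

theorem sum_bimodBicone_π_comp_ι :
    ∑ j, (bimodBicone P).π j ≫ (bimodBicone P).ι j = 𝟙 (bimodBicone P).pt :=
  Bimod.hom_ext _ _ ((bimod_sum_hom _ _).trans (biproduct.total (f := fun j => (P j).X)))

instance bimod_hasFiniteBiproducts : HasFiniteBiproducts (Bimod A B) where
  out _ := ⟨fun P => hasBiproduct_of_total (bimodBicone P) (sum_bimodBicone_π_comp_ι P)⟩

end BimoduleBiproducts

section InternalBimodules

open CategoryTheory.Limits MonObj

namespace BIM

variable {C : Type u} [Category.{v} C] [MonoidalCategory C] [HasCoequalizers C]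
  [∀ X : C, PreservesColimitsOfSize.{0, 0} (tensorLeft X)]
  [∀ X : C, PreservesColimitsOfSize.{0, 0} (tensorRight X)]

open scoped Bicategory

variable {a b c d : BIM C}

theorem hom_ext {f g : a ⟶ b} {φ ψ : f ⟶ g} (h : hom φ = hom ψ) : φ = ψ :=
  Bimod.hom_ext (M := f) (N := g) φ ψ h

theorem hom_comp {f g h : a ⟶ b} (φ : f ⟶ g) (ψ : g ⟶ h) : hom (φ ≫ ψ) = hom φ ≫ hom ψ := rfl

theorem hom_id (f : a ⟶ b) : hom (𝟙 f) = 𝟙 (Bimod.X f) := rfl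

instance epi_proj (f : a ⟶ b) (g : b ⟶ c) : Epi (proj f g) :=
  inferInstanceAs (Epi (coequalizer.π _ _))

instance epi_proj_whiskerRight (f : a ⟶ b) (g : b ⟶ c) (X : C) : Epi (proj f g ▷ X) :=
  inferInstanceAs (Epi ((tensorRight X).map (coequalizer.π _ _)))

instance epi_whiskerLeft_proj (f : a ⟶ b) (g : b ⟶ c) (X : C) : Epi (X ◁ proj f g) :=
  inferInstanceAs (Epi ((tensorLeft X).map (coequalizer.π _ _)))

theorem proj_condition (f : a ⟶ b) (g : b ⟶ c) :
    Bimod.actRight f ▷ Bimod.X g ≫ proj f g =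
      (α_ (Bimod.X f) b.mon.X (Bimod.X g)).hom ≫ Bimod.X f ◁ Bimod.actLeft g ≫ proj f g :=
  (coequalizer.condition _ _).trans (Category.assoc _ _ _)

theorem proj_comp_whiskerRight {f f' : a ⟶ b} (φ : f ⟶ f') (g : b ⟶ c) :
    proj f g ≫ hom (φ ▷ g) = hom φ ▷ Bimod.X g ≫ proj f' g :=
  ι_colimMap _ _

theorem proj_comp_whiskerLeft (f : a ⟶ b) {g g' : b ⟶ c} (φ : g ⟶ g') :
    proj f g ≫ hom (f ◁ φ) = Bimod.X f ◁ hom φ ≫ proj f g' :=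
  ι_colimMap _ _

theorem proj_comp_leftUnitor (f : a ⟶ b) :
    proj (𝟙 a) f ≫ hom (Bicategory.leftUnitor f).hom = Bimod.actLeft f :=
  coequalizer.π_desc _ _

theorem proj_comp_rightUnitor (f : a ⟶ b) :
    proj f (𝟙 b) ≫ hom (Bicategory.rightUnitor f).hom = Bimod.actRight f :=
  coequalizer.π_desc _ _

theorem proj_comp_associator (f : a ⟶ b) (g : b ⟶ c) (h : c ⟶ d) :
    proj f g ▷ Bimod.X h ≫ proj (f ≫ g) h ≫ hom (α_ f g h).hom =
      (α_ (Bimod.X f) (Bimod.X g) (Bimod.X h)).hom ≫ Bimod.X f ◁ proj g h ≫ proj f (g ≫ h) := by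
  have proj_comp : proj (f ≫ g) h ≫ hom (α_ f g h).hom = Bimod.AssociatorBimod.homAux f g h :=
    coequalizer.π_desc _ _
  rw [proj_comp]
  exact π_tensor_id_preserves_coequalizer_inv_desc _ _ _ _

theorem proj_comp_associator_inv (f : a ⟶ b) (g : b ⟶ c) (h : c ⟶ d) :
    Bimod.X f ◁ proj g h ≫ proj f (g ≫ h) ≫ hom (α_ f g h).inv =
      (α_ (Bimod.X f) (Bimod.X g) (Bimod.X h)).inv ≫ proj f g ▷ Bimod.X h ≫ proj (f ≫ g) h := by
  have proj_comp : proj f (g ≫ h) ≫ hom (α_ f g h).inv = Bimod.AssociatorBimod.invAux f g h :=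
    coequalizer.π_desc _ _
  rw [proj_comp]
  exact id_tensor_π_preserves_coequalizer_inv_desc _ _ _ _

theorem whiskerLeft_proj_comp_actLeft (f : a ⟶ b) (g : b ⟶ c) :
    a.mon.X ◁ proj f g ≫ Bimod.actLeft (f ≫ g) =
      (α_ a.mon.X (Bimod.X f) (Bimod.X g)).inv ≫ Bimod.actLeft f ▷ Bimod.X g ≫ proj f g :=
  Bimod.TensorBimod.whiskerLeft_π_actLeft f g

theorem proj_whiskerRight_comp_actRight (f : a ⟶ b) (g : b ⟶ c) :
    proj f g ▷ c.mon.X ≫ Bimod.actRight (f ≫ g) =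
      (α_ (Bimod.X f) (Bimod.X g) c.mon.X).hom ≫ Bimod.X f ◁ Bimod.actRight g ≫ proj f g :=
  Bimod.TensorBimod.π_tensor_id_actRight f g

section Preadditive

variable [Preadditive C] [MonoidalPreadditive C]

theorem hom_add {f g : a ⟶ b} (φ ψ : f ⟶ g) : hom (φ + ψ) = hom φ + hom ψ := rfl

theorem hom_sum {f g : a ⟶ b} {J : Type*} (s : Finset J) (φ : J → (f ⟶ g)) :
    hom (∑ j ∈ s, φ j) = ∑ j ∈ s, hom (φ j) :=
  bimod_sum_hom s φ

theorem add_whiskerRight {f f' : a ⟶ b} (φ ψ : f ⟶ f') (g : b ⟶ c) :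
    (φ + ψ) ▷ g = φ ▷ g + ψ ▷ g := by
  apply hom_ext
  rw [← cancel_epi (proj f g), hom_add, Preadditive.comp_add, proj_comp_whiskerRight,
    proj_comp_whiskerRight, proj_comp_whiskerRight, hom_add,
    MonoidalPreadditive.add_whiskerRight, Preadditive.add_comp]

instance hasFiniteBiproducts_hom [HasFiniteBiproducts C] : HasFiniteBiproducts (a ⟶ b) :=
  inferInstanceAs (HasFiniteBiproducts (Bimod a.mon b.mon))

end Preadditive

end BIM

end InternalBimodules

section HorizontalComposites

open CategoryTheory.Limits MonObj

namespace BIM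

variable {C : Type u} [Category.{v} C] [MonoidalCategory C] [HasCoequalizers C]
  [∀ X : C, PreservesColimitsOfSize.{0, 0} (tensorLeft X)]
  [∀ X : C, PreservesColimitsOfSize.{0, 0} (tensorRight X)]

open scoped Bicategory

variable {a b c : BIM C}

/-- The morphism out of a horizontal composite induced by a balanced morphism. -/
noncomputable def desc {f : a ⟶ b} {g : b ⟶ c} {Z : C} (p : Bimod.X f ⊗ Bimod.X g ⟶ Z)
    (balanced : Bimod.actRight f ▷ Bimod.X g ≫ p =
      (α_ (Bimod.X f) b.mon.X (Bimod.X g)).hom ≫ Bimod.X f ◁ Bimod.actLeft g ≫ p) :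
    Bimod.X (f ≫ g) ⟶ Z :=
  coequalizer.desc p (balanced.trans (Category.assoc _ _ _).symm)

theorem proj_comp_desc {f : a ⟶ b} {g : b ⟶ c} {Z : C} (p : Bimod.X f ⊗ Bimod.X g ⟶ Z) (hp) :
    proj f g ≫ desc p hp = p :=
  coequalizer.π_desc _ _

/-- The 2-cell out of a horizontal composite induced by a balanced bimodule map. -/
noncomputable def descCell {f : a ⟶ b} {g : b ⟶ c} {h : a ⟶ c}
    (p : Bimod.X f ⊗ Bimod.X g ⟶ Bimod.X h)
    (balanced : Bimod.actRight f ▷ Bimod.X g ≫ p =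
      (α_ (Bimod.X f) b.mon.X (Bimod.X g)).hom ≫ Bimod.X f ◁ Bimod.actLeft g ≫ p)
    (left_linear : (α_ a.mon.X (Bimod.X f) (Bimod.X g)).inv ≫ Bimod.actLeft f ▷ Bimod.X g ≫ p =
      a.mon.X ◁ p ≫ Bimod.actLeft h)
    (right_linear : (α_ (Bimod.X f) (Bimod.X g) c.mon.X).hom ≫
      Bimod.X f ◁ Bimod.actRight g ≫ p = p ▷ c.mon.X ≫ Bimod.actRight h) : f ≫ g ⟶ h :=
  Bimod.Hom.mk (M := f ≫ g) (N := h) (desc p balanced)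
    (by
      refine (cancel_epi (a.mon.X ◁ proj f g)).1 ?_
      refine (Category.assoc _ _ _).symm.trans ?_
      rw [whiskerLeft_proj_comp_actLeft, Category.assoc, Category.assoc, proj_comp_desc,
        left_linear, ← MonoidalCategory.whiskerLeft_comp_assoc, proj_comp_desc])
    (by
      refine (cancel_epi (proj f g ▷ c.mon.X)).1 ?_
      refine (Category.assoc _ _ _).symm.trans ?_
      rw [proj_whiskerRight_comp_actRight, Category.assoc, Category.assoc, proj_comp_desc,
        right_linear, ← MonoidalCategory.comp_whiskerRight_assoc, proj_comp_desc])

theorem proj_comp_descCell {f : a ⟶ b} {g : b ⟶ c} {h : a ⟶ c}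
    (p : Bimod.X f ⊗ Bimod.X g ⟶ Bimod.X h) (hb hl hr) :
    proj f g ≫ hom (descCell p hb hl hr) = p :=
  proj_comp_desc p hb

/-- The 2-cell `h ⟶ f ≫ g` given by a bimodule map from `h` to the external product `f ⊗ g`. -/
noncomputable def projCell {f : a ⟶ b} {g : b ⟶ c} {h : a ⟶ c}
    (p : Bimod.X h ⟶ Bimod.X f ⊗ Bimod.X g)
    (left_linear : a.mon.X ◁ p ≫ (α_ a.mon.X (Bimod.X f) (Bimod.X g)).inv ≫
      Bimod.actLeft f ▷ Bimod.X g = Bimod.actLeft h ≫ p)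
    (right_linear : p ▷ c.mon.X ≫ (α_ (Bimod.X f) (Bimod.X g) c.mon.X).hom ≫
      Bimod.X f ◁ Bimod.actRight g = Bimod.actRight h ≫ p) : h ⟶ f ≫ g :=
  Bimod.Hom.mk (M := h) (N := f ≫ g) (p ≫ proj f g)
    (by
      rw [MonoidalCategory.whiskerLeft_comp, Category.assoc, whiskerLeft_proj_comp_actLeft,
        ← Category.assoc, ← left_linear]
      simp only [Category.assoc])
    (by
      rw [MonoidalCategory.comp_whiskerRight, Category.assoc, proj_whiskerRight_comp_actRight,
        ← Category.assoc, ← right_linear]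
      simp only [Category.assoc])

section Zigzag

variable {f : a ⟶ b} {g : b ⟶ a}

theorem proj_comp_whiskerRight_associator_whiskerLeft {j : a ⟶ a} {k : b ⟶ b} (φ : j ⟶ f ≫ g)
    (ψ : g ≫ f ⟶ k) (p : Bimod.X j ⟶ Bimod.X f ⊗ Bimod.X g)
    (e : Bimod.X g ⊗ Bimod.X f ⟶ Bimod.X k) (hp : hom φ = p ≫ proj f g)
    (he : proj g f ≫ hom ψ = e) :
    proj j f ≫ hom (φ ▷ f ≫ (α_ f g f).hom ≫ f ◁ ψ) =
      p ▷ Bimod.X f ≫ (α_ (Bimod.X f) (Bimod.X g) (Bimod.X f)).hom ≫ Bimod.X f ◁ e ≫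
        proj f k := by
  have := congrArg (· ≫ hom (f ◁ ψ)) (proj_comp_associator f g f)
  simp only [Category.assoc] at this
  rw [hom_comp, hom_comp, ← Category.assoc, proj_comp_whiskerRight, hp,
    MonoidalCategory.comp_whiskerRight, Category.assoc, Category.assoc, this, ← he,
    MonoidalCategory.whiskerLeft_comp, Category.assoc, proj_comp_whiskerLeft]

theorem proj_comp_whiskerLeft_associator_whiskerRight {j : a ⟶ a} {k : b ⟶ b} (φ : j ⟶ f ≫ g)
    (ψ : g ≫ f ⟶ k) (p : Bimod.X j ⟶ Bimod.X f ⊗ Bimod.X g)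
    (e : Bimod.X g ⊗ Bimod.X f ⟶ Bimod.X k) (hp : hom φ = p ≫ proj f g)
    (he : proj g f ≫ hom ψ = e) :
    proj g j ≫ hom (g ◁ φ ≫ (α_ g f g).inv ≫ ψ ▷ g) =
      Bimod.X g ◁ p ≫ (α_ (Bimod.X g) (Bimod.X f) (Bimod.X g)).inv ≫ e ▷ Bimod.X g ≫
        proj k g := by
  have := congrArg (· ≫ hom (ψ ▷ g)) (proj_comp_associator_inv g f g)
  simp only [Category.assoc] at this
  rw [hom_comp, hom_comp, ← Category.assoc, proj_comp_whiskerLeft, hp,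
    MonoidalCategory.whiskerLeft_comp, Category.assoc, Category.assoc, this, ← he,
    MonoidalCategory.comp_whiskerRight, Category.assoc, proj_comp_whiskerRight]

variable (φ : 𝟙 a ⟶ f ≫ g) (ψ : g ≫ f ⟶ 𝟙 b)
  (p : a.mon.X ⟶ Bimod.X f ⊗ Bimod.X g) (e : Bimod.X g ⊗ Bimod.X f ⟶ b.mon.X)

theorem leftZigzag_eq (hp : hom φ = p ≫ proj f g) (he : proj g f ≫ hom ψ = e)
    (h : p ▷ Bimod.X f ≫ (α_ (Bimod.X f) (Bimod.X g) (Bimod.X f)).hom ≫ Bimod.X f ◁ e ≫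
      Bimod.actRight f = Bimod.actLeft f) :
    Bicategory.leftZigzag φ ψ =
      (Bicategory.leftUnitor f).hom ≫ (Bicategory.rightUnitor f).inv := by
  have leftZigzag_def : Bicategory.leftZigzag φ ψ = φ ▷ f ≫ (α_ f g f).hom ≫ f ◁ ψ := by
    simp [bicategoricalComp]
  rw [leftZigzag_def, Iso.eq_comp_inv]
  apply hom_ext
  refine (cancel_epi (proj (𝟙 a) f)).1 ?_
  rw [proj_comp_leftUnitor, hom_comp, ← Category.assoc,
    proj_comp_whiskerRight_associator_whiskerLeft φ ψ p e hp he]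
  simp only [Category.assoc]
  rw [proj_comp_rightUnitor]
  exact h

theorem rightZigzag_eq (hp : hom φ = p ≫ proj f g) (he : proj g f ≫ hom ψ = e)
    (h : Bimod.X g ◁ p ≫ (α_ (Bimod.X g) (Bimod.X f) (Bimod.X g)).inv ≫ e ▷ Bimod.X g ≫
      Bimod.actLeft g = Bimod.actRight g) :
    Bicategory.rightZigzag φ ψ =
      (Bicategory.rightUnitor g).hom ≫ (Bicategory.leftUnitor g).inv := by
  have rightZigzag_def : Bicategory.rightZigzag φ ψ = g ◁ φ ≫ (α_ g f g).inv ≫ ψ ▷ g := by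
    simp [bicategoricalComp]
  rw [rightZigzag_def, Iso.eq_comp_inv]
  apply hom_ext
  refine (cancel_epi (proj g (𝟙 a))).1 ?_
  rw [proj_comp_rightUnitor, hom_comp, ← Category.assoc,
    proj_comp_whiskerLeft_associator_whiskerRight φ ψ p e hp he]
  simp only [Category.assoc]
  rw [proj_comp_leftUnitor]
  exact h

end Zigzag

section Triples

variable {f : a ⟶ b} {g : b ⟶ a} {j : a ⟶ a} (e : f ≫ g ≅ j)

instance isIso_hom {f g : a ⟶ b} (φ : f ⟶ g) [IsIso φ] : IsIso (hom φ) :=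
  ⟨hom (inv φ), by rw [← hom_comp, IsIso.hom_inv_id, hom_id],
    by rw [← hom_comp, IsIso.inv_hom_id, hom_id]⟩

/-- The canonical projection onto `(f × g) × f` read through an identification `f × g ≅ j`. -/
noncomputable def leftTriple : Bimod.X j ⊗ Bimod.X f ⟶ Bimod.X ((f ≫ g) ≫ f) :=
  hom e.inv ▷ Bimod.X f ≫ proj (f ≫ g) f

/-- The canonical projection onto `g × (f × g)` read through an identification `f × g ≅ j`. -/
noncomputable def rightTriple : Bimod.X g ⊗ Bimod.X j ⟶ Bimod.X (g ≫ f ≫ g) :=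
  Bimod.X g ◁ hom e.inv ≫ proj g (f ≫ g)

instance epi_leftTriple : Epi (leftTriple e) := epi_comp _ _

instance epi_rightTriple : Epi (rightTriple e) := epi_comp _ _

theorem leftTriple_comp_conj_whiskerRight (x : j ⟶ j) :
    leftTriple e ≫ hom ((e.hom ≫ x ≫ e.inv) ▷ f) = hom x ▷ Bimod.X f ≫ leftTriple e := by
  have inv_comp_conj : hom e.inv ≫ hom (e.hom ≫ x ≫ e.inv) = hom x ≫ hom e.inv := by
    rw [← hom_comp, ← hom_comp, Iso.inv_hom_id_assoc]
  rw [leftTriple, Category.assoc, proj_comp_whiskerRight,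
    ← MonoidalCategory.comp_whiskerRight_assoc, inv_comp_conj,
    MonoidalCategory.comp_whiskerRight_assoc]

theorem rightTriple_comp_whiskerLeft_conj (x : j ⟶ j) :
    rightTriple e ≫ hom (g ◁ (e.hom ≫ x ≫ e.inv)) = Bimod.X g ◁ hom x ≫ rightTriple e := by
  have inv_comp_conj : hom e.inv ≫ hom (e.hom ≫ x ≫ e.inv) = hom x ≫ hom e.inv := by
    rw [← hom_comp, ← hom_comp, Iso.inv_hom_id_assoc]
  rw [rightTriple, Category.assoc, proj_comp_whiskerLeft,
    ← MonoidalCategory.whiskerLeft_comp_assoc, inv_comp_conj,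
    MonoidalCategory.whiskerLeft_comp_assoc]

section Evaluation

variable {e} {m : Bimod.X f ⊗ Bimod.X g ⟶ Bimod.X j} (hm : proj f g ≫ hom e.hom = m)

include hm

theorem whiskerRight_comp_leftTriple :
    m ▷ Bimod.X f ≫ leftTriple e = proj f g ▷ Bimod.X f ≫ proj (f ≫ g) f := by
  rw [leftTriple, ← MonoidalCategory.comp_whiskerRight_assoc, ← hm, Category.assoc, ← hom_comp,
    Iso.hom_inv_id, hom_id, Category.comp_id]

theorem whiskerLeft_comp_rightTriple :
    Bimod.X g ◁ m ≫ rightTriple e = Bimod.X g ◁ proj f g ≫ proj g (f ≫ g) := by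
  rw [rightTriple, ← MonoidalCategory.whiskerLeft_comp_assoc, ← hm, Category.assoc, ← hom_comp,
    Iso.hom_inv_id, hom_id, Category.comp_id]

variable {k : b ⟶ b}

theorem leftTriple_comp_associator_whiskerLeft (ψ : g ≫ f ⟶ k) :
    m ▷ Bimod.X f ≫ leftTriple e ≫ hom ((α_ f g f).hom ≫ f ◁ ψ) =
      (α_ (Bimod.X f) (Bimod.X g) (Bimod.X f)).hom ≫ Bimod.X f ◁ (proj g f ≫ hom ψ) ≫
        proj f k := by
  have := congrArg (· ≫ hom (f ◁ ψ)) (proj_comp_associator f g f)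
  simp only [Category.assoc] at this
  rw [← Category.assoc, whiskerRight_comp_leftTriple hm, hom_comp, Category.assoc, this,
    proj_comp_whiskerLeft, MonoidalCategory.whiskerLeft_comp_assoc]

theorem proj_comp_whiskerLeft_associator_inv (φ : k ⟶ g ≫ f)
    (p : Bimod.X k ⟶ Bimod.X g ⊗ Bimod.X f) (hp : hom φ = p ≫ proj g f) :
    proj f k ≫ hom (f ◁ φ ≫ (α_ f g f).inv) =
      Bimod.X f ◁ p ≫ (α_ (Bimod.X f) (Bimod.X g) (Bimod.X f)).inv ≫ m ▷ Bimod.X f ≫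
        leftTriple e := by
  rw [whiskerRight_comp_leftTriple hm, ← proj_comp_associator_inv, hom_comp, ← Category.assoc,
    proj_comp_whiskerLeft, hp, MonoidalCategory.whiskerLeft_comp]
  simp only [Category.assoc]

theorem rightTriple_comp_associator_inv_whiskerRight (ψ : g ≫ f ⟶ k) :
    Bimod.X g ◁ m ≫ rightTriple e ≫ hom ((α_ g f g).inv ≫ ψ ▷ g) =
      (α_ (Bimod.X g) (Bimod.X f) (Bimod.X g)).inv ≫ (proj g f ≫ hom ψ) ▷ Bimod.X g ≫
        proj k g := by
  have := congrArg (· ≫ hom (ψ ▷ g)) (proj_comp_associator_inv g f g)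
  simp only [Category.assoc] at this
  rw [← Category.assoc, whiskerLeft_comp_rightTriple hm, hom_comp, Category.assoc, this,
    proj_comp_whiskerRight, MonoidalCategory.comp_whiskerRight_assoc]

theorem proj_comp_whiskerRight_associator (φ : k ⟶ g ≫ f)
    (p : Bimod.X k ⟶ Bimod.X g ⊗ Bimod.X f) (hp : hom φ = p ≫ proj g f) :
    proj k g ≫ hom (φ ▷ g ≫ (α_ g f g).hom) =
      p ▷ Bimod.X g ≫ (α_ (Bimod.X g) (Bimod.X f) (Bimod.X g)).hom ≫ Bimod.X g ◁ m ≫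
        rightTriple e := by
  rw [whiskerLeft_comp_rightTriple hm, ← proj_comp_associator, hom_comp, ← Category.assoc,
    proj_comp_whiskerRight, hp, MonoidalCategory.comp_whiskerRight]
  simp only [Category.assoc]

end Evaluation

variable [Preadditive C] [MonoidalPreadditive C] {n : ℕ} (x y : Fin n → (j ⟶ j))

theorem sum_conj_whiskerRight_eq_id {θ : (f ≫ g) ≫ f ⟶ (f ≫ g) ≫ f}
    {m : Bimod.X j ⊗ Bimod.X f ⟶ Bimod.X j ⊗ Bimod.X f}
    (hθ : leftTriple e ≫ hom θ = m ≫ leftTriple e)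
    (h : ∑ i, hom (x i) ▷ Bimod.X f ≫ m ≫ hom (y i) ▷ Bimod.X f = 𝟙 _) :
    ∑ i, (e.hom ≫ x i ≫ e.inv) ▷ f ≫ θ ≫ (e.hom ≫ y i ≫ e.inv) ▷ f = 𝟙 _ := by
  apply hom_ext
  rw [← cancel_epi (leftTriple e), hom_sum, Preadditive.comp_sum, hom_id, Category.comp_id]
  refine Eq.trans ?_ ((congrArg (· ≫ leftTriple e) h).trans (Category.id_comp _))
  rw [Preadditive.sum_comp]
  refine Finset.sum_congr rfl (fun i _ => ?_)
  rw [hom_comp, hom_comp, ← Category.assoc, leftTriple_comp_conj_whiskerRight,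
    Category.assoc, ← Category.assoc (leftTriple e), hθ, Category.assoc,
    leftTriple_comp_conj_whiskerRight]
  simp only [Category.assoc]

theorem sum_whiskerLeft_conj_eq_id {θ : g ≫ f ≫ g ⟶ g ≫ f ≫ g}
    {m : Bimod.X g ⊗ Bimod.X j ⟶ Bimod.X g ⊗ Bimod.X j}
    (hθ : rightTriple e ≫ hom θ = m ≫ rightTriple e)
    (h : ∑ i, Bimod.X g ◁ hom (x i) ≫ m ≫ Bimod.X g ◁ hom (y i) = 𝟙 _) :
    ∑ i, g ◁ (e.hom ≫ x i ≫ e.inv) ≫ θ ≫ g ◁ (e.hom ≫ y i ≫ e.inv) = 𝟙 _ := by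
  apply hom_ext
  rw [← cancel_epi (rightTriple e), hom_sum, Preadditive.comp_sum, hom_id, Category.comp_id]
  refine Eq.trans ?_ ((congrArg (· ≫ rightTriple e) h).trans (Category.id_comp _))
  rw [Preadditive.sum_comp]
  refine Finset.sum_congr rfl (fun i _ => ?_)
  rw [hom_comp, hom_comp, ← Category.assoc, rightTriple_comp_whiskerLeft_conj,
    Category.assoc, ← Category.assoc (rightTriple e), hθ, Category.assoc,
    rightTriple_comp_whiskerLeft_conj]
  simp only [Category.assoc]

end Triples

end BIM

end HorizontalComposites

section FrobeniusMonoids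

open CategoryTheory.Limits MonObj

section Definition

variable {C : Type u} [Category.{v} C] [MonoidalCategory C]

theorem lift_unit_comp_mul (Q : C) [MonObj Q] : ((λ_ Q).inv ≫ η[Q] ▷ Q) ≫ μ[Q] = 𝟙 Q := by
  simp

instance isSplitEpi_mul (Q : C) [MonObj Q] : IsSplitEpi μ[Q] :=
  ⟨⟨_, lift_unit_comp_mul Q⟩⟩

instance epi_mul_whiskerRight (Q X : C) [MonObj Q] : Epi (μ[Q] ▷ X) :=
  inferInstanceAs (Epi ((tensorRight X).map μ[Q]))

instance epi_whiskerLeft_mul (Q X : C) [MonObj Q] : Epi (X ◁ μ[Q]) :=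
  inferInstanceAs (Epi ((tensorLeft X).map μ[Q]))

/-- A comultiplication `δ` with counit `ν` that makes a monoid `Q` a Frobenius monoid.
Coassociativity is a consequence of the two Frobenius relations. -/
structure IsFrobeniusMonoid (Q : C) [MonObj Q] (δ : Q ⟶ Q ⊗ Q) (ν : Q ⟶ 𝟙_ C) : Prop where
  whiskerLeft_comul_comp_mul : Q ◁ δ ≫ (α_ Q Q Q).inv ≫ μ[Q] ▷ Q = μ[Q] ≫ δ
  comul_whiskerRight_comp_mul : δ ▷ Q ≫ (α_ Q Q Q).hom ≫ Q ◁ μ[Q] = μ[Q] ≫ δ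
  counit_comul : δ ≫ ν ▷ Q ≫ (λ_ Q).hom = 𝟙 Q
  comul_counit : δ ≫ Q ◁ ν ≫ (ρ_ Q).hom = 𝟙 Q

namespace IsFrobeniusMonoid

variable {Q : C} [MonObj Q] {δ : Q ⟶ Q ⊗ Q} {ν : Q ⟶ 𝟙_ C} (frob : IsFrobeniusMonoid Q δ ν)

include frob

theorem comul_whiskerRight_comp_pairing :
    δ ▷ Q ≫ (α_ Q Q Q).hom ≫ Q ◁ (μ[Q] ≫ ν) ≫ (ρ_ Q).hom = μ[Q] := by
  have := congrArg (· ≫ Q ◁ ν ≫ (ρ_ Q).hom) frob.comul_whiskerRight_comp_mul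
  simp only [Category.assoc, frob.comul_counit, Category.comp_id] at this
  rw [MonoidalCategory.whiskerLeft_comp, Category.assoc, this]

theorem whiskerLeft_comul_comp_pairing :
    Q ◁ δ ≫ (α_ Q Q Q).inv ≫ (μ[Q] ≫ ν) ▷ Q ≫ (λ_ Q).hom = μ[Q] := by
  have := congrArg (· ≫ ν ▷ Q ≫ (λ_ Q).hom) frob.whiskerLeft_comul_comp_mul
  simp only [Category.assoc, frob.counit_comul, Category.comp_id] at this
  rw [MonoidalCategory.comp_whiskerRight, Category.assoc, this]

section Sums

variable [Preadditive C] [MonoidalPreadditive C] {J : Type*} [Fintype J] (x y : J → (Q ⟶ Q))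

theorem sum_whiskerRight_mul_comul_eq_id
    (h : ∑ j, x j ≫ δ ≫ y j ▷ Q = (ρ_ Q).inv ≫ Q ◁ η[Q]) :
    ∑ j, x j ▷ Q ≫ (μ[Q] ≫ δ) ≫ y j ▷ Q = 𝟙 (Q ⊗ Q) := by
  calc
    _ = (∑ j, x j ≫ δ ≫ y j ▷ Q) ▷ Q ≫ (α_ Q Q Q).hom ≫ Q ◁ μ[Q] := by
      simp only [← frob.comul_whiskerRight_comp_mul, sum_whiskerRight, Preadditive.sum_comp,
        comp_whiskerRight, Category.assoc, associator_naturality_left_assoc, whisker_exchange]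
    _ = 𝟙 (Q ⊗ Q) := by
      rw [h]
      simp [← MonoidalCategory.whiskerLeft_comp]

theorem sum_whiskerLeft_mul_comul_eq_id
    (h : ∑ j, x j ≫ δ ≫ Q ◁ y j = (λ_ Q).inv ≫ η[Q] ▷ Q) :
    ∑ j, Q ◁ x j ≫ (μ[Q] ≫ δ) ≫ Q ◁ y j = 𝟙 (Q ⊗ Q) := by
  calc
    _ = Q ◁ (∑ j, x j ≫ δ ≫ Q ◁ y j) ≫ (α_ Q Q Q).inv ≫ μ[Q] ▷ Q := by
      simp only [← frob.whiskerLeft_comul_comp_mul, whiskerLeft_sum, Preadditive.sum_comp,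
        MonoidalCategory.whiskerLeft_comp, Category.assoc, associator_inv_naturality_right_assoc,
        whisker_exchange]
    _ = 𝟙 (Q ⊗ Q) := by
      rw [h, MonoidalCategory.whiskerLeft_comp, Category.assoc,
        associator_inv_naturality_middle_assoc, ← MonoidalCategory.comp_whiskerRight, mul_one]
      simp

end Sums

end IsFrobeniusMonoid

end Definition

namespace BIM

variable {C : Type u} [Category.{v} C] [MonoidalCategory C] [HasCoequalizers C]
  [∀ X : C, PreservesColimitsOfSize.{0, 0} (tensorLeft X)]
  [∀ X : C, PreservesColimitsOfSize.{0, 0} (tensorRight X)]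

open scoped Bicategory

variable (C) in
/-- The identity 1-cell of the trivial monoid is the monoidal unit, seen as a bimodule. -/
def idTrivIso : 𝟙 (triv C) ≅ ofObj (𝟙_ C) :=
  Bimod.isoOfIso (P := Bimod.regular (Mon.trivial C)) (Q := unitUnitBimod (𝟙_ C)) (Iso.refl _)
    (by
      change (λ_ (𝟙_ C)).hom ≫ 𝟙 (𝟙_ C) = 𝟙_ C ◁ 𝟙 (𝟙_ C) ≫ (λ_ (𝟙_ C)).hom
      simp)
    (by
      change (λ_ (𝟙_ C)).hom ≫ 𝟙 (𝟙_ C) = 𝟙 (𝟙_ C) ▷ 𝟙_ C ≫ (ρ_ (𝟙_ C)).hom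
      simp [unitors_equal])

variable (Q : Mon C)

/-- The multiplication of `Q` as the evaluation `𝒳̄ × 𝒳 ⟶ 𝒬`. -/
noncomputable def mulCell : extBar Q ≫ ext Q ⟶ 𝟙 (ofMon Q) :=
  descCell (f := extBar Q) (g := ext Q) (h := 𝟙 (ofMon Q)) (μ[Q.X] : Q.X ⊗ Q.X ⟶ Q.X)
    (by
      change (ρ_ Q.X).hom ▷ Q.X ≫ μ[Q.X] =
        (α_ Q.X (𝟙_ C) Q.X).hom ≫ Q.X ◁ (λ_ Q.X).hom ≫ μ[Q.X]
      simp)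
    (by
      change (α_ Q.X Q.X Q.X).inv ≫ μ[Q.X] ▷ Q.X ≫ μ[Q.X] = Q.X ◁ μ[Q.X] ≫ μ[Q.X]
      simp)
    (by
      change (α_ Q.X Q.X Q.X).hom ≫ Q.X ◁ μ[Q.X] ≫ μ[Q.X] = μ[Q.X] ▷ Q.X ≫ μ[Q.X]
      simp)

theorem proj_comp_mulCell : proj (extBar Q) (ext Q) ≫ hom (mulCell Q) = μ[Q.X] :=
  proj_comp_descCell _ _ _ _

/-- The unit of `Q` as the coevaluation `𝒰 ⟶ 𝒳 × 𝒳̄`. -/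
noncomputable def oneCell : 𝟙 (triv C) ⟶ ext Q ≫ extBar Q :=
  (idTrivIso C).hom ≫ ofHom η[Q.X] ≫ (multIso Q).inv

theorem hom_oneCell_comp_multIso : hom (oneCell Q) ≫ hom (multIso Q).hom = η[Q.X] := by
  rw [← hom_comp, oneCell, Category.assoc, Category.assoc, Iso.inv_hom_id, Category.comp_id]
  exact Category.id_comp _

theorem hom_oneCell :
    hom (oneCell Q) = (η[Q.X] ≫ (λ_ Q.X).inv ≫ η[Q.X] ▷ Q.X) ≫ proj (ext Q) (extBar Q) := by
  have lift_comp_mul : (η[Q.X] ≫ (λ_ Q.X).inv ≫ η[Q.X] ▷ Q.X) ≫ μ[Q.X] = η[Q.X] := by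
    rw [Category.assoc, lift_unit_comp_mul, Category.comp_id]
  refine (cancel_mono (hom (multIso Q).hom)).1
    ((hom_oneCell_comp_multIso Q).trans (lift_comp_mul.symm.trans ?_))
  rw [← proj_multIso]
  exact (Category.assoc _ _ _).symm

/-- The duality between `𝒳` and `𝒳̄` that exists for every monoid. -/
noncomputable def mulAdjunction : Bicategory.Adjunction (ext Q) (extBar Q) where
  unit := oneCell Q
  counit := mulCell Q
  left_triangle := by
    refine leftZigzag_eq _ _ _ μ[Q.X] (hom_oneCell Q) (proj_comp_mulCell Q) ?_
    change (η[Q.X] ≫ (λ_ Q.X).inv ≫ η[Q.X] ▷ Q.X) ▷ Q.X ≫ (α_ Q.X Q.X Q.X).hom ≫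
      Q.X ◁ μ[Q.X] ≫ μ[Q.X] = (λ_ Q.X).hom
    rw [← mul_assoc, ← comp_whiskerRight_assoc, Category.assoc, lift_unit_comp_mul,
      Category.comp_id, one_mul]
  right_triangle := by
    refine rightZigzag_eq _ _ _ μ[Q.X] (hom_oneCell Q) (proj_comp_mulCell Q) ?_
    change Q.X ◁ (η[Q.X] ≫ (λ_ Q.X).inv ≫ η[Q.X] ▷ Q.X) ≫ (α_ Q.X Q.X Q.X).inv ≫
      μ[Q.X] ▷ Q.X ≫ μ[Q.X] = (ρ_ Q.X).hom
    rw [mul_assoc, Iso.inv_hom_id_assoc, ← MonoidalCategory.whiskerLeft_comp_assoc,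
      Category.assoc, lift_unit_comp_mul, Category.comp_id, mul_one]

variable {Q} {δ : Q.X ⟶ Q.X ⊗ Q.X} {ν : Q.X ⟶ 𝟙_ C}

/-- A counit of `Q` as the evaluation `𝒳 × 𝒳̄ ⟶ 𝒰`. -/
noncomputable def counitCell (ν : Q.X ⟶ 𝟙_ C) : ext Q ≫ extBar Q ⟶ 𝟙 (triv C) :=
  (multIso Q).hom ≫ ofHom ν ≫ (idTrivIso C).inv

theorem hom_counitCell (ν : Q.X ⟶ 𝟙_ C) : hom (counitCell ν) = hom (multIso Q).hom ≫ ν :=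
  congrArg (hom (multIso Q).hom ≫ ·) (Category.comp_id ν)

theorem proj_comp_counitCell (ν : Q.X ⟶ 𝟙_ C) :
    proj (ext Q) (extBar Q) ≫ hom (counitCell ν) = μ[Q.X] ≫ ν := by
  rw [hom_counitCell, ← proj_multIso]
  exact (Category.assoc _ _ _).symm

variable (frob : IsFrobeniusMonoid Q.X δ ν)

/-- The comultiplication of a Frobenius monoid as the coevaluation `𝒬 ⟶ 𝒳̄ × 𝒳`. -/
noncomputable def comulCell : 𝟙 (ofMon Q) ⟶ extBar Q ≫ ext Q :=
  projCell (f := extBar Q) (g := ext Q) (h := 𝟙 (ofMon Q)) δ frob.whiskerLeft_comul_comp_mul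
    frob.comul_whiskerRight_comp_mul

/-- The duality between `𝒳̄` and `𝒳` given by a Frobenius structure. -/
noncomputable def comulAdjunction : Bicategory.Adjunction (extBar Q) (ext Q) where
  unit := comulCell frob
  counit := counitCell ν
  left_triangle := leftZigzag_eq _ _ δ (μ[Q.X] ≫ ν : Q.X ⊗ Q.X ⟶ 𝟙_ C) rfl
    (proj_comp_counitCell ν) frob.comul_whiskerRight_comp_pairing
  right_triangle := rightZigzag_eq _ _ δ (μ[Q.X] ≫ ν : Q.X ⊗ Q.X ⟶ 𝟙_ C) rfl
    (proj_comp_counitCell ν) frob.whiskerLeft_comul_comp_pairing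

section Triples

variable (Q) in
theorem leftTriple_comp_mulCell :
    leftTriple (multIso Q) ≫ hom ((α_ (ext Q) (extBar Q) (ext Q)).hom ≫ ext Q ◁ mulCell Q) =
      proj (ext Q) (𝟙 (ofMon Q)) := by
  refine (cancel_epi (μ[Q.X] ▷ Q.X)).1
    ((leftTriple_comp_associator_whiskerLeft (proj_multIso Q) (mulCell Q)).trans ?_)
  rw [proj_comp_mulCell]
  exact (proj_condition (ext Q) (𝟙 (ofMon Q))).symm

variable (Q) in
theorem rightTriple_comp_mulCell :
    rightTriple (multIso Q) ≫
      hom ((α_ (extBar Q) (ext Q) (extBar Q)).inv ≫ mulCell Q ▷ extBar Q) =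
      proj (𝟙 (ofMon Q)) (extBar Q) := by
  refine (cancel_epi (Q.X ◁ μ[Q.X])).1
    ((rightTriple_comp_associator_inv_whiskerRight (proj_multIso Q) (mulCell Q)).trans ?_)
  rw [proj_comp_mulCell]
  exact (Iso.inv_comp_eq _).2 (proj_condition (𝟙 (ofMon Q)) (extBar Q))

theorem proj_comp_whiskerLeft_comulCell :
    proj (ext Q) (𝟙 (ofMon Q)) ≫
      hom (ext Q ◁ comulCell frob ≫ (α_ (ext Q) (extBar Q) (ext Q)).inv) =
      (μ[Q.X] ≫ δ) ≫ leftTriple (multIso Q) := by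
  refine (proj_comp_whiskerLeft_associator_inv (proj_multIso Q) (comulCell frob) δ rfl).trans ?_
  refine Eq.trans ?_ (congrArg (· ≫ leftTriple (multIso Q)) frob.whiskerLeft_comul_comp_mul)
  exact ((Category.assoc _ _ _).trans (congrArg (_ ≫ ·) (Category.assoc _ _ _))).symm

theorem proj_comp_comulCell_whiskerRight :
    proj (𝟙 (ofMon Q)) (extBar Q) ≫
      hom (comulCell frob ▷ extBar Q ≫ (α_ (extBar Q) (ext Q) (extBar Q)).hom) =
      (μ[Q.X] ≫ δ) ≫ rightTriple (multIso Q) := by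
  refine (proj_comp_whiskerRight_associator (proj_multIso Q) (comulCell frob) δ rfl).trans ?_
  refine Eq.trans ?_ (congrArg (· ≫ rightTriple (multIso Q)) frob.comul_whiskerRight_comp_mul)
  exact ((Category.assoc _ _ _).trans (congrArg (_ ≫ ·) (Category.assoc _ _ _))).symm

theorem leftTriple_comp_mulCell_comulCell :
    leftTriple (multIso Q) ≫ hom (((α_ (ext Q) (extBar Q) (ext Q)).hom ≫ ext Q ◁ mulCell Q) ≫
      ext Q ◁ comulCell frob ≫ (α_ (ext Q) (extBar Q) (ext Q)).inv) =
      (μ[Q.X] ≫ δ) ≫ leftTriple (multIso Q) := by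
  rw [hom_comp, ← Category.assoc, leftTriple_comp_mulCell]
  exact proj_comp_whiskerLeft_comulCell frob

theorem rightTriple_comp_mulCell_comulCell :
    rightTriple (multIso Q) ≫ hom (((α_ (extBar Q) (ext Q) (extBar Q)).inv ≫
      mulCell Q ▷ extBar Q) ≫ comulCell frob ▷ extBar Q ≫
        (α_ (extBar Q) (ext Q) (extBar Q)).hom) =
      (μ[Q.X] ≫ δ) ≫ rightTriple (multIso Q) := by
  rw [hom_comp, ← Category.assoc, rightTriple_comp_mulCell]
  exact proj_comp_comulCell_whiskerRight frob

end Triples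

section Conjugation

/-- The 2-endomorphism of `𝒳 × 𝒳̄` that corresponds under `t` to an endomorphism of `Q`. -/
noncomputable def conj (x : Q.X ⟶ Q.X) : ext Q ≫ extBar Q ⟶ ext Q ≫ extBar Q :=
  (multIso Q).hom ≫ ofHom x ≫ (multIso Q).inv

theorem conj_comp (x y : Q.X ⟶ Q.X) : conj (x ≫ y) = conj x ≫ conj y := by
  have ofHom_comp : ofHom (x ≫ y) = ofHom x ≫ ofHom y := rfl
  simp only [conj, ofHom_comp, Category.assoc, Iso.inv_hom_id_assoc]

theorem conj_add [Preadditive C] [MonoidalPreadditive C] (x y : Q.X ⟶ Q.X) :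
    conj (x + y) = conj x + conj y := by
  have ofHom_add : ofHom (x + y) = ofHom x + ofHom y := rfl
  simp only [conj, ofHom_add, Preadditive.add_comp, Preadditive.comp_add]

/-- A right `Q`-linear endomorphism of `Q` as a 2-endomorphism of `𝒳`. -/
def extEnd (x : Q.X ⟶ Q.X) (linear : μ[Q.X] ≫ x = x ▷ Q.X ≫ μ[Q.X]) : ext Q ⟶ ext Q :=
  Bimod.Hom.mk (M := unitMonBimod Q) (N := unitMonBimod Q) x (leftUnitor_naturality x).symm linear

theorem conj_eq_extEnd_whiskerRight (x : Q.X ⟶ Q.X)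
    (linear : μ[Q.X] ≫ x = x ▷ Q.X ≫ μ[Q.X]) : conj x = extEnd x linear ▷ extBar Q := by
  rw [conj, ← Category.assoc, Iso.comp_inv_eq]
  apply hom_ext
  refine (cancel_epi (proj (ext Q) (extBar Q))).1 ?_
  rw [hom_comp, hom_comp, ← Category.assoc, ← Category.assoc, proj_multIso,
    proj_comp_whiskerRight, Category.assoc, proj_multIso]
  exact linear

end Conjugation

section QuasiBasis

variable [Preadditive C] [MonoidalPreadditive C] {n : ℕ} (x y : Fin n → (Q.X ⟶ Q.X))

theorem sum_conj_whiskerRight_mul_comul_eq_id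
    (h : ∑ j, x j ≫ δ ≫ y j ▷ Q.X = (ρ_ Q.X).inv ≫ Q.X ◁ η[Q.X]) :
    ∑ j, (conj (x j) ▷ ext Q) ≫ (α_ (ext Q) (extBar Q) (ext Q)).hom ≫
      (ext Q ◁ (mulAdjunction Q).counit) ≫ (ext Q ◁ (comulAdjunction frob).unit) ≫
        (α_ (ext Q) (extBar Q) (ext Q)).inv ≫ (conj (y j) ▷ ext Q) =
      𝟙 ((ext Q ≫ extBar Q) ≫ ext Q) := by
  have := sum_conj_whiskerRight_eq_id (multIso Q) (fun j => ofHom (x j)) (fun j => ofHom (y j))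
    (leftTriple_comp_mulCell_comulCell frob) (frob.sum_whiskerRight_mul_comul_eq_id x y h)
  simp only [Category.assoc] at this
  exact this

theorem sum_whiskerLeft_conj_mul_comul_eq_id
    (h : ∑ j, x j ≫ δ ≫ Q.X ◁ y j = (λ_ Q.X).inv ≫ η[Q.X] ▷ Q.X) :
    ∑ j, (extBar Q ◁ conj (x j)) ≫ (α_ (extBar Q) (ext Q) (extBar Q)).inv ≫
      ((mulAdjunction Q).counit ▷ extBar Q) ≫ ((comulAdjunction frob).unit ▷ extBar Q) ≫
        (α_ (extBar Q) (ext Q) (extBar Q)).hom ≫ (extBar Q ◁ conj (y j)) =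
      𝟙 (extBar Q ≫ ext Q ≫ extBar Q) := by
  have := sum_whiskerLeft_conj_eq_id (multIso Q) (fun j => ofHom (x j)) (fun j => ofHom (y j))
    (rightTriple_comp_mulCell_comulCell frob) (frob.sum_whiskerLeft_mul_comul_eq_id x y h)
  simp only [Category.assoc] at this
  exact this

variable [HasFiniteBiproducts C]

include frob

theorem isLeftD2_of_sum_eq_id
    (h : ∑ j, x j ≫ δ ≫ y j ▷ Q.X = (ρ_ Q.X).inv ≫ Q.X ◁ η[Q.X]) :
    IsLeftD2 (ext Q) (extBar Q) := by
  refine isSummandOfCopies_of_sum_comp_eq_id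
    (fun j => (conj (x j) ▷ ext Q) ≫ (α_ (ext Q) (extBar Q) (ext Q)).hom ≫
      (ext Q ◁ (mulAdjunction Q).counit) ≫ (Bicategory.rightUnitor (ext Q)).hom)
    (fun j => (Bicategory.rightUnitor (ext Q)).inv ≫ (ext Q ◁ (comulAdjunction frob).unit) ≫
      (α_ (ext Q) (extBar Q) (ext Q)).inv ≫ (conj (y j) ▷ ext Q)) ?_
  simp only [Category.assoc, Iso.hom_inv_id_assoc]
  exact sum_conj_whiskerRight_mul_comul_eq_id frob x y h

theorem isRightD2_of_sum_eq_id
    (h : ∑ j, x j ≫ δ ≫ Q.X ◁ y j = (λ_ Q.X).inv ≫ η[Q.X] ▷ Q.X) :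
    IsRightD2 (ext Q) (extBar Q) := by
  refine isSummandOfCopies_of_sum_comp_eq_id
    (fun j => (α_ (extBar Q) (ext Q) (extBar Q)).hom ≫ (extBar Q ◁ conj (x j)) ≫
      (α_ (extBar Q) (ext Q) (extBar Q)).inv ≫ ((mulAdjunction Q).counit ▷ extBar Q) ≫
        (Bicategory.leftUnitor (extBar Q)).hom)
    (fun j => (Bicategory.leftUnitor (extBar Q)).inv ≫
      ((comulAdjunction frob).unit ▷ extBar Q) ≫ (α_ (extBar Q) (ext Q) (extBar Q)).hom ≫
        (extBar Q ◁ conj (y j)) ≫ (α_ (extBar Q) (ext Q) (extBar Q)).inv) ?_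
  have := congrArg (fun z => (α_ (extBar Q) (ext Q) (extBar Q)).hom ≫ z ≫
    (α_ (extBar Q) (ext Q) (extBar Q)).inv) (sum_whiskerLeft_conj_mul_comul_eq_id frob x y h)
  simp only [Preadditive.comp_sum, Preadditive.sum_comp, Category.assoc, Category.id_comp,
    Iso.hom_inv_id] at this
  simp only [Category.assoc, Iso.hom_inv_id_assoc]
  exact this

end QuasiBasis

end BIM

end FrobeniusMonoids

section BalancedTensor

variable {R R' M N P T : Type*} [AddCommGroup M] [AddCommGroup N] [AddCommGroup P]
  [AddCommGroup T]

/-- The map `f ⊗ g` on balanced tensor products, for additive maps `f` and `g` compatible with the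
actions of `R`. -/
def BalTensor.map {M' N' : Type*} [AddCommGroup M'] [AddCommGroup N'] {ρ : R → M →+ M}
    {l : R → N →+ N} {ρ' : R → M' →+ M'} {l' : R → N' →+ N'} (f : M →+ M') (g : N →+ N')
    (map_right : ∀ r m, f (ρ r m) = ρ' r (f m)) (map_left : ∀ r n, g (l r n) = l' r (g n)) :
    BalTensor ρ l →+ BalTensor ρ' l' :=
  lift (((tmulHom ρ' l').comp f).compl₂ g) (fun r m n => by
    change tmul ρ' l' (f (ρ r m)) (g n) = tmul ρ' l' (f m) (g (l r n))
    rw [map_right, map_left, smul_tmul])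

/-- Any coassociativity law can be applied to a map out of the triple tensor product that is
presented as `F p` on `(M ⊗ N) × {p}` and as `G m` on `{m} × (N ⊗ P)`: its balancedness over the
first base is then that of `F`, and over the second that of `G`. -/
theorem BalTensor₃.sum_apply_eq_sum_apply {ρ₁ : R → M →+ M} {l₂ : R → N →+ N} {ρ₂ : R' → N →+ N}
    {l₃ : R' → P →+ P} {ι κ : Type*} [Fintype ι] [Fintype κ] {q : ι → BalTensor ρ₁ l₂} {p : ι → P}
    {m : κ → M} {q' : κ → BalTensor ρ₂ l₃} (F : P → BalTensor ρ₁ l₂ →+ T)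
    (G : M → BalTensor ρ₂ l₃ →+ T)
    (apply_tmul : ∀ m n p, F p (BalTensor.tmul ρ₁ l₂ m n) = G m (BalTensor.tmul ρ₂ l₃ n p))
    (assoc : ∑ j, assocL ρ₁ l₂ ρ₂ l₃ (q j) (p j) = ∑ k, assocR ρ₁ l₂ ρ₂ l₃ (m k) (q' k)) :
    ∑ j, F (p j) (q j) = ∑ k, G (m k) (q' k) := by
  let f : M →+ N →+ P →+ T := AddMonoidHom.mk' (fun m => (BalTensor.tmulHom ρ₂ l₃).compr₂ (G m))
    (fun m m' => by
      ext n p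
      change G (m + m') (BalTensor.tmul ρ₂ l₃ n p) =
        G m (BalTensor.tmul ρ₂ l₃ n p) + G m' (BalTensor.tmul ρ₂ l₃ n p)
      simp only [← apply_tmul, BalTensor.add_tmul, map_add])
  have balanced_left : ∀ r m n p, f (ρ₁ r m) n p = f m (l₂ r n) p := fun r m n p => by
    change G (ρ₁ r m) (BalTensor.tmul ρ₂ l₃ n p) = G m (BalTensor.tmul ρ₂ l₃ (l₂ r n) p)
    rw [← apply_tmul, ← apply_tmul, BalTensor.smul_tmul]
  have balanced_right : ∀ r m n p, f m (ρ₂ r n) p = f m n (l₃ r p) := fun r m n p =>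
    congrArg (G m) (BalTensor.smul_tmul r n p)
  have lift_assocL_eq (p : P) :
      ((lift f balanced_left balanced_right).comp ((assocL ρ₁ l₂ ρ₂ l₃).flip p)) = F p :=
    BalTensor.hom_ext (fun m n => (apply_tmul m n p).symm)
  have lift_assocR_eq (m : M) :
      (lift f balanced_left balanced_right).comp (assocR ρ₁ l₂ ρ₂ l₃ m) = G m :=
    BalTensor.hom_ext (fun _ _ => rfl)
  simp only [← lift_assocL_eq, ← lift_assocR_eq, AddMonoidHom.comp_apply, AddMonoidHom.flip_apply,
    ← map_sum, assoc]

end BalancedTensor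

namespace LeftBialgebroid

open BalTensor

variable {A L : Type*} [Ring A] [Ring L] (B : LeftBialgebroid A L)

/-- The codomain `A_L ⊗ _LA` of the coproduct. -/
abbrev Sq : Type _ := BalTensor (fun l => AddMonoidHom.mulLeft (B.t (op l)))
  (fun l => AddMonoidHom.mulLeft (B.s l))

/-- The map `x ⊗ y ↦ x b ⊗ y c`. -/
def orbit (b c : A) : B.Sq →+ B.Sq :=
  BalTensor.map (AddMonoidHom.mulRight b) (AddMonoidHom.mulRight c)
    (fun _ _ => mul_assoc _ _ _) (fun _ _ => mul_assoc _ _ _)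

@[simp] theorem orbit_tmul (b c x y : A) :
    B.orbit b c (tmul _ _ x y) = tmul _ _ (x * b) (y * c) := rfl

theorem orbit_add_left (b b' c : A) : B.orbit (b + b') c = B.orbit b c + B.orbit b' c :=
  hom_ext (fun x y => by simp only [AddMonoidHom.add_apply, orbit_tmul, mul_add, add_tmul])

theorem orbit_add_right (b c c' : A) : B.orbit b (c + c') = B.orbit b c + B.orbit b c' :=
  hom_ext (fun x y => by simp only [AddMonoidHom.add_apply, orbit_tmul, mul_add, tmul_add])

theorem orbit_orbit (b c b' c' : A) (q : B.Sq) :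
    B.orbit b c (B.orbit b' c' q) = B.orbit (b' * b) (c' * c) q :=
  DFunLike.congr_fun (hom_ext (f := (B.orbit b c).comp (B.orbit b' c')) (fun x y => by
    simp only [AddMonoidHom.comp_apply, orbit_tmul, mul_assoc])) q

theorem orbit_t (l : L) (a : A) : B.orbit (B.t (op l)) 1 (B.γ a) = B.orbit 1 (B.s l) (B.γ a) := by
  obtain ⟨n, x, y, h⟩ := exists_rep (B.γ a)
  simpa only [h, map_sum, orbit_tmul, mul_one] using B.γ_takeuchi l a n x y h

/-- The diagonal left action `a·(x ⊗ y) = a₁ x ⊗ a₂ y`. -/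
def diagAct (a : A) : B.Sq →+ B.Sq :=
  lift (AddMonoidHom.mk' (fun b => AddMonoidHom.mk' (fun c => B.orbit b c (B.γ a))
      (fun c c' => by rw [orbit_add_right, AddMonoidHom.add_apply]))
      (fun b b' => by ext c; exact DFunLike.congr_fun (B.orbit_add_left b b' c) (B.γ a)))
    (fun l b c => by
      have h := congrArg (B.orbit b c) (B.orbit_t l a)
      rwa [orbit_orbit, orbit_orbit, one_mul, one_mul] at h)

theorem diagAct_tmul (a b c : A) : B.diagAct a (tmul _ _ b c) = B.orbit b c (B.γ a) := rfl

theorem diagAct_orbit (a b c : A) (q : B.Sq) :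
    B.diagAct a (B.orbit b c q) = B.orbit b c (B.diagAct a q) :=
  DFunLike.congr_fun (hom_ext (f := (B.diagAct a).comp (B.orbit b c))
    (g := (B.orbit b c).comp (B.diagAct a)) (fun x y => by
      simp only [AddMonoidHom.comp_apply, orbit_tmul, diagAct_tmul, orbit_orbit])) q

theorem γ_mul_eq_diagAct (a b : A) : B.γ (a * b) = B.diagAct a (B.γ b) := by
  obtain ⟨n, x, y, ha⟩ := exists_rep (B.γ a)
  obtain ⟨m, z, w, hb⟩ := exists_rep (B.γ b)
  rw [B.γ_mul a b n m x y z w ha hb, Finset.sum_comm, hb]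
  simp only [map_sum, diagAct_tmul, ha, orbit_tmul]

theorem γ_t (l : L) : B.γ (B.t (op l)) = tmul _ _ 1 (B.t (op l)) := by
  simpa using B.γ_bimod 1 l 1 1 (fun _ => 1) (fun _ => 1) (by simpa using B.γ_one)

theorem γ_mul_t (a : A) (l : L) : B.γ (a * B.t (op l)) = B.orbit 1 (B.t (op l)) (B.γ a) := by
  rw [γ_mul_eq_diagAct, γ_t, diagAct_tmul]

/-- The map `x ⊗ y ↦ x ⊗ t(l) y`. -/
def mulLeftT (l : L) : B.Sq →+ B.Sq :=
  BalTensor.map (AddMonoidHom.id A) (AddMonoidHom.mulLeft (B.t (op l))) (fun _ _ => rfl)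
    (fun l' y => by
      simp only [AddMonoidHom.coe_mulLeft, ← mul_assoc, B.s_t_comm])

theorem γ_t_mul (l : L) (a : A) : B.γ (B.t (op l) * a) = B.mulLeftT l (B.γ a) := by
  obtain ⟨n, x, y, h⟩ := exists_rep (B.γ a)
  have h' := B.γ_bimod 1 l a n x y h
  rw [map_one, one_mul] at h'
  simp only [h', h, map_sum, one_mul]
  rfl

/-- The map `x ⊗ y ↦ t(φ(y)) x`, through which the action of `φ ∈ _*𝒜` factors. -/
def actStarL (φ : B.StarL) : B.Sq →+ A :=
  lift (AddMonoidHom.mul.comp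
      (B.t.toAddMonoidHom.comp ((opAddEquiv : L ≃+ Lᵐᵒᵖ).toAddMonoidHom.comp φ.1))).flip
    (fun l x y => by
      change B.t (op (φ.1 y)) * (B.t (op l) * x) = B.t (op (φ.1 (B.s l * y))) * x
      rw [φ.2, MulOpposite.op_mul, map_mul, mul_assoc])

/-- The map `x ⊗ y ↦ s(φ(x)) y`, through which the action of `φ ∈ 𝒜_*` factors. -/
def actLStar (φ : B.LStar) : B.Sq →+ A :=
  lift (AddMonoidHom.mul.comp (B.s.toAddMonoidHom.comp φ.1)) (fun l x y => by
    change B.s (φ.1 (B.t (op l) * x)) * y = B.s (φ.1 x) * (B.s l * y)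
    rw [φ.2, map_mul, mul_assoc])

theorem hitStarL_eq_actStarL (φ : B.StarL) (a : A) : B.hitStarL φ a = B.actStarL φ (B.γ a) := rfl

theorem actStarL_orbit_left (φ : B.StarL) (b : A) (q : B.Sq) :
    B.actStarL φ (B.orbit b 1 q) = B.actStarL φ q * b :=
  DFunLike.congr_fun (hom_ext (f := (B.actStarL φ).comp (B.orbit b 1))
    (g := (AddMonoidHom.mulRight b).comp (B.actStarL φ)) (fun x y => by
      change B.t (op (φ.1 (y * 1))) * (x * b) = B.t (op (φ.1 y)) * x * b
      rw [mul_one, mul_assoc])) q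

theorem actLStar_orbit_right (φ : B.LStar) (c : A) (q : B.Sq) :
    B.actLStar φ (B.orbit 1 c q) = B.actLStar φ q * c :=
  DFunLike.congr_fun (hom_ext (f := (B.actLStar φ).comp (B.orbit 1 c))
    (g := (AddMonoidHom.mulRight c).comp (B.actLStar φ)) (fun x y => by
      change B.s (φ.1 (x * 1)) * (y * c) = B.s (φ.1 x) * y * c
      rw [mul_one, mul_assoc])) q

/-- The element `φ(· c)` of `_*𝒜`, for `φ ∈ _*𝒜`. -/
def shiftStarL (φ : B.StarL) (c : A) : B.StarL :=
  ⟨φ.1.comp (AddMonoidHom.mulRight c), fun l a => by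
    change φ.1 (B.s l * a * c) = l * φ.1 (a * c)
    rw [mul_assoc, φ.2]⟩

theorem hitStarL_shiftStarL (φ : B.StarL) (c a : A) :
    B.hitStarL (B.shiftStarL φ c) a = B.actStarL φ (B.orbit 1 c (B.γ a)) :=
  DFunLike.congr_fun (hom_ext (f := B.actStarL (B.shiftStarL φ c))
    (g := (B.actStarL φ).comp (B.orbit 1 c)) (fun x y => by
      change B.t (op (φ.1 (y * c))) * x = B.t (op (φ.1 (y * c))) * (x * 1)
      rw [mul_one])) (B.γ a)

/-- The counit as an element of the dual ring `_*𝒜`, of which it is the unit. -/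
def counitStarL : B.StarL := ⟨B.π, fun l a => by simpa using B.π_bimod l 1 a⟩

theorem hitStarL_counitStarL (a : A) : B.hitStarL B.counitStarL a = a := by
  obtain ⟨n, x, y, h⟩ := exists_rep (B.γ a)
  exact (B.hitStarL_of_rep _ a x y h).trans (B.counit_right a n x y h)

theorem hitStarL_s_mul (φ : B.StarL) (l : L) (a : A) :
    B.hitStarL φ (B.s l * a) = B.s l * B.hitStarL φ a := by
  obtain ⟨n, x, y, h⟩ := exists_rep (B.γ a)
  have h' : B.γ (B.s l * a) = ∑ j, tmul _ _ (B.s l * x j) (y j) := by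
    simpa using B.γ_bimod l 1 a n x y h
  simp only [B.hitStarL_of_rep φ a x y h, B.hitStarL_of_rep φ _ _ _ h', Finset.mul_sum,
    ← mul_assoc, B.s_t_comm]

theorem γ_hitStarL (φ : B.StarL) (a : A) {n : ℕ} {x y : Fin n → A}
    (h : B.γ a = ∑ j, tmul _ _ (x j) (y j)) :
    B.γ (B.hitStarL φ a) = ∑ j, tmul _ _ (x j) (B.hitStarL φ (y j)) := by
  rw [B.hitStarL_of_rep φ a x y h, map_sum]
  simp only [γ_t_mul]
  exact BalTensor₃.sum_apply_eq_sum_apply (fun w => B.mulLeftT (φ.1 w))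
    (fun u => (tmulHom _ _ u).comp (B.actStarL φ)) (fun _ _ _ => rfl) (B.coassoc a n x y h)

theorem hitStarL_mulStarL (φ ψ : B.StarL) (a : A) :
    B.hitStarL (B.mulStarL φ ψ) a = B.hitStarL ψ (B.hitStarL φ a) := by
  obtain ⟨n, x, y, h⟩ := exists_rep (B.γ a)
  rw [B.hitStarL_of_rep ψ _ _ _ (B.γ_hitStarL φ a h), B.hitStarL_of_rep _ a x y h]
  rfl

theorem hitStarL_hitLStar (φ : B.StarL) (ψ : B.LStar) (a : A) :
    B.hitStarL φ (B.hitLStar ψ a) = B.hitLStar ψ (B.hitStarL φ a) := by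
  obtain ⟨n, x, y, h⟩ := exists_rep (B.γ a)
  rw [B.hitLStar_of_rep ψ _ _ _ (B.γ_hitStarL φ a h), B.hitLStar_of_rep ψ a x y h,
    hitStarL_eq_actStarL]
  simp only [map_sum, ← hitStarL_eq_actStarL, hitStarL_s_mul]

end LeftBialgebroid

namespace RightBialgebroid

open BalTensor

variable {A R : Type u} [Ring A] [Ring R] (B : RightBialgebroid A R)

/-- The codomain `A^R ⊗ ^RA` of the coproduct. -/
abbrev Sq : Type u := B.Tens A A

theorem orbit_orbit (b c b' c' : A) (q : B.Sq) :
    B.orbit b c (B.orbit b' c' q) = B.orbit (b * b') (c * c') q :=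
  DFunLike.congr_fun (hom_ext (f := (B.orbit b c).comp (B.orbit b' c')) (fun x y => by
    simp only [AddMonoidHom.comp_apply, orbit_tmul, op_smul_eq_mul, mul_assoc])) q

theorem diagAct_orbit (a b c : A) (q : B.Sq) :
    B.diagAct a (B.orbit b c q) = B.orbit b c (B.diagAct a q) :=
  DFunLike.congr_fun (hom_ext (f := (B.diagAct a).comp (B.orbit b c))
    (g := (B.orbit b c).comp (B.diagAct a)) (fun x y => by
      simp only [AddMonoidHom.comp_apply, orbit_tmul, op_smul_eq_mul, diagAct_tmul,
        orbit_orbit])) q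

theorem γ_mul_eq_diagAct (a b : A) : B.γ (a * b) = B.diagAct b (B.γ a) :=
  (Mod.lin B.comulHom).map_smul (op b) a

theorem γ_s_mul (r : R) (a : A) : B.γ (B.s r * a) = B.orbit 1 (B.s r) (B.γ a) := by
  rw [γ_mul_eq_diagAct, γ_s, diagAct_tmul]

theorem γ_t_mul (r : R) (a : A) : B.γ (B.t (op r) * a) = B.orbit (B.t (op r)) 1 (B.γ a) := by
  rw [γ_mul_eq_diagAct, γ_t, diagAct_tmul]

end RightBialgebroid

namespace HopfAlgebroid

open BalTensor

variable {H R : Type u} {L : Type v} [Ring H] [Ring R] [Ring L]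

section Antipode

variable (𝓗 : HopfAlgebroid H L R)

theorem S_mul_tR (a : H) (r : R) : 𝓗.S (a * 𝓗.right.t (op r)) = 𝓗.right.s r * 𝓗.S a := by
  simpa using 𝓗.S_right r 1 a

theorem S_tL_mul (l : L) (a : H) : 𝓗.S (𝓗.left.t (op l) * a) = 𝓗.S a * 𝓗.left.s l := by
  simpa using 𝓗.S_left l 1 a

theorem S_mul_tL (a : H) (l : L) : 𝓗.S (a * 𝓗.left.t (op l)) = 𝓗.left.s l * 𝓗.S a := by
  simpa using 𝓗.S_left 1 l a

theorem S_symm_sL_mul (l : L) (a : H) :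
    𝓗.S.symm (𝓗.left.s l * a) = 𝓗.S.symm a * 𝓗.left.t (op l) := by
  rw [AddEquiv.symm_apply_eq, S_mul_tL, AddEquiv.apply_symm_apply]

theorem γL_mul_sR (a : H) (r : R) :
    𝓗.left.γ (a * 𝓗.right.s r) = 𝓗.left.orbit 1 (𝓗.right.s r) (𝓗.left.γ a) := by
  obtain ⟨l, hl⟩ := 𝓗.range_tL.superset (Set.mem_range_self r)
  rw [← hl]
  exact 𝓗.left.γ_mul_t a l.unop

theorem γR_tL_mul (l : L) (a : H) :
    𝓗.right.γ (𝓗.left.t (op l) * a) = 𝓗.right.orbit 1 (𝓗.left.t (op l)) (𝓗.right.γ a) := by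
  obtain ⟨r, hr⟩ := 𝓗.range_tL.subset (Set.mem_range_self (op l))
  rw [← hr, 𝓗.right.γ_s_mul]

theorem γR_sL_mul (l : L) (a : H) :
    𝓗.right.γ (𝓗.left.s l * a) = 𝓗.right.orbit (𝓗.left.s l) 1 (𝓗.right.γ a) := by
  obtain ⟨r, hr⟩ := 𝓗.range_sL.subset (Set.mem_range_self l)
  rw [← hr]
  exact 𝓗.right.γ_t_mul r.unop a

/-- The map `x ⊗ y ↦ x S(y)` on `H^R ⊗ ^RH`. -/
def mulAntipode : 𝓗.right.Sq →+ H :=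
  lift (AddMonoidHom.mul.compl₂ 𝓗.S.toAddMonoidHom) (fun r x y => by
    change x * 𝓗.right.s r * 𝓗.S y = x * 𝓗.S (y * 𝓗.right.t (op r))
    rw [S_mul_tR, mul_assoc])

theorem mulAntipode_γR (a : H) : 𝓗.mulAntipode (𝓗.right.γ a) = 𝓗.left.s (𝓗.left.π a) := by
  obtain ⟨n, x, y, h⟩ := exists_rep (𝓗.right.γ a)
  rw [h, map_sum]
  exact 𝓗.antipode_right a n x y h

/-- The map `x ⊗ y ↦ S(x) y` on `H_L ⊗ _LH`. -/
def antipodeMul : 𝓗.left.Sq →+ H :=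
  lift (AddMonoidHom.mul.comp 𝓗.S.toAddMonoidHom) (fun l x y => by
    change 𝓗.S (𝓗.left.t (op l) * x) * y = 𝓗.S x * (𝓗.left.s l * y)
    rw [S_tL_mul, mul_assoc])

theorem antipodeMul_γL (a : H) : 𝓗.antipodeMul (𝓗.left.γ a) = 𝓗.right.s (𝓗.right.π a) := by
  obtain ⟨n, x, y, h⟩ := exists_rep (𝓗.left.γ a)
  rw [h, map_sum]
  exact 𝓗.antipode_left a n x y h

/-- The map `x ⊗ y ↦ S⁻¹(y) x` on `H_L ⊗ _LH`. -/
def antipodeSymmMul : 𝓗.left.Sq →+ H :=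
  lift (AddMonoidHom.mul.comp 𝓗.S.symm.toAddMonoidHom).flip (fun l x y => by
    change 𝓗.S.symm y * (𝓗.left.t (op l) * x) = 𝓗.S.symm (𝓗.left.s l * y) * x
    rw [S_symm_sL_mul, mul_assoc])

theorem sum_γL_mul_S (a : H) {n : ℕ} {x y : Fin n → H}
    (h : 𝓗.right.γ a = ∑ j, tmul _ _ (x j) (y j)) :
    ∑ j, 𝓗.left.orbit 1 (𝓗.S (y j)) (𝓗.left.γ (x j)) = tmul _ _ a 1 := by
  obtain ⟨m, z, w, h'⟩ := exists_rep (𝓗.left.γ a)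
  calc
    _ = ∑ k, tmul _ _ (z k) (𝓗.mulAntipode (𝓗.right.γ (w k))) :=
      BalTensor₃.sum_apply_eq_sum_apply (fun v => 𝓗.left.orbit 1 (𝓗.S v))
        (fun u => (tmulHom _ _ u).comp 𝓗.mulAntipode)
        (fun u v w => congrArg (tmul _ _ · (v * 𝓗.S w)) (mul_one u))
        (𝓗.coassoc_LR a n m x y z w h h')
    _ = ∑ k, tmul _ _ (𝓗.left.t (op (𝓗.left.π (w k))) * z k) 1 := by
      refine Finset.sum_congr rfl fun k _ => ?_
      rw [mulAntipode_γR]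
      exact (congrArg (tmul _ _ (z k)) (mul_one _)).symm.trans (smul_tmul _ _ _).symm
    _ = tmul _ _ a 1 := by rw [← sum_tmul, 𝓗.left.counit_right a m z w h']

theorem sum_S_mul_γR (a : H) {n : ℕ} {x y : Fin n → H}
    (h : 𝓗.left.γ a = ∑ j, tmul _ _ (x j) (y j)) :
    ∑ j, 𝓗.right.orbit (𝓗.S (x j)) 1 (𝓗.right.γ (y j)) = tmul _ _ 1 a := by
  obtain ⟨m, z, w, h'⟩ := exists_rep (𝓗.right.γ a)
  calc
    _ = ∑ k, tmul _ _ (𝓗.antipodeMul (𝓗.left.γ (z k))) (w k) :=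
      (BalTensor₃.sum_apply_eq_sum_apply (fun v => ((tmulHom _ _).flip v).comp 𝓗.antipodeMul)
        (fun u => 𝓗.right.orbit (𝓗.S u) 1)
        (fun u v w => congrArg (tmul _ _ (𝓗.S u * v)) (one_mul w).symm)
        (𝓗.coassoc_LR a m n z w x y h' h)).symm
    _ = ∑ k, tmul _ _ 1 (w k * 𝓗.right.t (op (𝓗.right.π (z k)))) := by
      refine Finset.sum_congr rfl fun k _ => ?_
      rw [antipodeMul_γL]
      exact (congrArg (tmul _ _ · (w k)) (one_mul _)).symm.trans (smul_tmul _ _ _)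
    _ = tmul _ _ 1 a := by rw [← tmul_sum, 𝓗.right.counit_left a m z w h']

theorem γR_hitStarL (φ : 𝓗.left.StarL) (a : H) {n : ℕ} {x y : Fin n → H}
    (h : 𝓗.right.γ a = ∑ j, tmul _ _ (x j) (y j)) :
    𝓗.right.γ (𝓗.left.hitStarL φ a) = ∑ j, tmul _ _ (x j) (𝓗.left.hitStarL φ (y j)) := by
  obtain ⟨m, z, w, h'⟩ := exists_rep (𝓗.left.γ a)
  rw [𝓗.left.hitStarL_of_rep φ a z w h', map_sum]
  simp only [γR_tL_mul]
  exact BalTensor₃.sum_apply_eq_sum_apply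
    (fun v => 𝓗.right.orbit (1 : H) (𝓗.left.t (op (φ.1 v))))
    (fun u => (tmulHom _ _ u).comp (𝓗.left.actStarL φ))
    (fun u v w => congrArg (tmul _ _ · (𝓗.left.t (op (φ.1 w)) * v)) (one_mul u))
    (𝓗.coassoc_RL a m n z w x y h' h)

theorem γR_hitLStar (ψ : 𝓗.left.LStar) (a : H) {n : ℕ} {x y : Fin n → H}
    (h : 𝓗.right.γ a = ∑ j, tmul _ _ (x j) (y j)) :
    𝓗.right.γ (𝓗.left.hitLStar ψ a) = ∑ j, tmul _ _ (𝓗.left.hitLStar ψ (x j)) (y j) := by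
  obtain ⟨m, z, w, h'⟩ := exists_rep (𝓗.left.γ a)
  rw [𝓗.left.hitLStar_of_rep ψ a z w h', map_sum]
  simp only [γR_sL_mul]
  exact (BalTensor₃.sum_apply_eq_sum_apply
    (fun v => ((tmulHom _ _).flip v).comp (𝓗.left.actLStar ψ))
    (fun u => 𝓗.right.orbit (𝓗.left.s (ψ.1 u)) (1 : H))
    (fun u v w => congrArg (tmul _ _ (𝓗.left.s (ψ.1 u) * v)) (one_mul w).symm)
    (𝓗.coassoc_LR a n m x y z w h h')).symm

end Antipode

namespace IsRightIntegral

variable {𝓗 : HopfAlgebroid H L R} {i : H} (hi : 𝓗.IsRightIntegral i)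

include hi

theorem mul_t (r : R) : i * 𝓗.right.t (op r) = i * 𝓗.right.s r := by
  have π_t : 𝓗.right.π (𝓗.right.t (op r)) = r := by
    rw [← one_mul (𝓗.right.t (op r)), 𝓗.right.π_mul_t, 𝓗.right.π_one, mul_one]
  rw [hi (𝓗.right.t (op r)), π_t]

/-- Both sides equal `i₁ a⁽¹⁾₁ ⊗ i₂ a⁽¹⁾₂ S(a⁽²⁾)`. -/
theorem γL_mul_left_eq (a : H) :
    𝓗.left.orbit a 1 (𝓗.left.γ i) = 𝓗.left.orbit 1 (𝓗.S a) (𝓗.left.γ i) := by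
  obtain ⟨n, x, y, h⟩ := exists_rep (𝓗.right.γ a)
  calc
    _ = ∑ j, 𝓗.left.orbit 1 (𝓗.S (y j)) (𝓗.left.γ (i * x j)) := by
      rw [← 𝓗.left.diagAct_tmul, ← 𝓗.sum_γL_mul_S a h, map_sum]
      simp only [𝓗.left.diagAct_orbit, 𝓗.left.γ_mul_eq_diagAct]
    _ = ∑ j, 𝓗.left.diagAct i (tmul _ _ 1 (𝓗.S (y j * 𝓗.right.t (op (𝓗.right.π (x j)))))) := by
      refine Finset.sum_congr rfl fun j _ => ?_
      rw [hi (x j), γL_mul_sR, 𝓗.left.orbit_orbit, one_mul, S_mul_tR, 𝓗.left.diagAct_tmul]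
    _ = 𝓗.left.diagAct i (tmul _ _ 1 (𝓗.S a)) := by
      rw [← map_sum, ← tmul_sum, ← map_sum, 𝓗.right.counit_left a n x y h]

theorem sum_S_mul_γR_mul {n : ℕ} {x y : Fin n → H}
    (h : 𝓗.left.γ i = ∑ j, tmul _ _ (x j) (y j)) (a : H) :
    ∑ j, 𝓗.right.orbit (𝓗.S (x j)) 1 (𝓗.right.γ (y j * a)) = tmul _ _ a i := by
  obtain ⟨m, z, w, h'⟩ := exists_rep (𝓗.right.γ a)
  calc
    _ = 𝓗.right.diagAct a (tmul _ _ 1 i) := by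
      simp only [← 𝓗.sum_S_mul_γR i h, map_sum, 𝓗.right.diagAct_orbit, 𝓗.right.γ_mul_eq_diagAct]
    _ = ∑ k, tmul _ _ (z k) (i * w k) := by
      simp only [𝓗.right.diagAct_of_rep a _ _ z w h', op_smul_eq_mul, one_mul]
    _ = ∑ k, tmul _ _ (z k * 𝓗.right.s (𝓗.right.π (w k))) i := by
      refine Finset.sum_congr rfl fun k _ => ?_
      rw [hi (w k), ← hi.mul_t]
      exact (smul_tmul _ _ _).symm
    _ = tmul _ _ a i := by rw [← sum_tmul, 𝓗.right.counit_right a m z w h']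

variable (hnd : 𝓗.IsNondegenerate i)

include hnd

theorem S_mul (a b : H) : 𝓗.S (a * b) = 𝓗.S b * 𝓗.S a := by
  obtain ⟨ψ, hψ⟩ := hnd.bijective_lStar.2 1
  have orbit_S : 𝓗.left.orbit 1 (𝓗.S (a * b)) (𝓗.left.γ i) =
      𝓗.left.orbit 1 (𝓗.S b * 𝓗.S a) (𝓗.left.γ i) := calc
    _ = 𝓗.left.orbit b 1 (𝓗.left.orbit 1 (𝓗.S a) (𝓗.left.γ i)) := by
      rw [← hi.γL_mul_left_eq, ← hi.γL_mul_left_eq, 𝓗.left.orbit_orbit, one_mul]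
    _ = 𝓗.left.orbit 1 (𝓗.S a) (𝓗.left.orbit 1 (𝓗.S b) (𝓗.left.γ i)) := by
      rw [← hi.γL_mul_left_eq b]
      simp only [𝓗.left.orbit_orbit, one_mul, mul_one]
    _ = _ := by rw [𝓗.left.orbit_orbit, one_mul]
  have actLStar_γL : 𝓗.left.actLStar ψ (𝓗.left.γ i) = 1 := hψ
  simpa only [𝓗.left.actLStar_orbit_right, actLStar_γL, one_mul] using
    congrArg (𝓗.left.actLStar ψ) orbit_S

theorem S_one : 𝓗.S 1 = 1 := by
  simpa only [mul_one, AddEquiv.apply_symm_apply] using (hi.S_mul hnd (𝓗.S.symm 1) 1).symm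

theorem antipodeSymmMul_γL (a : H) :
    𝓗.antipodeSymmMul (𝓗.left.γ a) = 𝓗.right.t (op (𝓗.right.π a)) := by
  have S_antipodeSymmMul (q : 𝓗.left.Sq) : 𝓗.S (𝓗.antipodeSymmMul q) = 𝓗.antipodeMul q :=
    DFunLike.congr_fun (hom_ext (f := 𝓗.S.toAddMonoidHom.comp 𝓗.antipodeSymmMul)
      (fun x y => (hi.S_mul hnd (𝓗.S.symm y) x).trans
        (congrArg (𝓗.S x * ·) (𝓗.S.apply_symm_apply y)))) q
  apply 𝓗.S.injective
  rw [S_antipodeSymmMul, antipodeMul_γL, ← one_mul (𝓗.right.t _), S_mul_tR, hi.S_one hnd, mul_one]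

theorem sum_S_symm_mul_γR (a : H) {n : ℕ} {x y : Fin n → H}
    (h : 𝓗.left.γ a = ∑ j, tmul _ _ (x j) (y j)) :
    ∑ j, 𝓗.right.orbit 1 (𝓗.S.symm (y j)) (𝓗.right.γ (x j)) = tmul _ _ a 1 := by
  obtain ⟨m, z, w, h'⟩ := exists_rep (𝓗.right.γ a)
  calc
    _ = ∑ k, tmul _ _ (z k) (𝓗.antipodeSymmMul (𝓗.left.γ (w k))) :=
      BalTensor₃.sum_apply_eq_sum_apply (fun v => 𝓗.right.orbit 1 (𝓗.S.symm v))
        (fun u => (tmulHom _ _ u).comp 𝓗.antipodeSymmMul)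
        (fun u v w => congrArg (tmul _ _ · (𝓗.S.symm w * v)) (one_mul u))
        (𝓗.coassoc_RL a n m x y z w h h')
    _ = ∑ k, tmul _ _ (z k * 𝓗.right.s (𝓗.right.π (w k))) 1 := by
      refine Finset.sum_congr rfl fun k _ => ?_
      rw [hi.antipodeSymmMul_γL hnd]
      exact (congrArg (tmul _ _ (z k)) (one_mul _)).symm.trans (smul_tmul _ _ _).symm
    _ = tmul _ _ a 1 := by rw [← sum_tmul, 𝓗.right.counit_right a m z w h']

theorem sum_S_symm_mul_γR_mul {n : ℕ} {x y : Fin n → H}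
    (h : 𝓗.left.γ i = ∑ j, tmul _ _ (x j) (y j)) (a : H) :
    ∑ j, 𝓗.right.orbit 1 (𝓗.S.symm (y j)) (𝓗.right.γ (x j * a)) = tmul _ _ i a := by
  obtain ⟨m, z, w, h'⟩ := exists_rep (𝓗.right.γ a)
  calc
    _ = 𝓗.right.diagAct a (tmul _ _ i 1) := by
      simp only [← hi.sum_S_symm_mul_γR hnd i h, map_sum, 𝓗.right.diagAct_orbit,
        𝓗.right.γ_mul_eq_diagAct]
    _ = ∑ k, tmul _ _ (i * z k) (w k) := by
      simp only [𝓗.right.diagAct_of_rep a _ _ z w h', op_smul_eq_mul, one_mul]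
    _ = ∑ k, tmul _ _ i (w k * 𝓗.right.t (op (𝓗.right.π (z k)))) := by
      refine Finset.sum_congr rfl fun k _ => ?_
      rw [hi (z k)]
      exact smul_tmul _ _ _
    _ = tmul _ _ i a := by rw [← tmul_sum, 𝓗.right.counit_left a m z w h']

end IsRightIntegral

section Convolution

variable {𝓗 : HopfAlgebroid H L R} {i : H}

/-- The element `_Li⁻¹(k)` of `_*𝓗`. -/
noncomputable def dualStarL (hnd : 𝓗.IsNondegenerate i) (k : H) : 𝓗.left.StarL :=
  (Equiv.ofBijective _ hnd.bijective_starL).symm k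

variable (hnd : 𝓗.IsNondegenerate i)

theorem hitStarL_dualStarL (k : H) : 𝓗.left.hitStarL (dualStarL hnd k) i = k :=
  (Equiv.ofBijective _ hnd.bijective_starL).apply_symm_apply k

theorem dualStarL_eq_of_hitStarL_eq {k : H} {φ : 𝓗.left.StarL} (h : 𝓗.left.hitStarL φ i = k) :
    dualStarL hnd k = φ :=
  (Equiv.ofBijective _ hnd.bijective_starL).symm_apply_eq.2 h.symm

theorem conv_eq_hitStarL (h k : H) : conv hnd h k = 𝓗.left.hitStarL (dualStarL hnd k) h := by
  change 𝓗.left.hitStarL (𝓗.left.mulStarL (dualStarL hnd h) (dualStarL hnd k)) i = _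
  rw [𝓗.left.hitStarL_mulStarL, hitStarL_dualStarL]

theorem exists_conv_eq_hitLStar (h : H) :
    ∃ ψ : 𝓗.left.LStar, ∀ k, conv hnd h k = 𝓗.left.hitLStar ψ k := by
  obtain ⟨ψ, rfl⟩ := hnd.bijective_lStar.2 h
  refine ⟨ψ, fun k => ?_⟩
  rw [conv_eq_hitStarL, 𝓗.left.hitStarL_hitLStar, hitStarL_dualStarL]

theorem conv_assoc (h k l : H) : conv hnd (conv hnd h k) l = conv hnd h (conv hnd k l) := by
  have dualStarL_conv : dualStarL hnd (conv hnd k l) =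
      𝓗.left.mulStarL (dualStarL hnd k) (dualStarL hnd l) := dualStarL_eq_of_hitStarL_eq hnd rfl
  rw [conv_eq_hitStarL hnd h (conv hnd k l), dualStarL_conv, 𝓗.left.hitStarL_mulStarL,
    ← conv_eq_hitStarL, ← conv_eq_hitStarL]

theorem integral_conv (k : H) : conv hnd i k = k := by
  rw [conv_eq_hitStarL, hitStarL_dualStarL]

theorem conv_integral (h : H) : conv hnd h i = h := by
  rw [conv_eq_hitStarL, dualStarL_eq_of_hitStarL_eq hnd (𝓗.left.hitStarL_counitStarL i),
    𝓗.left.hitStarL_counitStarL]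

theorem conv_sL_mul (l : L) (h k : H) :
    conv hnd (𝓗.left.s l * h) k = 𝓗.left.s l * conv hnd h k := by
  rw [conv_eq_hitStarL, conv_eq_hitStarL, 𝓗.left.hitStarL_s_mul]

theorem γR_conv_right (h k : H) {n : ℕ} {x y : Fin n → H}
    (hh : 𝓗.right.γ h = ∑ j, tmul _ _ (x j) (y j)) :
    𝓗.right.γ (conv hnd h k) = ∑ j, tmul _ _ (x j) (conv hnd (y j) k) := by
  simp only [conv_eq_hitStarL]
  exact 𝓗.γR_hitStarL _ h hh

theorem γR_conv_left (h k : H) {n : ℕ} {x y : Fin n → H}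
    (hk : 𝓗.right.γ k = ∑ j, tmul _ _ (x j) (y j)) :
    𝓗.right.γ (conv hnd h k) = ∑ j, tmul _ _ (conv hnd h (x j)) (y j) := by
  obtain ⟨ψ, hψ⟩ := exists_conv_eq_hitLStar hnd h
  simp only [hψ]
  exact 𝓗.γR_hitLStar ψ k hk

variable (hi : 𝓗.IsRightIntegral i)

include hi

theorem conv_eq_actStarL (h k : H) :
    conv hnd h k =
      𝓗.left.actStarL (dualStarL hnd 1) (𝓗.left.orbit 1 (𝓗.S k) (𝓗.left.γ h)) := by
  have dualStarL_eq : dualStarL hnd k = 𝓗.left.shiftStarL (dualStarL hnd 1) (𝓗.S k) := by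
    apply dualStarL_eq_of_hitStarL_eq
    rw [𝓗.left.hitStarL_shiftStarL, ← hi.γL_mul_left_eq, 𝓗.left.actStarL_orbit_left,
      ← 𝓗.left.hitStarL_eq_actStarL, hitStarL_dualStarL, one_mul]
  rw [conv_eq_hitStarL, dualStarL_eq, 𝓗.left.hitStarL_shiftStarL]

theorem conv_add_left (h h' k : H) : conv hnd (h + h') k = conv hnd h k + conv hnd h' k := by
  simp only [conv_eq_actStarL hnd hi, map_add]

theorem conv_add_right (h k k' : H) : conv hnd h (k + k') = conv hnd h k + conv hnd h k' := by
  simp only [conv_eq_actStarL hnd hi, map_add, 𝓗.left.orbit_add_right, AddMonoidHom.add_apply]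

theorem conv_mul_sR (h k : H) (r : R) :
    conv hnd (h * 𝓗.right.s r) k = conv hnd h (k * 𝓗.right.t (op r)) := by
  rw [conv_eq_actStarL hnd hi, conv_eq_actStarL hnd hi, γL_mul_sR, 𝓗.left.orbit_orbit, S_mul_tR,
    one_mul]

theorem sum_conv_mul_mul (h k a : H) {n : ℕ} {x y : Fin n → H}
    (ha : 𝓗.right.γ a = ∑ j, tmul _ _ (x j) (y j)) :
    ∑ j, conv hnd (h * x j) (k * y j) = conv hnd h k * a := by
  let act := 𝓗.left.actStarL (dualStarL hnd 1)
  calc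
    _ = ∑ j, act (𝓗.left.orbit 1 (𝓗.S k)
          (𝓗.left.diagAct h (𝓗.left.orbit 1 (𝓗.S (y j)) (𝓗.left.γ (x j))))) := by
      simp only [conv_eq_actStarL hnd hi, hi.S_mul hnd, 𝓗.left.γ_mul_eq_diagAct,
        𝓗.left.diagAct_orbit, 𝓗.left.orbit_orbit, one_mul, act]
    _ = act (𝓗.left.orbit 1 (𝓗.S k) (𝓗.left.orbit a 1 (𝓗.left.γ h))) := by
      simp only [← map_sum, 𝓗.sum_γL_mul_S a ha, 𝓗.left.diagAct_tmul]
    _ = act (𝓗.left.orbit a 1 (𝓗.left.orbit 1 (𝓗.S k) (𝓗.left.γ h))) := by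
      simp only [𝓗.left.orbit_orbit, one_mul, mul_one]
    _ = conv hnd h k * a := by
      rw [𝓗.left.actStarL_orbit_left, conv_eq_actStarL hnd hi]

end Convolution

end HopfAlgebroid

namespace RightBialgebroid

open BalTensor

variable {A R : Type u} [Ring A] [Ring R] {B : RightBialgebroid A R}

instance : Limits.HasFiniteBiproducts B.Mod :=
  inferInstanceAs (Limits.HasFiniteBiproducts (ModuleCat.{u} Aᵐᵒᵖ))

theorem Mod.lin_sum_apply {M N : B.Mod} {J : Type*} (s : Finset J) (f : J → (M ⟶ N)) (m : M) :
    Mod.lin (∑ j ∈ s, f j) m = ∑ j ∈ s, Mod.lin (f j) m :=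
  map_sum (AddMonoidHom.mk' (fun f : M ⟶ N => Mod.lin f m) (fun _ _ => rfl)) f s

theorem leftMul_mul (a b : A) : B.leftMul (a * b) = B.leftMul b ≫ B.leftMul a :=
  Mod.hom_ext' (LinearMap.ext (fun k : A => mul_assoc a b k))

theorem leftMul_add (a b : A) : B.leftMul (a + b) = B.leftMul a + B.leftMul b :=
  Mod.hom_ext' (LinearMap.ext (fun k : A => add_mul a b k))

theorem lin_leftMul_whiskerRight (a : A) (q : B.Sq) :
    (Mod.lin (B.leftMul a ▷ B.reg) q : B.Sq) = B.orbit (M := A) (N := A) a (1 : A) q :=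
  DFunLike.congr_fun (hom_ext (f := (Mod.lin (B.leftMul a ▷ B.reg)).toAddMonoidHom)
    (g := B.orbit (M := A) (N := A) a (1 : A)) (fun (x y : A) =>
      congrArg (tmul (rightAct B.s A) (leftAct B.t A) (a * x)) (one_mul y).symm)) q

theorem lin_whiskerLeft_leftMul (a : A) (q : B.Sq) :
    (Mod.lin (B.reg ◁ B.leftMul a) q : B.Sq) = B.orbit (M := A) (N := A) (1 : A) a q :=
  DFunLike.congr_fun (hom_ext (f := (Mod.lin (B.reg ◁ B.leftMul a)).toAddMonoidHom)
    (g := B.orbit (M := A) (N := A) (1 : A) a) (fun (x y : A) =>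
      congrArg (fun z => tmul (rightAct B.s A) (leftAct B.t A) z (a * y)) (one_mul x).symm)) q

theorem comulHom_comp_counitHom_whiskerRight :
    B.comulHom ≫ B.counitHom ▷ B.reg ≫ (λ_ B.reg).hom = 𝟙 B.reg :=
  Mod.hom_ext' (LinearMap.ext (fun a : A => by
    obtain ⟨n, x, y, h⟩ := exists_rep (B.γ a)
    change Mod.lin (B.counitHom ▷ B.reg ≫ (λ_ B.reg).hom) (B.γ a) = a
    rw [h]
    exact (map_sum _ _ _).trans (B.counit_left a n x y h)))

theorem comulHom_comp_whiskerLeft_counitHom :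
    B.comulHom ≫ B.reg ◁ B.counitHom ≫ (ρ_ B.reg).hom = 𝟙 B.reg :=
  Mod.hom_ext' (LinearMap.ext (fun a : A => by
    obtain ⟨n, x, y, h⟩ := exists_rep (B.γ a)
    change Mod.lin (B.reg ◁ B.counitHom ≫ (ρ_ B.reg).hom) (B.γ a) = a
    rw [h]
    exact (map_sum _ _ _).trans (B.counit_right a n x y h)))

end RightBialgebroid

namespace HopfAlgebroid

open BalTensor MonObj RightBialgebroid

variable {H R : Type u} {L : Type v} [Ring H] [Ring R] [Ring L] {𝓗 : HopfAlgebroid H L R}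
  {i : H} (hnd : 𝓗.IsNondegenerate i) (hi : 𝓗.IsRightIntegral i)

/-- The unit `η(r) = i s_R(r)` of the convolution monoid. -/
def unitHom (hi : 𝓗.IsRightIntegral i) : 𝟙_ 𝓗.right.Mod ⟶ 𝓗.right.reg :=
  Mod.ofLin (M := Mod.of 𝓗.right 𝓗.right.UnitMod) (N := 𝓗.right.reg)
    { toFun := fun r : R => (i * 𝓗.right.s r : H)
      map_add' := fun (r r' : R) => by
        change i * 𝓗.right.s (r + r') = i * 𝓗.right.s r + i * 𝓗.right.s r'
        rw [map_add, mul_add]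
      map_smul' := fun a (r : R) => by
        change i * 𝓗.right.s (𝓗.right.π (𝓗.right.s r * a.unop)) = i * 𝓗.right.s r * a.unop
        rw [← hi, _root_.mul_assoc] }

/-- The convolution product as a biadditive map. -/
noncomputable def convAddHom : H →+ H →+ H :=
  AddMonoidHom.mk' (fun h => AddMonoidHom.mk' (conv hnd h) (conv_add_right hnd hi h))
    (fun h h' => AddMonoidHom.ext (conv_add_left hnd hi h h'))

/-- The convolution product as a morphism `H_H ⊗ H_H ⟶ H_H`. -/
noncomputable def convHom : 𝓗.right.reg ⊗ 𝓗.right.reg ⟶ 𝓗.right.reg :=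
  Mod.ofLin (M := Mod.tensor 𝓗.right.reg 𝓗.right.reg) (N := 𝓗.right.reg)
    (𝓗.right.linOfTmul (M := H) (N := H) (P := H)
      (lift (convAddHom hnd hi) (fun r h k => conv_mul_sR hnd hi h k r))
      (fun a h k => by
        obtain ⟨n, x, y, ha⟩ := exists_rep (𝓗.right.γ a)
        rw [𝓗.right.smul_tmul_of_rep a h k x y ha, map_sum]
        exact sum_conv_mul_mul hnd hi h k a ha))

/-- The convolution monoid `(H_H, ∗, η)`. -/
noncomputable abbrev convMonObj : MonObj 𝓗.right.reg where
  one := unitHom hi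
  mul := convHom hnd hi
  one_mul := Mod.tensor_ext (fun (r : R) (m : H) => by
    change conv hnd (i * 𝓗.right.s r) m = m * 𝓗.right.t (op r)
    rw [conv_mul_sR hnd hi, integral_conv])
  mul_one := Mod.tensor_ext (fun (m : H) (r : R) => by
    change conv hnd m (i * 𝓗.right.s r) = m * 𝓗.right.s r
    rw [← hi.mul_t, ← conv_mul_sR hnd hi, conv_integral])
  mul_assoc := Mod.tensor_ext₃ (fun (h k l : H) => conv_assoc hnd h k l)

theorem isConvolution :
    letI := convMonObj hnd hi
    𝓗.IsConvolution hnd :=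
  letI := convMonObj hnd hi
  { mul := fun _ _ => rfl
    one := fun _ => rfl }

theorem isFrobeniusMonoid_conv :
    letI := convMonObj hnd hi
    IsFrobeniusMonoid 𝓗.right.reg 𝓗.right.comulHom 𝓗.right.counitHom :=
  letI := convMonObj hnd hi
  { whiskerLeft_comul_comp_mul := Mod.tensor_ext (fun (h k : H) => by
      obtain ⟨n, x, y, hk⟩ := exists_rep (𝓗.right.γ k)
      change Mod.lin ((α_ 𝓗.right.reg 𝓗.right.reg 𝓗.right.reg).inv ≫
        convHom hnd hi ▷ 𝓗.right.reg) (Mod.tm h (𝓗.right.γ k)) = 𝓗.right.γ (conv hnd h k)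
      rw [γR_conv_left hnd h k hk, hk]
      exact (congrArg _ (tmul_sum _ _ _)).trans (map_sum _ _ _))
    comul_whiskerRight_comp_mul := Mod.tensor_ext (fun (h k : H) => by
      obtain ⟨n, x, y, hh⟩ := exists_rep (𝓗.right.γ h)
      change Mod.lin ((α_ 𝓗.right.reg 𝓗.right.reg 𝓗.right.reg).hom ≫
        𝓗.right.reg ◁ convHom hnd hi) (Mod.tm (𝓗.right.γ h) k) = 𝓗.right.γ (conv hnd h k)
      rw [γR_conv_right hnd h k hh, hh]
      exact (congrArg _ (sum_tmul _ _ _)).trans (map_sum _ _ _))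
    counit_comul := comulHom_comp_counitHom_whiskerRight
    comul_counit := comulHom_comp_whiskerLeft_counitHom }

section QuasiBasis

variable {n : ℕ} {x y : Fin n → H}

theorem sum_leftMul_comulHom_whiskerRight (h : 𝓗.left.γ i = ∑ j, tmul _ _ (x j) (y j)) :
    ∑ j, 𝓗.right.leftMul (y j) ≫ 𝓗.right.comulHom ≫ 𝓗.right.leftMul (𝓗.S (x j)) ▷ 𝓗.right.reg =
      (ρ_ 𝓗.right.reg).inv ≫ 𝓗.right.reg ◁ unitHom hi :=
  Mod.hom_ext' (LinearMap.ext (fun a : H => calc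
    _ = ∑ j, 𝓗.right.orbit (𝓗.S (x j)) 1 (𝓗.right.γ (y j * a)) :=
      (Mod.lin_sum_apply (M := 𝓗.right.reg) _ _ a).trans
        (Finset.sum_congr rfl (fun j _ => lin_leftMul_whiskerRight _ (𝓗.right.γ (y j * a))))
    _ = tmul _ _ a i := hi.sum_S_mul_γR_mul h a
    _ = tmul _ _ a (i * 𝓗.right.s 1) := by rw [map_one, _root_.mul_one]))

include hnd in
theorem sum_leftMul_comulHom_whiskerLeft (h : 𝓗.left.γ i = ∑ j, tmul _ _ (x j) (y j)) :
    ∑ j, 𝓗.right.leftMul (x j) ≫ 𝓗.right.comulHom ≫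
        𝓗.right.reg ◁ 𝓗.right.leftMul (𝓗.S.symm (y j)) =
      (λ_ 𝓗.right.reg).inv ≫ unitHom hi ▷ 𝓗.right.reg :=
  Mod.hom_ext' (LinearMap.ext (fun a : H => calc
    _ = ∑ j, 𝓗.right.orbit 1 (𝓗.S.symm (y j)) (𝓗.right.γ (x j * a)) :=
      (Mod.lin_sum_apply (M := 𝓗.right.reg) _ _ a).trans
        (Finset.sum_congr rfl (fun j _ => lin_whiskerLeft_leftMul _ (𝓗.right.γ (x j * a))))
    _ = tmul _ _ i a := hi.sum_S_symm_mul_γR_mul hnd h a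
    _ = tmul _ _ (i * 𝓗.right.s 1) a := by rw [map_one, _root_.mul_one]))

end QuasiBasis

section LeftMultiplication

variable [MonObj 𝓗.right.reg]

theorem Lam_mul (a b : H) : 𝓗.Lam (a * b) = 𝓗.Lam b ≫ 𝓗.Lam a :=
  (congrArg (BIM.conj (Q := 𝓗.monReg)) (leftMul_mul a b)).trans (BIM.conj_comp _ _)

variable (𝓗) in
/-- `Λ` as an additive map. -/
noncomputable def LamHom : H →+ (𝓗.calX ≫ 𝓗.calXbar ⟶ 𝓗.calX ≫ 𝓗.calXbar) :=
  AddMonoidHom.mk' 𝓗.Lam (fun a b =>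
    (congrArg (BIM.conj (Q := 𝓗.monReg)) (leftMul_add a b)).trans (BIM.conj_add _ _))

variable {hnd} (hc : 𝓗.IsConvolution hnd)

include hc

theorem exists_Lam_sL_eq_whiskerRight (l : L) :
    ∃ e : 𝓗.calX ⟶ 𝓗.calX, 𝓗.Lam (𝓗.left.s l) = Bicategory.whiskerRight e 𝓗.calXbar :=
  ⟨_, BIM.conj_eq_extEnd_whiskerRight (Q := 𝓗.monReg) (𝓗.right.leftMul (𝓗.left.s l))
    (Mod.tensor_ext (fun (h k : H) =>
      (congrArg (fun z : H => 𝓗.left.s l * z) (hc.mul h k)).trans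
        ((conv_sL_mul hnd l h k).symm.trans (hc.mul (𝓗.left.s l * h) k).symm)))⟩

/-- The additive map `x ⊗ y ↦ Λ(S(x)) ⊗ Λ(y)`. -/
noncomputable def LamTensor : 𝓗.left.Sq →+ EndTensor 𝓗.calX 𝓗.calXbar :=
  lift (((tmulHom _ _).comp (𝓗.LamHom.comp 𝓗.S.toAddMonoidHom)).compl₂ 𝓗.LamHom)
    (fun l x y => by
      change tmul _ _ (𝓗.Lam (𝓗.S (𝓗.left.t (op l) * x))) (𝓗.Lam y) =
        tmul _ _ (𝓗.Lam (𝓗.S x)) (𝓗.Lam (𝓗.left.s l * y))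
      obtain ⟨e, he⟩ := exists_Lam_sL_eq_whiskerRight hc l
      rw [S_tL_mul, Lam_mul, Lam_mul, he]
      exact smul_tmul e _ _)

theorem LamTensor_sum_tmul {n : ℕ} (x y : Fin n → H) :
    LamTensor hc (∑ j, tmul _ _ (x j) (y j)) =
      ∑ j, tmul _ _ (𝓗.Lam (𝓗.S (x j))) (𝓗.Lam (y j)) :=
  map_sum _ _ _

end LeftMultiplication

end HopfAlgebroid

/-- Let `𝓗` be a Hopf algebroid with a non-degenerate right integral `i`. The convolution product
makes the right regular module a monoid `𝒬` of `ℳ_H`; the 1-cell `𝒳 = (H_H, l_H, ∗)` of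
`BIM(ℳ_H)` is Frobenius with two-sided dual `𝒳̄ = (H_H, ∗, r_H)`, it satisfies the (left and right)
D2 condition, and `Λ(S(i₁)) ⊗ Λ(i₂)` is a D2 quasi-basis. -/
theorem mainTheorem7 {H R : Type u} {L : Type v} [Ring H] [Ring R] [Ring L]
    (𝓗 : HopfAlgebroid H L R) (i : H) (hi : 𝓗.IsRightIntegral i) (hnd : 𝓗.IsNondegenerate i) :
    ∃ _ : MonObj 𝓗.right.reg, 𝓗.IsConvolution hnd ∧
      ∃ (adjL : Bicategory.Adjunction 𝓗.calX 𝓗.calXbar)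
        (adjR : Bicategory.Adjunction 𝓗.calXbar 𝓗.calX),
        𝓗.IsCanonicalDuality adjL adjR ∧
        IsLeftD2 𝓗.calX 𝓗.calXbar ∧ IsRightD2 𝓗.calX 𝓗.calXbar ∧
        ∃ q : EndTensor 𝓗.calX 𝓗.calXbar,
          (∀ (n : ℕ) (x y : Fin n → H), 𝓗.left.γ i = ∑ j, BalTensor.tmul _ _ (x j) (y j) →
            q = ∑ j, BalTensor.tmul _ _ (𝓗.Lam (𝓗.S (x j))) (𝓗.Lam (y j))) ∧
          IsD2QuasiBasis adjL.counit adjR.unit q := by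
  let := HopfAlgebroid.convMonObj hnd hi
  have hc : 𝓗.IsConvolution hnd := HopfAlgebroid.isConvolution hnd hi
  have frob : IsFrobeniusMonoid 𝓗.monReg.X 𝓗.right.comulHom 𝓗.right.counitHom :=
    HopfAlgebroid.isFrobeniusMonoid_conv hnd hi
  obtain ⟨m, x, y, hxy⟩ := BalTensor.exists_rep (𝓗.left.γ i)
  have left_sum := HopfAlgebroid.sum_leftMul_comulHom_whiskerRight hi hxy
  have right_sum := HopfAlgebroid.sum_leftMul_comulHom_whiskerLeft hnd hi hxy
  have eq_sum (n : ℕ) (x y : Fin n → H) (h : 𝓗.left.γ i = ∑ j, BalTensor.tmul _ _ (x j) (y j)) :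
      HopfAlgebroid.LamTensor hc (𝓗.left.γ i) =
        ∑ j, BalTensor.tmul _ _ (𝓗.Lam (𝓗.S (x j))) (𝓗.Lam (y j)) := by
    rw [h, HopfAlgebroid.LamTensor_sum_tmul]
  refine ⟨inferInstance, hc, BIM.mulAdjunction 𝓗.monReg, BIM.comulAdjunction frob,
    ⟨BIM.proj_comp_mulCell _, BIM.hom_oneCell_comp_multIso _, BIM.hom_counitCell _, rfl⟩,
    BIM.isLeftD2_of_sum_eq_id frob _ _ left_sum, BIM.isRightD2_of_sum_eq_id frob _ _ right_sum,
    HopfAlgebroid.LamTensor hc (𝓗.left.γ i), eq_sum, ?_⟩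
  rw [eq_sum m x y hxy]
  exact isD2QuasiBasis_sum_tmul (fun φ ψ => BIM.add_whiskerRight φ ψ _) _ _ _ _
    (BIM.sum_conj_whiskerRight_mul_comul_eq_id frob _ _ left_sum)
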